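/- **Networks.** Let $n\in\{1,2\}$. A network $\mathcal G$ in $\mathbb R^d$ consists of finitely many domains $\Omega_1,\dots,\Omega_N\subset\mathbb R^n$, each with its own coordinate system and placed in $\mathbb R^d$ by an isometry (we identify $\Omega_i$ with its image): bounded open segments if $n=1$ (edge-network), bounded connected polygons lying locally on one side of their boundary, without slits or pinched boundary points, if $n=2$ (plane-network). Further there is a finite set $\Gamma$ of bifurcations $\gamma$, which are points if $n=1$ and nondegenerate closed segments if $n=2$. With $I_\gamma=\{i:\gamma\subset\overline{\Omega_i}\}$, each $\gamma\in\Gamma$ satisfies $|I_\gamma|\ge 3$, $\gamma=\bigcap_{i\in I_\gamma}\overline{\Omega_i}$, and $\gamma\subset\partial\Omega_i$ for $i\in I_\gamma$. The domains meet only through bifurcations: if $x\in\overline{\Omega_i}\cap\overline{\Omega_j}$, then $i$ and $j$ are linked by a chain of indices in which any two consecutive ones lie in $I_\gamma$ for some $\gamma\in\Gamma$ with $x\in\gamma$. Let $D_\gamma=\{(i,j)\in I_\gamma^2: i<j\}$, and let $\partial\mathcal G$ be the closure of $\bigcup_i\partial\Omega_i\setminus\bigcup_{\gamma\in\Gamma}\gamma$.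 The space $H^1_0(\mathcal G)$ consists of the families $v=(v_i)$ with $v_i\in H^1(\Omega_i)$ whose traces satisfy $v_i=v_j$ on $\gamma$ for all $i,j\in I_\gamma$, $\gamma\in\Gamma$, and $v_i=0$ on $\partial\Omega_i\cap\partial\mathcal G$. **Meshes.** Let $\mathcal T_h=\bigcup_i\mathcal T_{h,i}$, where $\mathcal T_{h,i}$ is a finite partition of $\overline{\Omega_i}$ into closed intervals ($n=1$) or triangles ($n=2$); the mesh is conforming, also across the domains (any two elements of $\mathcal T_h$ are disjoint or meet in a common vertex or edge). Let $h=\max_K\operatorname{diam}K$. The mesh is shape-regular with constant $\rho>0$: each $K$ contains a ball of radius at least $\operatorname{diam}(K)/\rho$, and if $n=1$ the lengths of any two elements of $\mathcal T_h$ sharing a node (possibly a bifurcation) differ at most by the factor $\rho$. The faces $F$ are the mesh points ($n=1$) or edges ($n=2$): $\mathcal F_{h,i}^{\rm int}$ are those shared by two elements of $\mathcal T_{h,i}$, $\mathcal F_{h,i}^{\partial\mathcal G}$ those of elements of $\mathcal T_{h,i}$ that lie on $\partial\mathcal G$, and $\mathcal F_h^\gamma$ those contained in $\gamma$. For $n=2$,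 $h_F$ is the length of $F$; for $n=1$, $h_F$ is the maximal length of the mesh elements at the point $F$ (also at bifurcations). For $n=1$, $\|\cdot\|_{L^2(F)}$ is the absolute value at $F$. Let $V_h^1$ be the space of $v\in L^2$ with $v|_K$ a polynomial of degree at most one for all $K\in\mathcal T_h$. For penalty parameters $\eta_{F,i},\eta_\gamma\ge\eta_0>0$ and $v\in V_h^1$ set $$\|v\|_{\mathrm{DG}}^2=\sum_{i=1}^N\Big(\sum_{K\in\mathcal T_{h,i}}\|\nabla v\|_{L^2(K)}^2+\sum_{F\in\mathcal F_{h,i}^{\rm int}}\frac{\eta_{F,i}}{h_F}\|[v_i]\|_{L^2(F)}^2+\sum_{F\in\mathcal F_{h,i}^{\partial\mathcal G}}\frac{\eta_{F,i}}{h_F}\|v_i\|_{L^2(F)}^2\Big)+\sum_{\gamma\in\Gamma}\eta_\gamma\sum_{F\in\mathcal F_h^\gamma}\frac1{h_F}\sum_{(i,j)\in D_\gamma}\|v_i-v_j\|_{L^2(F)}^2,$$ where $[v_i]$ is the difference of the traces from the two elements at $F$. **Enriching map.** Let $\mathcal N_h$ be the set of mesh vertices not on $\partial\mathcal G$, $\omega_z$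 the set of elements (of all domains) having the vertex $z$, and $\varphi_z$ the continuous, elementwise affine nodal basis function at $z$ (value $1$ at $z$ and $0$ at all other vertices). For $v\in V_h^1$ set $$E_hv=\sum_{z\in\mathcal N_h}\Big(\frac1{\operatorname{card}(\omega_z)}\sum_{K\in\omega_z}v|_K(z)\Big)\varphi_z .$$ **Lemma.** For every network $\mathcal G$ and all $\rho,\eta_0>0$ there is a constant $C>0$ such that for every mesh of $\mathcal G$ that is conforming and shape-regular with constant $\rho$, all penalty parameters $\eta_{F,i},\eta_\gamma\ge\eta_0$ and all $v\in V_h^1$: 1. $E_hv\in V_h^1\cap H_0^1(\mathcal G)$, and $(E_hv)|_{K}(z)=\frac1{\operatorname{card}(\omega_z)}\sum_{K'\in\omega_z}v|_{K'}(z)$ for all $z\in\mathcal N_h$ and $K\in\omega_z$; 2. $\big(\sum_{i=1}^N\|E_hv-v\|_{L^2(\Omega_i)}^2\big)^{1/2}\le C\,h\,\|v\|_{\mathrm{DG}}$; 3. $\big(\sum_{i=1}^N\|\nabla E_hv\|_{L^2(\Omega_i)}^2\big)^{1/2}\le C\,\|v\|_{\mathrm{DG}}$. -/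

import Mathlib

open Set Filter Topology MeasureTheory
open scoped ContDiff Gradient Classical

noncomputable section

namespace HyperDG

/-- Euclidean space `ℝᵏ`. -/
abbrev E (k : ℕ) := EuclideanSpace ℝ (Fin k)

/-! ### Sobolev functions on an open subset of `ℝⁿ` -/

/-- `W` is a weak gradient of `w` on `Ω`. -/
def HasWeakGradient {n : ℕ} (Ω : Set (E n)) (w : E n → ℝ) (W : E n → E n) : Prop :=
  LocallyIntegrableOn w Ω ∧ LocallyIntegrableOn W Ω ∧
    ∀ φ : E n → ℝ, ContDiff ℝ ∞ φ → HasCompactSupport φ → tsupport φ ⊆ Ω →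
      ∫ x in Ω, w x • ∇ φ x = - ∫ x in Ω, φ x • W x

/-- `w ∈ H¹(Ω)`. -/
def MemH1 {n : ℕ} (Ω : Set (E n)) (w : E n → ℝ) : Prop :=
  MemLp w 2 (volume.restrict Ω) ∧
    ∃ W, HasWeakGradient Ω w W ∧ MemLp W 2 (volume.restrict Ω)

/-- The weak gradient of `w` on `Ω` (unique almost everywhere in `Ω`); zero if there is none. -/
def weakGrad {n : ℕ} (Ω : Set (E n)) (w : E n → ℝ) : E n → E n :=
  if h : ∃ W, HasWeakGradient Ω w W then h.choose else 0

/-- `g ∈ L²(∂Ω)` is the trace of `w ∈ H¹(Ω)`. The trace operator is the continuous extension to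
`H¹(Ω)` of the restriction `u ↦ u|_{∂Ω}` defined on `H¹(Ω) ∩ C(closure Ω)`. -/
def HasTrace {n : ℕ} (Ω : Set (E n)) (w g : E n → ℝ) : Prop :=
  MemLp g 2 (μH[(n : ℝ) - 1].restrict (frontier Ω)) ∧
  ∃ (u : ℕ → E n → ℝ) (U : ℕ → E n → E n) (W : E n → E n),
    (∀ k, ContinuousOn (u k) (closure Ω) ∧ MemLp (u k) 2 (volume.restrict Ω) ∧
      HasWeakGradient Ω (u k) (U k) ∧ MemLp (U k) 2 (volume.restrict Ω)) ∧
    HasWeakGradient Ω w W ∧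
    Tendsto (fun k => eLpNorm (u k - w) 2 (volume.restrict Ω)) atTop (𝓝 0) ∧
    Tendsto (fun k => eLpNorm (U k - W) 2 (volume.restrict Ω)) atTop (𝓝 0) ∧
    Tendsto (fun k => eLpNorm (u k - g) 2 (μH[(n : ℝ) - 1].restrict (frontier Ω)))
      atTop (𝓝 0)

/-! ### Networks -/

/-- For `n = 1` a bounded open interval, for `n = 2` a (Lipschitz) polygonal domain: a bounded
domain whose boundary lies in finitely many points (lines) and which lies on one side of its
boundary (no slits) and is locally connected at its boundary (no pinching). -/
structure IsPolytopalDomain {n : ℕ} (Ω : Set (E n)) : Prop where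
  isOpen : IsOpen Ω
  isConnected : IsConnected Ω
  isBounded : Bornology.IsBounded Ω
  frontier_subset : ∃ A : Set (AffineSubspace ℝ (E n)), A.Finite ∧
    (∀ P ∈ A, Module.finrank ℝ P.direction + 1 = n) ∧ frontier Ω ⊆ ⋃ P ∈ A, (P : Set (E n))
  interior_closure : interior (closure Ω) = Ω
  locally_connected : ∀ x ∈ frontier Ω, ∀ᶠ r in 𝓝[>] (0 : ℝ),
    IsPreconnected (Ω ∩ Metric.ball x r)

/-- A network in `ℝᵈ`: an edge-network for `n = 1`, a plane-network for `n = 2`. Each domain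
`Ω i` is given in its own coordinate system `ℝⁿ` and is placed in `ℝᵈ` by an isometry `Φ i`. -/
structure Network (n d N : ℕ) where
  /-- the segments (`n = 1`) or polygons (`n = 2`) -/
  Ω : Fin N → Set (E n)
  /-- their placement in the ambient space -/
  Φ : Fin N → E n →ᵃⁱ[ℝ] E d
  /-- the bifurcations -/
  Γ : Finset (Set (E d))
  polytopal : ∀ i, IsPolytopalDomain (Ω i)
  /-- bifurcations are points (`n = 1`) or nondegenerate closed segments (`n = 2`) -/
  bif_shape : ∀ γ ∈ Γ, ∃ s : Finset (E d), s.card = n ∧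
    AffineIndependent ℝ ((↑) : s → E d) ∧ γ = convexHull ℝ (s : Set (E d))
  /-- a bifurcation belongs to at least three domains -/
  bif_card : ∀ γ ∈ Γ, 3 ≤ (Finset.univ.filter fun i => γ ⊆ Φ i '' closure (Ω i)).card
  /-- a bifurcation is the intersection of the closed domains that contain it -/
  bif_eq : ∀ γ ∈ Γ, γ = ⋂ i ∈ {i | γ ⊆ Φ i '' closure (Ω i)}, Φ i '' closure (Ω i)
  /-- a bifurcation lies in the boundaries of the domains that contain it -/
  bif_frontier : ∀ γ ∈ Γ, ∀ i, γ ⊆ Φ i '' closure (Ω i) → γ ⊆ Φ i '' frontier (Ω i)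
  /-- the domains meet only through bifurcations: two domains that meet at `x` are linked by
  a chain of domains in which consecutive ones share a bifurcation through `x` -/
  meet : ∀ x i j, x ∈ Φ i '' closure (Ω i) → x ∈ Φ j '' closure (Ω j) →
    Relation.ReflTransGen (fun a b => ∃ γ ∈ Γ, x ∈ γ ∧
      γ ⊆ Φ a '' closure (Ω a) ∧ γ ⊆ Φ b '' closure (Ω b)) i j

namespace Network

variable {n d N : ℕ} (G : Network n d N)

/-- The closed domain `i` in the ambient space. -/
def surf (i : Fin N) : Set (E d) := G.Φ i '' closure (G.Ω i)

/-- The coordinates, in the coordinate system of domain `i`, of a point of its plane. -/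
def coord (i : Fin N) : E d → E n := Function.invFun (G.Φ i)

/-- `I_γ`, the indices of the domains whose closure contains `γ`. -/
def I (γ : Set (E d)) : Finset (Fin N) := Finset.univ.filter fun i => γ ⊆ G.surf i

/-- `D_γ`, the pairs `i < j` of indices in `I_γ`. -/
def D (γ : Set (E d)) : Finset (Fin N × Fin N) :=
  Finset.univ.filter fun p => p.1 < p.2 ∧ p.1 ∈ G.I γ ∧ p.2 ∈ G.I γ

/-- `∂G`, the union of the boundaries of the domains without the bifurcations, as a closed set:
the union of the nodes (closed boundary segments) that belong to one domain only. -/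
def boundary : Set (E d) :=
  closure ((⋃ i, G.Φ i '' frontier (G.Ω i)) \ ⋃ γ ∈ G.Γ, γ)

/-- `v ∈ H¹₀(G)`. A function on the network is a family of functions on the domains. -/
def MemH10 (v : Fin N → E n → ℝ) : Prop :=
  (∀ i, MemH1 (G.Ω i) (v i)) ∧
  ∃ g : Fin N → E n → ℝ, (∀ i, HasTrace (G.Ω i) (v i) (g i)) ∧
    (∀ γ ∈ G.Γ, ∀ i ∈ G.I γ, ∀ j ∈ G.I γ, ∀ᵐ x ∂(μH[(n : ℝ) - 1].restrict γ),
      g i (G.coord i x) = g j (G.coord j x)) ∧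
    ∀ i, ∀ᵐ x ∂(μH[(n : ℝ) - 1].restrict (G.Φ i '' frontier (G.Ω i) ∩ G.boundary)),
      g i (G.coord i x) = 0

/-- A conforming simplicial mesh of the network. An element is given by its set of vertices, in
the coordinates of its domain; as a set, it is the closed simplex spanned by them. The meshes of
different domains match where the domains meet. -/
structure Mesh where
  /-- the elements of each domain -/
  T : Fin N → Finset (Finset (E n))
  card_eq : ∀ i, ∀ K ∈ T i, K.card = n + 1
  indep : ∀ i, ∀ K ∈ T i, AffineIndependent ℝ ((↑) : K → E n)
  cover : ∀ i, ⋃ K ∈ T i, convexHull ℝ (K : Set (E n)) = closure (G.Ω i)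
  conforming : ∀ i j, ∀ K ∈ T i, ∀ L ∈ T j,
    G.Φ i '' convexHull ℝ (K : Set (E n)) ∩ G.Φ j '' convexHull ℝ (L : Set (E n)) ⊆
      convexHull ℝ (G.Φ i '' (K : Set (E n)) ∩ G.Φ j '' (L : Set (E n)))

end Network

/-! ### Piecewise affine functions -/

/-- The diameter of an element or the length of an edge. -/
def size {k : ℕ} (K : Finset (E k)) : ℝ := Metric.diam (convexHull ℝ (K : Set (E k)))

/-- `w` agrees on the element `K` with the polynomial `p` of degree at most one. -/
def AgreesOn {n : ℕ} (w : E n → ℝ) (K : Finset (E n)) (p : E n →ᵃ[ℝ] ℝ) : Prop :=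
  w =ᵐ[volume.restrict (convexHull ℝ (K : Set (E n)))] p

/-- `w|_K` as a polynomial, if `w` agrees on the element `K` with a (unique) polynomial of degree
at most one. -/
def elemPoly {n : ℕ} (w : E n → ℝ) (K : Finset (E n)) : E n →ᵃ[ℝ] ℝ :=
  if h : ∃ p, AgreesOn w K p then h.choose else 0

namespace Network.Mesh

variable {n d N : ℕ} {G : Network n d N} (M : G.Mesh)

/-- All elements, each with the index of its domain. -/
def elems : Finset (Σ _ : Fin N, Finset (E n)) := Finset.univ.sigma M.T

/-- The overall mesh size `h`. -/
def h : ℝ := ⨆ p : M.elems, size p.1.2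

/-- The set of vertices, in the ambient space, of an element. -/
def emb (_ : G.Mesh) (p : Σ _ : Fin N, Finset (E n)) : Finset (E d) := p.2.image (G.Φ p.1)

/-- Shape regularity with constant `ρ`: each element contains a ball of radius at least `1 / ρ`
times its diameter; for intervals, where this says nothing, the lengths of two elements that
share a node are within the factor `ρ`. -/
def ShapeRegular (ρ : ℝ) : Prop :=
  (∀ p ∈ M.elems, ∃ c, Metric.closedBall c (size p.2 / ρ) ⊆ convexHull ℝ (p.2 : Set (E n))) ∧
  (n = 1 → ∀ p ∈ M.elems, ∀ q ∈ M.elems, (M.emb p ∩ M.emb q).Nonempty →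
    size p.2 ≤ ρ * size q.2)

/-- `v ∈ V_h^1`. -/
def MemV (v : Fin N → E n → ℝ) : Prop :=
  ∀ i, MemLp (v i) 2 (volume.restrict (G.Ω i)) ∧ ∀ K ∈ M.T i, ∃ p, AgreesOn (v i) K p

/-- The value at a point of the ambient space of the polynomial `v|_K`, for an element `K` of
domain `i`. -/
def val (_ : G.Mesh) (v : Fin N → E n → ℝ) (i : Fin N) (K : Finset (E n)) (x : E d) : ℝ :=
  elemPoly (v i) K (G.coord i x)

/-! #### Faces: points for `n = 1`, edges for `n = 2`, given by their vertices in `ℝᵈ` -/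

/-- All mesh faces. -/
def faces : Finset (Finset (E d)) := M.elems.biUnion fun p => (M.emb p).powersetCard n

/-- The elements of domain `i` that have the face `F`. -/
def elemsAt (i : Fin N) (F : Finset (E d)) : Finset (Finset (E n)) :=
  (M.T i).filter fun K => F ⊆ M.emb ⟨i, K⟩

/-- The interior faces of domain `i`, shared by two elements of it. -/
def intFaces (i : Fin N) : Finset (Finset (E d)) :=
  M.faces.filter fun F => 2 ≤ (M.elemsAt i F).card

/-- The faces of domain `i` on `∂G`. -/
def bdFaces (i : Fin N) : Finset (Finset (E d)) :=
  M.faces.filter fun F =>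
    (M.elemsAt i F).Nonempty ∧ convexHull ℝ (F : Set (E d)) ⊆ G.boundary

/-- The faces that partition the bifurcation `γ`. -/
def bifFaces (γ : Set (E d)) : Finset (Finset (E d)) :=
  M.faces.filter fun F => convexHull ℝ (F : Set (E d)) ⊆ γ

/-- `h_F`: for `n = 1` the maximal length of the elements at the point `F` (at a bifurcation this
is `h_γ`), for `n = 2` the length of the edge `F`. -/
def hF (F : Finset (E d)) : ℝ :=
  if n = 1 then ⨆ p : M.elems.filter (fun p => F ⊆ M.emb p), size p.1.2 else size F

/-- `‖f‖²` in `L²(F)`; for `n = 1` this is the square of the value of `f` at the point `F`. -/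
def faceSq (_ : G.Mesh) (F : Finset (E d)) (f : E d → ℝ) : ℝ :=
  ∫ x in convexHull ℝ (F : Set (E d)), f x ^ 2 ∂μH[(n : ℝ) - 1]

/-- `‖v‖²_{DG,i}`. An interior face is counted once for each order of its two elements, hence the
factor `1 / 2`; a face on `∂G` belongs to one element of domain `i`. -/
def dgSqDom (ηF : Fin N → Finset (E d) → ℝ) (v : Fin N → E n → ℝ) (i : Fin N) : ℝ :=
  ∑ K ∈ M.T i, (∫ x in convexHull ℝ (K : Set (E n)), ‖∇ (elemPoly (v i) K : E n → ℝ) x‖ ^ 2) +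
  ∑ F ∈ M.intFaces i, ηF i F / M.hF F *
    (1 / 2 * ∑ q ∈ (M.elemsAt i F).offDiag,
      M.faceSq F fun x => M.val v i q.1 x - M.val v i q.2 x) +
  ∑ F ∈ M.bdFaces i, ηF i F / M.hF F * ∑ K ∈ M.elemsAt i F, M.faceSq F fun x => M.val v i K x

/-- The DG norm, with penalty parameters `ηF i F` for the faces on and inside the domains and
`ηΓ γ` for the bifurcations. A face on a bifurcation `γ` belongs to exactly one element of each
domain `i ∈ I_γ`. -/
def dgNorm (ηF : Fin N → Finset (E d) → ℝ) (ηΓ : Set (E d) → ℝ) (v : Fin N → E n → ℝ) : ℝ :=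
  Real.sqrt (∑ i, M.dgSqDom ηF v i +
    ∑ γ ∈ G.Γ, ηΓ γ * ∑ F ∈ M.bifFaces γ, 1 / M.hF F * ∑ p ∈ G.D γ,
      ∑ K ∈ M.elemsAt p.1 F, ∑ L ∈ M.elemsAt p.2 F,
        M.faceSq F fun x => M.val v p.1 K x - M.val v p.2 L x)

/-! #### The enriching map -/

/-- `N_h`, the mesh vertices that do not belong to `∂G`. -/
def nodes : Finset (E d) := (M.elems.biUnion M.emb).filter fun z => z ∉ G.boundary

/-- `ω_z`, the elements (of all domains) that have the vertex `z`. -/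
def patch (z : E d) : Finset (Σ _ : Fin N, Finset (E n)) := M.elems.filter fun p => z ∈ M.emb p

/-- The nodal value `E_h v (z)`: the mean of the values at `z` of `v` on the elements at `z`. -/
def nodalAvg (v : Fin N → E n → ℝ) (z : E d) : ℝ :=
  ((M.patch z).card : ℝ)⁻¹ * ∑ p ∈ M.patch z, M.val v p.1 p.2 z

/-- The polynomial of degree one on the element `K` of domain `i` whose value is one at the
vertex `z` and zero at the other vertices (zero if `z` is not a vertex of `K`). -/
def bary (_ : G.Mesh) (i : Fin N) (K : Finset (E n)) (z : E d) : E n →ᵃ[ℝ] ℝ :=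
  if h : ∃ p : E n →ᵃ[ℝ] ℝ, ∀ y ∈ K, p y = if G.Φ i y = z then 1 else 0 then h.choose else 0

/-- The nodal basis function `φ_z`, which equals `bary i K z` on each closed element `K` of each
domain `i`. -/
def hat (z : E d) (i : Fin N) (x : E n) : ℝ :=
  if h : ∃ K ∈ M.T i, x ∈ convexHull ℝ (K : Set (E n)) then M.bary i h.choose z x else 0

/-- The enriching map `E_h`. -/
def enrich (v : Fin N → E n → ℝ) (i : Fin N) (x : E n) : ℝ :=
  ∑ z ∈ M.nodes, M.nodalAvg v z * M.hat z i x

end Network.Mesh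

end HyperDG

end

/-! Conformity. On each element `E_h v` is the affine function with the vertex values `nodeVal`: the
patch average off `∂G`, zero on `∂G`. These values depend on the vertex alone, and two elements meet
in the hull of their common vertices. Hence `E_h v` is continuous on each closed domain,
single-valued where domains meet, and zero on `∂G` (`enrich_eq_of_eq`,
`enrich_eq_zero_of_boundary`). A continuous piecewise affine function has its elementwise gradient
as weak gradient (`hasWeakGradient_piecewise`) and is its own trace.

Estimates. On an element of size `s` the difference `E_h v - v` is affine, so its squared `L²` norm
is bounded by `s ^ n`, and that of its gradient by `s ^ n / s ^ 2`, times its squared vertex values.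
Both bounds follow once the sum of the `vertexDefect`s is controlled by the squared DG norm
(`sum_vertexDefect_le`). At a node the difference is a mean of differences of values of `v` on two
elements of the patch. Each of these telescopes along a chain of elements through common faces at
the vertex, and the jump at an endpoint of a face is bounded by its `L²` norm on the face
(`faceSq_ge`). At a vertex on `∂G` the chain starts at a penalised boundary face (`exists_bdFace`).
Shape regularity bounds the number of elements at a vertex (`card_patch_le`), hence the length of
the chains and the multiplicity with which faces are counted.

Chains. The geometric core is that such chains exist (`linked_of_mem_patch`); the plane case is the
substantial one. In one domain, a small punctured neighbourhood of the vertex is connected, so the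
elements cannot split into two classes without a common edge there. Two domains sharing a
bifurcation share an edge on it: a point of the bifurcation near the vertex has the same minimal
face in both meshes. The condition `meet` joins the domains at the vertex by such steps. The tool
throughout is the minimal face of a point, expressed by `PosCombo`. -/

noncomputable section

namespace HyperDG

/-! ### Convex combinations with positive weights -/

section PosCombo

variable {V : Type*} [NormedAddCommGroup V] [NormedSpace ℝ V]

/-- `x` lies in the relative interior of the simplex spanned by `F`. -/
def PosCombo (F : Finset V) (x : V) : Prop :=
  ∃ w : V → ℝ, (∀ a ∈ F, 0 < w a) ∧ ∑ a ∈ F, w a = 1 ∧ ∑ a ∈ F, w a • a = x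

lemma PosCombo.nonempty {F : Finset V} {x : V} (h : PosCombo F x) : F.Nonempty := by
  obtain ⟨w, -, h1, -⟩ := h
  rw [Finset.nonempty_iff_ne_empty]
  rintro rfl
  simp at h1

lemma PosCombo.mem_convexHull {F : Finset V} {x : V} (h : PosCombo F x) :
    x ∈ convexHull ℝ (F : Set V) := by
  obtain ⟨w, h0, h1, h2⟩ := h
  exact Finset.mem_convexHull'.2 ⟨w, fun a ha => (h0 a ha).le, h1, h2⟩

lemma exists_posCombo {A : Finset V} {x : V} (h : x ∈ convexHull ℝ (A : Set V)) :
    ∃ F ⊆ A, PosCombo F x := by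
  obtain ⟨w, h0, h1, h2⟩ := Finset.mem_convexHull'.1 h
  refine ⟨A.filter fun a => w a ≠ 0, Finset.filter_subset _ _, w, ?_, ?_, ?_⟩
  · intro a ha
    rw [Finset.mem_filter] at ha
    exact lt_of_le_of_ne (h0 a ha.1) (Ne.symm ha.2)
  · rw [Finset.sum_filter_ne_zero, h1]
  · rw [← h2]
    refine Finset.sum_filter_of_ne fun a _ hne h => hne ?_
    rw [h, zero_smul]

lemma posCombo_singleton (z : V) : PosCombo {z} z :=
  ⟨fun _ => 1, by simp, by simp, by simp⟩

lemma PosCombo.eq_of_singleton {z x : V} (h : PosCombo {z} x) : x = z := by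
  simpa using h.mem_convexHull

/-- A vertex `a` of `F` outside `T` has positive weight in `x`, so it lies on the line through `x`
and the centre of mass of the other vertices of `F`. Both points are in the affine span of `A`
without `a`, against affine independence. -/
lemma PosCombo.subset {A F T : Finset V} {x : V} (hA : AffineIndependent ℝ ((↑) : A → V))
    (hF : F ⊆ A) (hT : T ⊆ A) (h : PosCombo F x) (hx : x ∈ convexHull ℝ (T : Set V)) :
    F ⊆ T := by
  intro a ha
  by_contra haT
  obtain ⟨w, h0, h1, h2⟩ := h
  have hTA : (T : Set V) ⊆ (A : Set V) \ {a} := fun t ht =>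
    ⟨hT ht, fun hta => haT (by rw [mem_singleton_iff] at hta; exact hta ▸ ht)⟩
  set B : AffineSubspace ℝ V := affineSpan ℝ ((A : Set V) \ {a}) with hB
  have hxB : x ∈ B := affineSpan_mono ℝ hTA (convexHull_subset_affineSpan _ hx)
  have hna : a ∉ B := by
    have := hA.notMem_affineSpan_sdiff ⟨a, hF ha⟩ Set.univ
    convert this using 2
    rw [hB]
    congr 1
    ext y
    simp only [Set.mem_sdiff, mem_singleton_iff, mem_image, mem_univ, true_and, Subtype.exists]
    constructor
    · rintro ⟨hy, hya⟩
      exact ⟨y, hy, by simpa using hya, rfl⟩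
    · rintro ⟨y', hy', hne, rfl⟩
      exact ⟨hy', by simpa using hne⟩
  have hsum := Finset.add_sum_erase F w ha
  have hsum2 := Finset.add_sum_erase F (fun a => w a • a) ha
  rw [h1] at hsum
  rw [h2] at hsum2
  by_cases hE : (F.erase a).Nonempty
  · have hpos : 0 < ∑ b ∈ F.erase a, w b :=
      Finset.sum_pos (fun b hb => h0 b (Finset.mem_of_mem_erase hb)) hE
    set σ := ∑ b ∈ F.erase a, w b with hσ
    have hy : (F.erase a).centerMass w id ∈ B := by
      refine convexHull_subset_affineSpan _ (Finset.centerMass_mem_convexHull _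
        (fun b hb => (h0 b (Finset.mem_of_mem_erase hb)).le) hpos fun b hb => ?_)
      exact ⟨hF (Finset.mem_of_mem_erase hb), Finset.ne_of_mem_erase hb⟩
    have hy' : σ • (F.erase a).centerMass w id = ∑ b ∈ F.erase a, w b • b := by
      rw [Finset.centerMass, smul_smul, mul_inv_cancel₀ hpos.ne', one_smul]; rfl
    set y := (F.erase a).centerMass w id with hyd
    rw [← hy'] at hsum2
    have : a = AffineMap.lineMap y x ((w a)⁻¹) := by
      have hwa := (h0 a ha).ne'
      have hs : σ = 1 - w a := by linarith
      rw [AffineMap.lineMap_apply, ← hsum2, hs, vsub_eq_sub, vadd_eq_add]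
      match_scalars <;> field_simp <;> ring
    exact hna (this ▸ AffineMap.lineMap_mem _ hy hxB)
  · rw [Finset.not_nonempty_iff_eq_empty] at hE
    rw [hE] at hsum hsum2
    simp only [Finset.sum_empty, add_zero] at hsum hsum2
    rw [hsum, one_smul] at hsum2
    exact hna (hsum2 ▸ hxB)

/-- Any positive share of `x` makes all weights positive; every point of the closed simplex is thus
a limit of points of the relative interior. -/
lemma PosCombo.lineMap {F : Finset V} {x y : V} (h : PosCombo F x)
    (hy : y ∈ convexHull ℝ (F : Set V)) {t : ℝ} (h0 : 0 < t) (h1 : t ≤ 1) :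
    PosCombo F (AffineMap.lineMap y x t) := by
  obtain ⟨w, hw0, hw1, hw2⟩ := h
  obtain ⟨u, hu0, hu1, hu2⟩ := Finset.mem_convexHull'.1 hy
  refine ⟨fun a => (1 - t) * u a + t * w a, fun a ha => ?_, ?_, ?_⟩
  · have := mul_nonneg (sub_nonneg.2 h1) (hu0 a ha)
    have := mul_pos h0 (hw0 a ha)
    linarith
  · rw [Finset.sum_add_distrib, ← Finset.mul_sum, ← Finset.mul_sum, hw1, hu1]
    ring
  · simp only [add_smul, mul_smul]
    rw [Finset.sum_add_distrib, ← Finset.smul_sum, ← Finset.smul_sum, hw2, hu2,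
      AffineMap.lineMap_apply_module]

/-- The segment from `y` to `x` can be prolonged beyond `x` inside the simplex. Since `y` keeps the
positive weight `1 - s`, the homothety with centre `b` carries a neighbourhood of `y` to one of `x`.
-/
lemma PosCombo.exists_extend {F : Finset V} {x y : V} (h : PosCombo F x)
    (hy : y ∈ convexHull ℝ (F : Set V)) :
    ∃ b ∈ convexHull ℝ (F : Set V), ∃ s : ℝ, 0 ≤ s ∧ s < 1 ∧ x = (1 - s) • y + s • b := by
  have hne := h.nonempty
  obtain ⟨w, hw0, hw1, hw2⟩ := h
  obtain ⟨u, hu0, hu1, hu2⟩ := Finset.mem_convexHull'.1 hy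
  obtain ⟨a0, ha0, hmin⟩ := F.exists_min_image w hne
  -- As `ε ≤ w a` and `u a ≤ 1`, the weights `w a - ε * u a` stay nonnegative; the cap `1 / 2` keeps
  -- `1 - ε` positive.
  set ε := min (w a0) (1 / 2) with hε
  have hε0 : 0 < ε := lt_min (hw0 a0 ha0) (by norm_num)
  have hε1 : ε ≤ 1 / 2 := min_le_right _ _
  have hs : 0 < 1 - ε := by linarith
  have hule : ∀ a ∈ F, u a ≤ 1 := fun a ha => hu1 ▸ Finset.single_le_sum hu0 ha
  refine ⟨∑ a ∈ F, ((1 - ε)⁻¹ * (w a - ε * u a)) • a, ?_, 1 - ε, hs.le, by linarith, ?_⟩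
  · refine Finset.mem_convexHull'.2 ⟨_, fun a ha => ?_, ?_, rfl⟩
    · refine mul_nonneg (inv_nonneg.2 hs.le) ?_
      have h1 : ε ≤ w a := (min_le_left _ _).trans (hmin a ha)
      nlinarith [hule a ha, hu0 a ha]
    · rw [← Finset.mul_sum, Finset.sum_sub_distrib, ← Finset.mul_sum, hw1, hu1, mul_one,
        inv_mul_cancel₀ hs.ne']
  · have : ∑ a ∈ F, ((1 - ε)⁻¹ * (w a - ε * u a)) • a = (1 - ε)⁻¹ • (x - ε • y) := by
      rw [← hw2, ← hu2, Finset.smul_sum, ← Finset.sum_sub_distrib, Finset.smul_sum]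
      exact Finset.sum_congr rfl fun a _ => by module
    rw [this, smul_smul, mul_inv_cancel₀ hs.ne', one_smul]
    module

lemma PosCombo.mem_interior {F : Finset V} {x : V} (h : PosCombo F x)
    (hi : (interior (convexHull ℝ (F : Set V))).Nonempty) :
    x ∈ interior (convexHull ℝ (F : Set V)) := by
  obtain ⟨y, hy⟩ := hi
  obtain ⟨b, hb, s, hs0, hs1, rfl⟩ := h.exists_extend (interior_subset hy)
  exact (convex_convexHull ℝ _).combo_interior_self_mem_interior hy hb (by linarith) hs0
    (by ring)

/-- If a union of convex sets that contain `F` is a neighbourhood of one point of the simplex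
spanned by `F`, then of every point of its relative interior. -/
lemma PosCombo.mem_interior_iUnion {ι : Type*} {s : Set ι} {C : ι → Set V} {F : Finset V}
    {x y : V} (hx : PosCombo F x) (hy : y ∈ convexHull ℝ (F : Set V))
    (hC : ∀ k ∈ s, Convex ℝ (C k)) (hF : ∀ k ∈ s, (F : Set V) ⊆ C k)
    (hi : y ∈ interior (⋃ k ∈ s, C k)) : x ∈ interior (⋃ k ∈ s, C k) := by
  obtain ⟨b, hb, t, ht0, ht1, rfl⟩ := hx.exists_extend hy
  have ht : 0 < 1 - t := by linarith
  rw [mem_interior_iff_mem_nhds, Metric.mem_nhds_iff] at hi ⊢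
  obtain ⟨ε, hε, hsub⟩ := hi
  refine ⟨(1 - t) * ε, by positivity, fun z hz => ?_⟩
  -- The preimage of `z` under the homothety with centre `b` that sends `y` to `x`. Each `C k` is
  -- convex and contains `b`, so it is mapped into itself.
  set z' : V := (1 - t)⁻¹ • (z - t • b) with hz'
  have hzz : z = (1 - t) • z' + t • b := by
    rw [hz', smul_smul, mul_inv_cancel₀ ht.ne', one_smul]; abel
  have hz'm : z' ∈ Metric.ball y ε := by
    rw [Metric.mem_ball, dist_eq_norm] at hz ⊢
    have : z - ((1 - t) • y + t • b) = (1 - t) • (z' - y) := by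
      rw [smul_sub]; nth_rw 1 [hzz]; abel
    rw [this, norm_smul, Real.norm_of_nonneg ht.le] at hz
    exact lt_of_mul_lt_mul_left hz ht.le
  have := hsub hz'm
  simp only [mem_iUnion] at this ⊢
  obtain ⟨k, hk, hzk⟩ := this
  exact ⟨k, hk, hzz ▸ hC k hk hzk (convexHull_min (hF k hk) (hC k hk) hb) ht.le ht0 (by ring)⟩

lemma interior_convexHull_nonempty [FiniteDimensional ℝ V] {K : Finset V}
    (hK : AffineIndependent ℝ ((↑) : K → V)) (hc : K.card = Module.finrank ℝ V + 1) :
    (interior (convexHull ℝ (K : Set V))).Nonempty := by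
  rw [interior_convexHull_nonempty_iff_affineSpan_eq_top]
  have := hK.affineSpan_eq_top_iff_card_eq_finrank_add_one
  rw [Subtype.range_coe_subtype] at this
  exact this.2 (by simpa using hc)

/-- A proper face of a simplex of full dimension is a null set. -/
lemma volume_convexHull_eq_zero [FiniteDimensional ℝ V] [MeasurableSpace V] [BorelSpace V]
    (μ : Measure V) [μ.IsAddHaarMeasure] {K S : Finset V}
    (hK : AffineIndependent ℝ ((↑) : K → V)) (hc : K.card = Module.finrank ℝ V + 1)
    (hS : S ⊂ K) : μ (convexHull ℝ (S : Set V)) = 0 := by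
  have hSi : AffineIndependent ℝ ((↑) : S → V) := hK.mono hS.1
  have hcard := Finset.card_lt_card hS
  refine measure_mono_null (convexHull_subset_affineSpan _)
    (Measure.addHaar_affineSubspace μ _ fun htop => ?_)
  have := hSi.affineSpan_eq_top_iff_card_eq_finrank_add_one
  rw [Subtype.range_coe_subtype] at this
  have := this.1 (by simpa using htop)
  simp at this
  omega

end PosCombo

/-- A punctured ball in a space of dimension at least two is connected. -/
lemma isPreconnected_ball_diff_singleton {V : Type*} [NormedAddCommGroup V] [NormedSpace ℝ V]
    (hV : 1 < Module.rank ℝ V) (y : V) (r : ℝ) : IsPreconnected (Metric.ball y r \ {y}) := by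
  -- Polar coordinates: a continuous image of the connected set sphere times interval.
  have : Metric.ball y r \ {y} =
      (fun q : V × ℝ => y + q.2 • q.1) '' (Metric.sphere (0 : V) 1 ×ˢ Ioo 0 r) := by
    ext x
    simp only [Set.mem_sdiff, Metric.mem_ball, mem_singleton_iff, mem_image, mem_prod,
      mem_sphere_zero_iff_norm, mem_Ioo, Prod.exists]
    constructor
    · rintro ⟨hx, hne⟩
      have hn : 0 < ‖x - y‖ := norm_pos_iff.2 (sub_ne_zero.2 hne)
      refine ⟨‖x - y‖⁻¹ • (x - y), ‖x - y‖, ⟨?_, hn, by rwa [← dist_eq_norm]⟩, ?_⟩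
      · rw [norm_smul, norm_inv, norm_norm, inv_mul_cancel₀ hn.ne']
      · rw [smul_smul, mul_inv_cancel₀ hn.ne', one_smul]; abel
    · rintro ⟨u, t, ⟨hu, ht, htr⟩, rfl⟩
      constructor
      · rwa [dist_eq_norm, add_sub_cancel_left, norm_smul, hu, mul_one, Real.norm_of_nonneg ht.le]
      · intro h
        rw [add_eq_left, smul_eq_zero] at h
        rcases h with h | h
        · exact ht.ne' h
        · rw [h, norm_zero] at hu; exact zero_ne_one hu
  rw [this]
  refine IsPreconnected.image ?_ _ (by fun_prop)
  exact (isPreconnected_sphere hV _ _).prod isPreconnected_Ioo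

end HyperDG

/-! ### Affine images, and minimal faces in a conforming mesh. -/

namespace HyperDG

section Affine

variable {V W : Type*} [NormedAddCommGroup V] [NormedSpace ℝ V] [NormedAddCommGroup W]
  [NormedSpace ℝ W]

lemma affineMap_sum_smul {ι : Type*} (f : V →ᵃ[ℝ] W) (s : Finset ι) (w : ι → ℝ) (u : ι → V)
    (hw : ∑ a ∈ s, w a = 1) : f (∑ a ∈ s, w a • u a) = ∑ a ∈ s, w a • f (u a) := by
  have h : ∀ v, f v = f.linear v + f 0 := fun v => congrFun f.decomp v
  rw [h, map_sum]
  simp_rw [h (u _), smul_add, map_smul]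
  rw [Finset.sum_add_distrib, ← Finset.sum_smul, hw, one_smul]

lemma PosCombo.image [DecidableEq W] {f : V →ᵃ[ℝ] W} (hf : Function.Injective f) {F : Finset V} {x : V}
    (h : PosCombo F x) : PosCombo (F.image f) (f x) := by
  obtain ⟨w, h0, h1, h2⟩ := h
  have hl := Function.leftInverse_invFun hf
  refine ⟨fun a => w (Function.invFun f a), ?_, ?_, ?_⟩
  · intro a ha
    obtain ⟨b, hb, rfl⟩ := Finset.mem_image.1 ha
    simpa [hl b] using h0 b hb
  · rw [Finset.sum_image hf.injOn]
    simpa [hl _] using h1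
  · rw [Finset.sum_image hf.injOn, ← h2, affineMap_sum_smul f F w _ h1]
    simp [hl _]

lemma PosCombo.exists_of_image [DecidableEq W] {f : V →ᵃ[ℝ] W} (hf : Function.Injective f) {F : Finset V} {x : W}
    (h : PosCombo (F.image f) x) : ∃ y, f y = x ∧ PosCombo F y := by
  obtain ⟨w, h0, h1, h2⟩ := h
  rw [Finset.sum_image hf.injOn] at h1 h2
  exact ⟨∑ a ∈ F, w (f a) • a, by rw [affineMap_sum_smul f F (fun a => w (f a)) _ h1, h2],
    fun a => w (f a), fun a ha => h0 _ (Finset.mem_image_of_mem f ha), h1, rfl⟩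

end Affine

lemma IsPolytopalDomain.frontier_eq {n : ℕ} {Ω : Set (E n)} (h : IsPolytopalDomain Ω) :
    frontier Ω = closure Ω \ Ω := h.isOpen.frontier_eq

namespace Network

variable {n d N : ℕ} (G : Network n d N)

lemma coord_apply (i : Fin N) (y : E n) : G.coord i (G.Φ i y) = y :=
  Function.leftInverse_invFun (G.Φ i).injective y

lemma mem_I {γ : Set (E d)} {i : Fin N} : i ∈ G.I γ ↔ γ ⊆ G.surf i := by
  simp [I]

lemma bif_convex {γ : Set (E d)} (hγ : γ ∈ G.Γ) : Convex ℝ γ := by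
  obtain ⟨s, -, -, rfl⟩ := G.bif_shape γ hγ
  exact convex_convexHull ℝ _

lemma bif_isCompact {γ : Set (E d)} (hγ : γ ∈ G.Γ) : IsCompact γ := by
  obtain ⟨s, -, -, rfl⟩ := G.bif_shape γ hγ
  exact s.finite_toSet.isCompact_convexHull (𝕜 := ℝ)

namespace Mesh

variable {G} (M : G.Mesh)

lemma mem_elems {p : Σ _ : Fin N, Finset (E n)} : p ∈ M.elems ↔ p.2 ∈ M.T p.1 := by
  simp [elems]

lemma mk_mem_elems {i : Fin N} {K : Finset (E n)} : (⟨i, K⟩ : Σ _ : Fin N, Finset (E n)) ∈ M.elems ↔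
    K ∈ M.T i := M.mem_elems

lemma mem_emb {p : Σ _ : Fin N, Finset (E n)} {z : E d} :
    z ∈ M.emb p ↔ ∃ y ∈ p.2, G.Φ p.1 y = z := by
  simp [emb]

lemma emb_eq (p : Σ _ : Fin N, Finset (E n)) :
    M.emb p = p.2.image (G.Φ p.1).toAffineMap := by
  ext z
  simp [emb]

lemma coe_emb (p : Σ _ : Fin N, Finset (E n)) :
    (M.emb p : Set (E d)) = G.Φ p.1 '' (p.2 : Set (E n)) := by
  simp [emb]

lemma convexHull_emb (p : Σ _ : Fin N, Finset (E n)) :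
    convexHull ℝ (M.emb p : Set (E d)) = G.Φ p.1 '' convexHull ℝ (p.2 : Set (E n)) := by
  rw [coe_emb]
  exact ((G.Φ p.1).toAffineMap.image_convexHull _).symm

lemma card_emb {p : Σ _ : Fin N, Finset (E n)} (hp : p ∈ M.elems) : (M.emb p).card = n + 1 := by
  rw [emb, Finset.card_image_of_injective _ (G.Φ p.1).injective]
  exact M.card_eq _ _ (M.mem_elems.1 hp)

lemma affineIndependent_emb {p : Σ _ : Fin N, Finset (E n)} (hp : p ∈ M.elems) :
    AffineIndependent ℝ ((↑) : M.emb p → E d) := by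
  have h := M.indep _ _ (M.mem_elems.1 hp)
  have h2 := (h.map' (G.Φ p.1).toAffineMap (G.Φ p.1).injective).range
  have : range ((G.Φ p.1).toAffineMap ∘ ((↑) : p.2 → E n)) = (M.emb p : Set (E d)) := by
    rw [coe_emb, range_comp, Subtype.range_coe]
    rfl
  rw [this] at h2
  exact h2

lemma conforming' {p q : Σ _ : Fin N, Finset (E n)} (hp : p ∈ M.elems) (hq : q ∈ M.elems)
    {x : E d} (hxp : x ∈ convexHull ℝ (M.emb p : Set (E d)))
    (hxq : x ∈ convexHull ℝ (M.emb q : Set (E d))) :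
    x ∈ convexHull ℝ ((M.emb p ∩ M.emb q : Finset (E d)) : Set (E d)) := by
  rw [Finset.coe_inter, coe_emb, coe_emb]
  rw [convexHull_emb] at hxp hxq
  exact M.conforming _ _ _ (M.mem_elems.1 hp) _ (M.mem_elems.1 hq) ⟨hxp, hxq⟩

/-- The minimal face that contains a point is a face of all elements that contain it. -/
lemma carrier_subset {p q : Σ _ : Fin N, Finset (E n)} (hp : p ∈ M.elems) (hq : q ∈ M.elems)
    {x : E d} {F : Finset (E d)} (hF : F ⊆ M.emb p) (hx : PosCombo F x)
    (hxq : x ∈ convexHull ℝ (M.emb q : Set (E d))) : F ⊆ M.emb q := by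
  have hxp := convexHull_mono (Finset.coe_subset.2 hF) hx.mem_convexHull
  exact (hx.subset (M.affineIndependent_emb hp) hF Finset.inter_subset_left
    (M.conforming' hp hq hxp hxq)).trans Finset.inter_subset_right

lemma mem_surf_iff {i : Fin N} {x : E d} :
    x ∈ G.surf i ↔ ∃ p ∈ M.elems, p.1 = i ∧ x ∈ convexHull ℝ (M.emb p : Set (E d)) := by
  rw [surf, ← M.cover i]
  constructor
  · rintro ⟨y, hy, rfl⟩
    simp only [mem_iUnion] at hy
    obtain ⟨K, hK, hy⟩ := hy
    exact ⟨⟨i, K⟩, M.mk_mem_elems.2 hK, rfl, by rw [convexHull_emb]; exact ⟨y, hy, rfl⟩⟩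
  · rintro ⟨p, hp, rfl, hx⟩
    rw [convexHull_emb] at hx
    obtain ⟨y, hy, rfl⟩ := hx
    exact ⟨y, mem_biUnion (M.mem_elems.1 hp) hy, rfl⟩

lemma convexHull_emb_subset_surf {p : Σ _ : Fin N, Finset (E n)} (hp : p ∈ M.elems) :
    convexHull ℝ (M.emb p : Set (E d)) ⊆ G.surf p.1 :=
  fun _ hx => M.mem_surf_iff.2 ⟨p, hp, rfl, hx⟩

/-- Faces that contain points close to a point `z` contain the minimal face of `z`. -/
lemma exists_ball_carrier {p₀ : Σ _ : Fin N, Finset (E n)} (hp₀ : p₀ ∈ M.elems) {z : E d}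
    {F : Finset (E d)} (hF : F ⊆ M.emb p₀) (hz : PosCombo F z) :
    ∃ ε > 0, ∀ x, dist x z < ε → ∀ p ∈ M.elems, ∀ S ⊆ M.emb p,
      x ∈ convexHull ℝ (S : Set (E d)) → F ⊆ S := by
  -- The faces not containing `F` have a closed union, and `z` is not in it because `F` is contained
  -- in every face through `z`.
  set B : Set (E d) := ⋃ S ∈ (M.elems.biUnion fun p => (M.emb p).powerset).filter
    (fun S => ¬ F ⊆ S), convexHull ℝ (S : Set (E d)) with hB
  have hcl : IsClosed B := by
    refine Set.Finite.isClosed_biUnion (Finset.finite_toSet _) fun S _ => ?_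
    exact (S.finite_toSet.isCompact_convexHull (𝕜 := ℝ)).isClosed
  have hzB : z ∉ B := by
    intro h
    simp only [hB, mem_iUnion, Finset.mem_filter, Finset.mem_biUnion, Finset.mem_powerset] at h
    obtain ⟨S, ⟨⟨p, hp, hSp⟩, hzS⟩, hzc⟩ := h
    have h1 : F ⊆ M.emb p := M.carrier_subset hp₀ hp hF hz
      (convexHull_mono (Finset.coe_subset.2 hSp) hzc)
    exact hzS (hz.subset (M.affineIndependent_emb hp) h1 hSp hzc)
  obtain ⟨ε, hε, hsub⟩ := Metric.isOpen_iff.1 hcl.isOpen_compl z hzB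
  refine ⟨ε, hε, fun x hx p hp S hS hxS => ?_⟩
  by_contra hzS
  refine hsub hx (mem_biUnion (x := S) ?_ hxS)
  simp only [Finset.coe_filter, Finset.mem_biUnion, Finset.mem_powerset, Set.mem_ofPred_eq]
  exact ⟨⟨p, hp, hS⟩, hzS⟩

/-- Faces that contain points close to a vertex contain the vertex. -/
lemma exists_ball_vertex {p₀ : Σ _ : Fin N, Finset (E n)} (hp₀ : p₀ ∈ M.elems) {z : E d}
    (hz : z ∈ M.emb p₀) :
    ∃ ε > 0, ∀ x, dist x z < ε → ∀ p ∈ M.elems, ∀ S ⊆ M.emb p,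
      x ∈ convexHull ℝ (S : Set (E d)) → z ∈ S := by
  obtain ⟨ε, hε, h⟩ := M.exists_ball_carrier hp₀ (Finset.singleton_subset_iff.2 hz)
    (posCombo_singleton z)
  exact ⟨ε, hε, fun x hx p hp S hS hxS =>
    Finset.singleton_subset_iff.1 (h x hx p hp S hS hxS)⟩

lemma convexHull_subset_closure {i : Fin N} {K : Finset (E n)} (hK : K ∈ M.T i) :
    convexHull ℝ (K : Set (E n)) ⊆ closure (G.Ω i) := by
  rw [← M.cover i]
  exact subset_biUnion_of_mem (u := fun K : Finset (E n) => convexHull ℝ (K : Set (E n))) hK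

/-- This rests on `Ω` being the interior of its closure: with a slit, the interior of an element
could leave the domain. -/
lemma interior_subset_domain {i : Fin N} {K : Finset (E n)} (hK : K ∈ M.T i) :
    interior (convexHull ℝ (K : Set (E n))) ⊆ G.Ω i := by
  rw [← (G.polytopal i).interior_closure]
  exact interior_mono (M.convexHull_subset_closure hK)

lemma interior_nonempty {i : Fin N} {K : Finset (E n)} (hK : K ∈ M.T i) :
    (interior (convexHull ℝ (K : Set (E n)))).Nonempty :=
  interior_convexHull_nonempty (M.indep i K hK) (by simpa using M.card_eq i K hK)

/-- A point of the boundary of a domain is not in the relative interior of an element. -/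
lemma ne_emb_of_frontier {p : Σ _ : Fin N, Finset (E n)} (hp : p ∈ M.elems) {x : E d}
    (hx : x ∈ G.Φ p.1 '' frontier (G.Ω p.1)) {F : Finset (E d)} (hF : PosCombo F x) :
    F ≠ M.emb p := by
  intro hFp
  rw [hFp, emb_eq] at hF
  obtain ⟨y, hy, rfl⟩ := hx
  obtain ⟨y', hyy, hy'⟩ := PosCombo.exists_of_image (f := (G.Φ p.1).toAffineMap)
    (G.Φ p.1).injective hF
  obtain rfl : y' = y := (G.Φ p.1).injective hyy
  rw [(G.polytopal p.1).frontier_eq] at hy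
  have hT := M.mem_elems.1 hp
  exact hy.2 (M.interior_subset_domain hT (hy'.mem_interior (M.interior_nonempty hT)))

/-- Each closed domain containing `γ` has an element through `x`, which then has all vertices of
`F`. As `γ` is the intersection of these domains, it contains the vertices, and it is convex. -/
lemma convexHull_subset_bif {p : Σ _ : Fin N, Finset (E n)} (hp : p ∈ M.elems) {x : E d}
    {F : Finset (E d)} (hF : F ⊆ M.emb p) (hx : PosCombo F x) {γ : Set (E d)} (hγ : γ ∈ G.Γ)
    (hxγ : x ∈ γ) : convexHull ℝ (F : Set (E d)) ⊆ γ := by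
  refine convexHull_min ?_ (G.bif_convex hγ)
  rw [G.bif_eq γ hγ]
  refine subset_iInter₂ fun k hk => ?_
  obtain ⟨q, hq, rfl, hxq⟩ := M.mem_surf_iff.1 (show x ∈ G.surf k from hk hxγ)
  exact (Finset.coe_subset.2 (M.carrier_subset hp hq hF hx hxq)).trans
    ((subset_convexHull ℝ _).trans (M.convexHull_emb_subset_surf hq))

/-- Of the relative interior of a face, all points or none lie on the boundary of a domain. -/
lemma frontier_of_posCombo {p : Σ _ : Fin N, Finset (E n)} (hp : p ∈ M.elems) {x x' : E d}
    {F : Finset (E d)} (hF : F ⊆ M.emb p) (hx : PosCombo F x) (hx' : PosCombo F x') {j : Fin N}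
    (hxj : x ∈ G.Φ j '' frontier (G.Ω j)) : x' ∈ G.Φ j '' frontier (G.Ω j) := by
  have hxs : x ∈ G.surf j := image_mono frontier_subset_closure hxj
  obtain ⟨q, hq, rfl, hxq⟩ := M.mem_surf_iff.1 hxs
  have hFq := M.carrier_subset hp hq hF hx hxq
  have hinj := (G.Φ q.1).injective
  obtain ⟨F', rfl⟩ : ∃ F' : Finset (E n), F'.image (G.Φ q.1).toAffineMap = F := by
    refine ⟨q.2.filter fun a => G.Φ q.1 a ∈ F, ?_⟩
    ext a
    simp only [Finset.mem_image, Finset.mem_filter]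
    constructor
    · rintro ⟨b, ⟨-, hb⟩, rfl⟩
      exact hb
    · intro ha
      obtain ⟨b, hb, rfl⟩ := M.mem_emb.1 (hFq ha)
      exact ⟨b, ⟨hb, ha⟩, rfl⟩
  obtain ⟨y, rfl, hy⟩ := hx.exists_of_image hinj
  obtain ⟨y', rfl, hy'⟩ := hx'.exists_of_image hinj
  obtain ⟨y₁, hy₁, hyy₁⟩ := hxj
  obtain rfl : y₁ = y := hinj hyy₁
  refine ⟨y', ?_, rfl⟩
  rw [(G.polytopal q.1).frontier_eq] at hy₁ ⊢
  have hqT := M.mem_elems.1 hq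
  constructor
  · refine M.convexHull_subset_closure hqT (convexHull_mono ?_ hy'.mem_convexHull)
    intro a ha
    obtain ⟨b, hb, hab⟩ := M.mem_emb.1 (hFq (Finset.mem_image_of_mem _ ha))
    obtain rfl : b = a := hinj hab
    exact hb
  · intro hyΩ
    apply hy₁.2
    -- If `y'` were in the domain, the elements with the face `F'` would cover a neighbourhood of
    -- it, the other elements being closed and missing `y'`. `PosCombo.mem_interior_iUnion` moves
    -- this neighbourhood to `y`, so `y` is in the interior of the closure, which is the domain.
    set s : Set (Finset (E n)) := {K | K ∈ M.T q.1 ∧ F' ⊆ K}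
    set s' : Set (Finset (E n)) := {K | K ∈ M.T q.1 ∧ ¬ F' ⊆ K}
    set A : Set (E n) := ⋃ K ∈ s, convexHull ℝ (K : Set (E n)) with hA
    set B : Set (E n) := ⋃ K ∈ s', convexHull ℝ (K : Set (E n))
    have hsub : A ⊆ closure (G.Ω q.1) := iUnion₂_subset fun K hK =>
      M.convexHull_subset_closure hK.1
    have hBcl : IsClosed B := by
      refine Set.Finite.isClosed_biUnion ((M.T q.1).finite_toSet.subset fun K hK => hK.1)
        fun S _ => (S.finite_toSet.isCompact_convexHull (𝕜 := ℝ)).isClosed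
    have hyB : y' ∉ B := by
      intro h
      simp only [B, mem_iUnion] at h
      obtain ⟨K, hK, hyK⟩ := h
      have h2 : F'.image (G.Φ q.1).toAffineMap ⊆ M.emb ⟨q.1, K⟩ := by
        refine M.carrier_subset hp (M.mk_mem_elems.2 hK.1) hF hx' ?_
        rw [convexHull_emb]
        exact ⟨y', hyK, rfl⟩
      refine hK.2 fun a ha => ?_
      obtain ⟨b, hb, hab⟩ := M.mem_emb.1 (h2 (Finset.mem_image_of_mem _ ha))
      obtain rfl : b = a := hinj hab
      exact hb
    have hint : y' ∈ interior A := by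
      rw [mem_interior_iff_mem_nhds]
      filter_upwards [(G.polytopal q.1).isOpen.mem_nhds hyΩ, hBcl.isOpen_compl.mem_nhds hyB]
        with w hw hwB
      have := subset_closure hw
      rw [← M.cover q.1] at this
      simp only [mem_iUnion] at this
      obtain ⟨K, hK, hwK⟩ := this
      by_cases hKF : F' ⊆ K
      · exact mem_biUnion (show K ∈ s from ⟨hK, hKF⟩) hwK
      · exact absurd (mem_biUnion (show K ∈ s' from ⟨hK, hKF⟩) hwK) hwB
    have := hy.mem_interior_iUnion (C := fun K : Finset (E n) => convexHull ℝ (K : Set (E n)))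
      hy'.mem_convexHull (fun K _ => convex_convexHull ℝ _)
      (fun K (hK : K ∈ s) => (Finset.coe_subset.2 hK.2).trans (subset_convexHull ℝ _)) hint
    rw [← (G.polytopal q.1).interior_closure]
    exact interior_mono hsub this

end Mesh
end Network
end HyperDG

/-! ### Local connectivity of the domains, and chains of elements at a vertex. -/

namespace HyperDG

lemma one_lt_rank_euclidean {n : ℕ} (hn : 1 < n) : 1 < Module.rank ℝ (E n) := by
  rw [← Module.finrank_eq_rank, finrank_euclideanSpace_fin]
  exact_mod_cast hn

/-- The boundary of a polygonal domain has no isolated points. -/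
lemma IsPolytopalDomain.exists_frontier_ne {n : ℕ} (hn : 1 < n) {Ω : Set (E n)}
    (h : IsPolytopalDomain Ω) {y : E n} (hy : y ∈ frontier Ω) {r : ℝ} (hr : 0 < r) :
    ∃ x ∈ frontier Ω, x ≠ y ∧ dist x y < r := by
  have hpre := isPreconnected_ball_diff_singleton (one_lt_rank_euclidean hn) y r
  rw [h.frontier_eq] at hy
  have h1 : ((Metric.ball y r \ {y}) ∩ Ω).Nonempty := by
    obtain ⟨x, hx, hd⟩ := Metric.mem_closure_iff.1 hy.1 r hr
    exact ⟨x, ⟨Metric.mem_ball'.2 hd, fun hxy => hy.2 (by rw [mem_singleton_iff] at hxy; exact hxy ▸ hx)⟩, hx⟩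
  -- Otherwise `Ω` would fill the punctured ball and, being the interior of its closure, contain
  -- `y`.
  have h2 : ((Metric.ball y r \ {y}) ∩ Ωᶜ).Nonempty := by
    by_contra hne
    rw [not_nonempty_iff_eq_empty, ← sdiff_eq, sdiff_eq_empty] at hne
    apply hy.2
    rw [← h.interior_closure, mem_interior_iff_mem_nhds]
    filter_upwards [Metric.ball_mem_nhds y hr] with x hx
    by_cases hxy : x = y
    · exact hxy ▸ hy.1
    · exact subset_closure (hne ⟨hx, hxy⟩)
  by_contra! hcon
  have hcov : Metric.ball y r \ {y} ⊆ closure Ω ∪ Ωᶜ := fun x _ =>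
    (em (x ∈ Ω)).imp (fun h => subset_closure h) id
  -- The closed sets `closure Ω` and `Ωᶜ` cover the connected punctured ball and both meet it, so
  -- they share a point there: a frontier point.
  obtain ⟨x, hx, hxc, hxo⟩ := isPreconnected_closed_iff.1 hpre _ _ isClosed_closure
    h.isOpen.isClosed_compl hcov (h1.mono (inter_subset_inter_right _ subset_closure)) h2
  exact (hcon x (by rw [h.frontier_eq]; exact ⟨hxc, hxo⟩) hx.2).not_gt hx.1

/-- A domain is locally connected at the points of its closure, also without the point. -/
lemma IsPolytopalDomain.exists_preconnected {n : ℕ} (hn : 1 < n) {Ω : Set (E n)}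
    (h : IsPolytopalDomain Ω) {y : E n} (hy : y ∈ closure Ω) {ε : ℝ} (hε : 0 < ε) :
    ∃ r, 0 < r ∧ r < ε ∧ IsPreconnected ((Ω ∩ Metric.ball y r) \ {y}) := by
  by_cases hyΩ : y ∈ Ω
  · obtain ⟨r, hr, hsub⟩ := Metric.isOpen_iff.1 h.isOpen y hyΩ
    refine ⟨min r (ε / 2), by positivity, (min_le_right _ _).trans_lt (by linarith), ?_⟩
    rw [inter_eq_right.2 ((Metric.ball_subset_ball (min_le_left _ _)).trans hsub)]
    exact isPreconnected_ball_diff_singleton (one_lt_rank_euclidean hn) y _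
  · have h1 := h.locally_connected y (by rw [h.frontier_eq]; exact ⟨hy, hyΩ⟩)
    have h2 : ∀ᶠ r in 𝓝[>] (0 : ℝ), r ∈ Ioo 0 ε := Ioo_mem_nhdsGT hε
    obtain ⟨r, hr1, hr2⟩ := (h1.and h2).exists
    refine ⟨r, hr2.1, hr2.2, ?_⟩
    rwa [sdiff_singleton_eq_self fun hy => hyΩ hy.1]

namespace Network.Mesh

variable {n d N : ℕ} {G : Network n d N} (M : G.Mesh)

lemma mem_patch {z : E d} {p : Σ _ : Fin N, Finset (E n)} :
    p ∈ M.patch z ↔ p ∈ M.elems ∧ z ∈ M.emb p := by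
  simp [patch]

lemma mem_faces {F : Finset (E d)} :
    F ∈ M.faces ↔ ∃ p ∈ M.elems, F ⊆ M.emb p ∧ F.card = n := by
  simp [faces, Finset.mem_powersetCard]

lemma mem_elemsAt {i : Fin N} {F : Finset (E d)} {K : Finset (E n)} :
    K ∈ M.elemsAt i F ↔ (⟨i, K⟩ : Σ _ : Fin N, Finset (E n)) ∈ M.elems ∧ F ⊆ M.emb ⟨i, K⟩ := by
  rw [elemsAt, Finset.mem_filter, mk_mem_elems]

lemma vertex_of_mem {p q : Σ _ : Fin N, Finset (E n)} {z : E d} (hp : p ∈ M.patch z)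
    (hq : q ∈ M.elems) (h : z ∈ convexHull ℝ (M.emb q : Set (E d))) : q ∈ M.patch z := by
  rw [mem_patch] at hp ⊢
  exact ⟨hq, Finset.singleton_subset_iff.1 (M.carrier_subset hp.1 hq
    (Finset.singleton_subset_iff.2 hp.2) (posCombo_singleton z) h)⟩

/-- Two elements with the vertex `z` share a face at `z`, inside a domain or on a bifurcation. -/
def Linked (z : E d) (p q : Σ _ : Fin N, Finset (E n)) : Prop :=
  p ∈ M.patch z ∧ q ∈ M.patch z ∧ ∃ F ∈ M.faces, z ∈ F ∧ F ⊆ M.emb p ∧ F ⊆ M.emb q ∧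
    (p.1 = q.1 ∨ ∃ γ ∈ G.Γ, convexHull ℝ (F : Set (E d)) ⊆ γ ∧ p.1 ∈ G.I γ ∧ q.1 ∈ G.I γ)

lemma two_le_card {z x : E d} {F : Finset (E d)} (hz : z ∈ F) (hx : PosCombo F x) (hxz : x ≠ z) :
    2 ≤ F.card := by
  by_contra hlt
  have h1 : F.card = 1 := by
    have := Finset.card_pos.2 ⟨z, hz⟩
    omega
  obtain ⟨a, rfl⟩ := Finset.card_eq_one.1 h1
  obtain rfl := Finset.mem_singleton.1 hz
  exact hxz hx.eq_of_singleton

lemma singleton_mem_faces (hn : n = 1) {p : Σ _ : Fin N, Finset (E n)} {z : E d}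
    (hp : p ∈ M.patch z) : {z} ∈ M.faces := by
  rw [mem_patch] at hp
  exact M.mem_faces.2 ⟨p, hp.1, Finset.singleton_subset_iff.2 hp.2, by simp [hn]⟩

/-- The elements of a domain at a vertex are connected through their common faces. -/
lemma linked_of_same_domain (hn : n = 1 ∨ n = 2) {z : E d} {i : Fin N} {K L : Finset (E n)}
    (hK : ⟨i, K⟩ ∈ M.patch z) (hL : ⟨i, L⟩ ∈ M.patch z) :
    Relation.ReflTransGen (M.Linked z) ⟨i, K⟩ ⟨i, L⟩ := by
  have hK' := M.mem_patch.1 hK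
  have hL' := M.mem_patch.1 hL
  rcases hn with hn | hn
  · exact .single ⟨hK, hL, {z}, M.singleton_mem_faces hn hK, Finset.mem_singleton_self z,
      Finset.singleton_subset_iff.2 hK'.2, Finset.singleton_subset_iff.2 hL'.2, Or.inl rfl⟩
  by_contra hcon
  obtain ⟨y, hy, hyz⟩ := M.mem_emb.1 hK'.2
  obtain ⟨y', hyL, hyz'⟩ := M.mem_emb.1 hL'.2
  obtain rfl : y' = y := (G.Φ i).injective (hyz'.trans hyz.symm)
  simp only at hyz hyL
  obtain ⟨ε, hε, hball⟩ := M.exists_ball_vertex hK'.1 hK'.2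
  obtain ⟨r, hr, hrε, hpre⟩ := (G.polytopal i).exists_preconnected (by omega)
    (M.convexHull_subset_closure (M.mk_mem_elems.1 hK'.1) (subset_convexHull ℝ _ hy)) hε
  -- The elements reachable from `K` and the others have closed unions covering the connected
  -- punctured set, and both meet it. At a common point a reachable and an unreachable element meet;
  -- their common minimal face will link them, a contradiction.
  set s : Set (Finset (E n)) :=
    {K' | K' ∈ M.T i ∧ Relation.ReflTransGen (M.Linked z) ⟨i, K⟩ ⟨i, K'⟩} with hs
  set t : Set (Finset (E n)) :=
    {K' | K' ∈ M.T i ∧ ¬ Relation.ReflTransGen (M.Linked z) ⟨i, K⟩ ⟨i, K'⟩} with ht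
  have hcl : ∀ u : Set (Finset (E n)), (∀ K' ∈ u, K' ∈ M.T i) →
      IsClosed (⋃ K' ∈ u, convexHull ℝ (K' : Set (E n))) := fun u hu =>
    Set.Finite.isClosed_biUnion ((M.T i).finite_toSet.subset hu)
      fun S _ => (S.finite_toSet.isCompact_convexHull (𝕜 := ℝ)).isClosed
  have hmeet : ∀ K' : Finset (E n), K' ∈ M.T i → y' ∈ K' →
      (((G.Ω i ∩ Metric.ball y' r) \ {y'}) ∩ convexHull ℝ (K' : Set (E n))).Nonempty := by
    intro K' hK' hyK'
    have h1 : y' ∈ closure (interior (convexHull ℝ (K' : Set (E n)))) := by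
      rw [(convex_convexHull ℝ _).closure_interior_eq_closure_of_nonempty_interior
        (M.interior_nonempty hK')]
      exact subset_closure (subset_convexHull ℝ _ hyK')
    obtain ⟨w, hw, hwd⟩ := Metric.mem_closure_iff.1 h1 r hr
    have : Nontrivial (E n) := by
      subst hn
      infer_instance
    obtain ⟨x, hx, hxy⟩ := (dense_compl_singleton y').inter_open_nonempty
      (interior (convexHull ℝ (K' : Set (E n))) ∩ Metric.ball y' r)
      (isOpen_interior.inter Metric.isOpen_ball) ⟨w, hw, Metric.mem_ball'.2 hwd⟩
    exact ⟨x, ⟨⟨M.interior_subset_domain hK' hx.1, hx.2⟩, hxy⟩, interior_subset hx.1⟩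
  have hnear : ∀ x ∈ Metric.ball y' r, dist (G.Φ i x) z < ε := by
    intro x hx
    rw [← hyz, (G.Φ i).dist_map]
    exact hx.trans hrε
  obtain ⟨x, hxU, hxs, hxt⟩ := isPreconnected_closed_iff.1 hpre _ _
    (hcl s fun K' h => h.1) (hcl t fun K' h => h.1)
    (by
      intro x hx
      have h1 := subset_closure hx.1.1
      rw [← M.cover i] at h1
      simp only [mem_iUnion] at h1
      obtain ⟨K', hK', hxK'⟩ := h1
      by_cases h : Relation.ReflTransGen (M.Linked z) ⟨i, K⟩ ⟨i, K'⟩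
      · exact Or.inl (mem_biUnion (show K' ∈ s from ⟨hK', h⟩) hxK')
      · exact Or.inr (mem_biUnion (show K' ∈ t from ⟨hK', h⟩) hxK'))
    ((hmeet K (M.mk_mem_elems.1 hK'.1) hy).mono (inter_subset_inter_right _
      (subset_biUnion_of_mem (u := fun K : Finset (E n) => convexHull ℝ (K : Set (E n)))
        (show K ∈ s from ⟨M.mk_mem_elems.1 hK'.1, .refl⟩))))
    ((hmeet L (M.mk_mem_elems.1 hL'.1) hyL).mono (inter_subset_inter_right _
      (subset_biUnion_of_mem (u := fun K : Finset (E n) => convexHull ℝ (K : Set (E n)))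
        (show L ∈ t from ⟨M.mk_mem_elems.1 hL'.1, hcon⟩))))
  simp only [mem_iUnion] at hxs hxt
  obtain ⟨K₁, hK₁, hxK₁⟩ := hxs
  obtain ⟨K₂, hK₂, hxK₂⟩ := hxt
  have hmem : ∀ K' : Finset (E n), x ∈ convexHull ℝ (K' : Set (E n)) →
      G.Φ i x ∈ convexHull ℝ (M.emb ⟨i, K'⟩ : Set (E d)) := by
    intro K' h
    rw [convexHull_emb]
    exact ⟨x, h, rfl⟩
  have he₁ := M.mk_mem_elems.2 hK₁.1
  have he₂ := M.mk_mem_elems.2 hK₂.1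
  obtain ⟨F, hF, hFx⟩ := exists_posCombo (hmem K₁ hxK₁)
  have hF₂ := M.carrier_subset he₁ he₂ hF hFx (hmem K₂ hxK₂)
  -- So close to `z`, every face through `x` has the vertex `z`. Since `x` is not `z`, there is a
  -- second vertex, and `F` contains an edge at `z`.
  have hzF := hball _ (hnear x hxU.1.2) _ he₁ F hF hFx.mem_convexHull
  have hc : 2 ≤ F.card := two_le_card hzF hFx fun h =>
    hxU.2 ((G.Φ i).injective (h.trans hyz.symm))
  obtain ⟨F', hzF', hF'F, hF'c⟩ := Finset.exists_subsuperset_card_eq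
    (Finset.singleton_subset_iff.2 hzF) (n := n) (by simp [hn]) (by omega)
  refine hK₂.2 (hK₁.2.tail ⟨M.mem_patch.2 ⟨he₁, hF hzF⟩, M.mem_patch.2 ⟨he₂, hF₂ hzF⟩, F',
    M.mem_faces.2 ⟨_, he₁, hF'F.trans hF, hF'c⟩, Finset.singleton_subset_iff.1 hzF',
    hF'F.trans hF, hF'F.trans hF₂, Or.inl rfl⟩)

lemma card_lt_of_ne_emb {p : Σ _ : Fin N, Finset (E n)} (hp : p ∈ M.elems) {F : Finset (E d)}
    (hF : F ⊆ M.emb p) (hne : F ≠ M.emb p) : F.card ≤ n := by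
  have := Finset.card_lt_card (Finset.ssubset_iff_subset_ne.2 ⟨hF, hne⟩)
  rw [M.card_emb hp] at this
  omega

/-- Two domains with a common bifurcation `γ` share a face on `γ` at each vertex on `γ`. -/
lemma linked_of_bif (hn : n = 1 ∨ n = 2) {z : E d} {γ : Set (E d)} (hγ : γ ∈ G.Γ) (hz : z ∈ γ)
    {p q : Σ _ : Fin N, Finset (E n)} (hp : p ∈ M.patch z) (hq : q ∈ M.patch z)
    (hpγ : γ ⊆ G.surf p.1) (hqγ : γ ⊆ G.surf q.1) :
    Relation.ReflTransGen (M.Linked z) p q := by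
  have hp' := M.mem_patch.1 hp
  have hq' := M.mem_patch.1 hq
  rcases hn with hn | hn
  · refine .single ⟨hp, hq, {z}, M.singleton_mem_faces hn hp, Finset.mem_singleton_self z,
      Finset.singleton_subset_iff.2 hp'.2, Finset.singleton_subset_iff.2 hq'.2,
      Or.inr ⟨γ, hγ, by simpa using hz, G.mem_I.2 hpγ, G.mem_I.2 hqγ⟩⟩
  obtain ⟨ε, hε, hball⟩ := M.exists_ball_vertex hp'.1 hp'.2
  -- The minimal face of such a point has the vertex `z` and at least one more, but at most two
  -- vertices because `γ` lies in the frontier. So it is an edge at `z`, contained in `γ` and common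
  -- to both domains.
  obtain ⟨x, hxγ, hxz, hxd⟩ : ∃ x ∈ γ, x ≠ z ∧ dist x z < ε := by
    obtain ⟨y, hyγ, hyz⟩ : ∃ y ∈ γ, y ≠ z := by
      obtain ⟨s, hs, -, rfl⟩ := G.bif_shape γ hγ
      obtain ⟨y, hy, hyz⟩ := Finset.exists_mem_ne (s := s) (by omega) z
      exact ⟨y, subset_convexHull ℝ _ hy, hyz⟩
    have hd : 0 < dist z y := dist_pos.2 hyz.symm
    set t := min 1 (ε / (2 * dist z y)) with ht
    have ht0 : 0 < t := by positivity
    refine ⟨AffineMap.lineMap z y t, (G.bif_convex hγ).lineMap_mem hz hyγ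
      ⟨ht0.le, min_le_left _ _⟩, ?_, ?_⟩
    · intro h
      rw [AffineMap.lineMap_eq_left_iff] at h
      exact h.elim hyz.symm ht0.ne'
    · rw [dist_lineMap_left, Real.norm_of_nonneg ht0.le]
      calc t * dist z y ≤ ε / (2 * dist z y) * dist z y := by
            gcongr; exact min_le_right _ _
        _ = ε / 2 := by field_simp
        _ < ε := by linarith
  obtain ⟨p', hp'e, hpp', hxp'⟩ := M.mem_surf_iff.1 (hpγ hxγ)
  obtain ⟨q', hq'e, hqq', hxq'⟩ := M.mem_surf_iff.1 (hqγ hxγ)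
  obtain ⟨F, hF, hFx⟩ := exists_posCombo hxp'
  have hF₂ := M.carrier_subset hp'e hq'e hF hFx hxq'
  have hzF := hball _ hxd _ hp'e F hF hFx.mem_convexHull
  have hc : 2 ≤ F.card := two_le_card hzF hFx hxz
  have hc2 := M.card_lt_of_ne_emb hp'e hF (M.ne_emb_of_frontier hp'e
    (hpp' ▸ G.bif_frontier γ hγ p.1 hpγ hxγ) hFx)
  have hpz := M.mem_patch.2 ⟨hp'e, hF hzF⟩
  have hqz := M.mem_patch.2 ⟨hq'e, hF₂ hzF⟩
  have hlink : M.Linked z p' q' := ⟨hpz, hqz, F, M.mem_faces.2 ⟨_, hp'e, hF, by omega⟩, hzF, hF,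
    hF₂, Or.inr ⟨γ, hγ, M.convexHull_subset_bif hp'e hF hFx hγ hxγ,
      G.mem_I.2 (hpp' ▸ hpγ), G.mem_I.2 (hqq' ▸ hqγ)⟩⟩
  obtain ⟨i, K⟩ := p
  obtain ⟨j, L⟩ := q
  obtain ⟨i', K'⟩ := p'
  obtain ⟨j', L'⟩ := q'
  simp only at hpp' hqq'
  subst hpp' hqq'
  exact ((M.linked_of_same_domain (Or.inr hn) hp hpz).tail hlink).trans
    (M.linked_of_same_domain (Or.inr hn) hqz hq)

/-- The elements at a vertex are connected through their common faces. -/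
lemma linked_of_mem_patch (hn : n = 1 ∨ n = 2) {z : E d} {p q : Σ _ : Fin N, Finset (E n)}
    (hp : p ∈ M.patch z) (hq : q ∈ M.patch z) : Relation.ReflTransGen (M.Linked z) p q := by
  have hsurf : ∀ r ∈ M.patch z, z ∈ G.surf r.1 := fun r hr =>
    M.convexHull_emb_subset_surf (M.mem_patch.1 hr).1
      (subset_convexHull ℝ _ (M.mem_patch.1 hr).2)
  -- Induction along the chain of domains from `meet`: each of them contains `z`, hence has an
  -- element with the vertex `z`, to which the chain of elements is continued.
  have key : ∀ b, Relation.ReflTransGen (fun a b => ∃ γ ∈ G.Γ, z ∈ γ ∧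
      γ ⊆ G.Φ a '' closure (G.Ω a) ∧ γ ⊆ G.Φ b '' closure (G.Ω b)) p.1 b →
      ∀ q ∈ M.patch z, q.1 = b → Relation.ReflTransGen (M.Linked z) p q := by
    intro b hb
    induction hb with
    | refl =>
      rintro ⟨j, L⟩ hq rfl
      obtain ⟨i, K⟩ := p
      exact M.linked_of_same_domain hn hp hq
    | tail hab hbc ih =>
      rintro q hq rfl
      obtain ⟨γ, hγ, hzγ, hbγ, hcγ⟩ := hbc
      obtain ⟨r, hr, rfl, hzr⟩ := M.mem_surf_iff.1 (hbγ hzγ)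
      have hrz := M.vertex_of_mem hp hr hzr
      exact (ih r hrz rfl).trans (M.linked_of_bif hn hγ hzγ hrz hq hbγ hcγ)
  exact key q.1 (G.meet z p.1 q.1 (hsurf p hp) (hsurf q hq)) q hq rfl

/-! #### Faces on the boundary of the network -/

/-- Lying on the frontier of a domain, or on a bifurcation, is constant over the relative interior
of a face. So this interior lies in the set whose closure is `∂G`; the remaining points are limits.
-/
lemma convexHull_subset_boundary_of_frontier {p : Σ _ : Fin N, Finset (E n)} (hp : p ∈ M.elems)
    {x : E d} {F : Finset (E d)} (hF : F ⊆ M.emb p) (hFx : PosCombo F x)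
    (hx : x ∈ (⋃ i, G.Φ i '' frontier (G.Ω i)) \ ⋃ γ ∈ G.Γ, γ) :
    convexHull ℝ (F : Set (E d)) ⊆ G.boundary := by
  intro y hy
  have hlim : Tendsto (fun t : ℝ => AffineMap.lineMap y x t) (𝓝[>] 0) (𝓝 y) := by
    have : Continuous fun t : ℝ => (AffineMap.lineMap y x t : E d) := by fun_prop
    have h := this.tendsto 0
    rw [AffineMap.lineMap_apply_zero] at h
    exact h.mono_left nhdsWithin_le_nhds
  refine mem_closure_of_tendsto hlim ?_
  filter_upwards [Ioc_mem_nhdsGT (zero_lt_one' ℝ)] with t ht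
  have hFt := hFx.lineMap hy ht.1 ht.2
  obtain ⟨hx1, hx2⟩ := hx
  obtain ⟨j, hj⟩ := mem_iUnion.1 hx1
  refine ⟨mem_iUnion.2 ⟨j, M.frontier_of_posCombo hp hF hFx hFt hj⟩, fun h => hx2 ?_⟩
  simp only [mem_iUnion] at h ⊢
  obtain ⟨γ, hγ, htγ⟩ := h
  exact ⟨γ, hγ, M.convexHull_subset_bif hp hF hFt hγ htγ hFx.mem_convexHull⟩

/-- Close to a point of `∂G` there is a face on `∂G`. -/
lemma exists_face_of_boundary {p : Σ _ : Fin N, Finset (E n)} (hp : p ∈ M.elems) {x : E d}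
    {F : Finset (E d)} (hF : F ⊆ M.emb p) (hFx : PosCombo F x) (hx : x ∈ G.boundary) :
    ∃ q ∈ M.elems, ∃ S ⊆ M.emb q, F ⊆ S ∧ ∃ y ∈ (G.Φ q.1 '' frontier (G.Ω q.1)) \ ⋃ γ ∈ G.Γ, γ,
      PosCombo S y := by
  obtain ⟨ε, hε, hball⟩ := M.exists_ball_carrier hp hF hFx
  obtain ⟨y, hy, hyd⟩ := Metric.mem_closure_iff.1 hx ε hε
  obtain ⟨j, hj⟩ := mem_iUnion.1 hy.1
  obtain ⟨q, hq, rfl, hyq⟩ := M.mem_surf_iff.1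
    (show y ∈ G.surf j from image_mono frontier_subset_closure hj)
  obtain ⟨S, hS, hSy⟩ := exists_posCombo hyq
  exact ⟨q, hq, S, hS, hball y (by rwa [dist_comm]) q hq S hS hSy.mem_convexHull, y, ⟨hj, hy.2⟩,
    hSy⟩

/-- The point `x` may itself lie on a bifurcation, `∂G` being a closure. But a nearby point off the
bifurcations has a minimal face that contains `F` and lies on `∂G`. -/
lemma convexHull_subset_boundary {p : Σ _ : Fin N, Finset (E n)} (hp : p ∈ M.elems) {x : E d}
    {F : Finset (E d)} (hF : F ⊆ M.emb p) (hFx : PosCombo F x) (hx : x ∈ G.boundary) :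
    convexHull ℝ (F : Set (E d)) ⊆ G.boundary := by
  obtain ⟨q, hq, S, hS, hFS, y, hy, hSy⟩ := M.exists_face_of_boundary hp hF hFx hx
  exact (convexHull_mono (Finset.coe_subset.2 hFS)).trans
    (M.convexHull_subset_boundary_of_frontier hq hS hSy
      ⟨mem_iUnion.2 ⟨q.1, hy.1⟩, hy.2⟩)

/-- A vertex on `∂G` belongs to a face on `∂G`. -/
lemma exists_bdFace (hn : n = 1 ∨ n = 2) {p : Σ _ : Fin N, Finset (E n)} {z : E d}
    (hp : p ∈ M.patch z) (hz : z ∈ G.boundary) :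
    ∃ q ∈ M.patch z, ∃ F ∈ M.bdFaces q.1, z ∈ F ∧ F ⊆ M.emb q := by
  have hp' := M.mem_patch.1 hp
  suffices h : ∃ q ∈ M.elems, ∃ S ⊆ M.emb q, z ∈ S ∧ S.card = n ∧
      convexHull ℝ (S : Set (E d)) ⊆ G.boundary by
    obtain ⟨q, hq, S, hS, hzS, hc, hb⟩ := h
    refine ⟨q, M.mem_patch.2 ⟨hq, hS hzS⟩, S, ?_, hzS, hS⟩
    rw [bdFaces, Finset.mem_filter]
    exact ⟨M.mem_faces.2 ⟨q, hq, hS, hc⟩, ⟨q.2, M.mem_elemsAt.2 ⟨hq, hS⟩⟩, hb⟩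
  obtain ⟨q, hq, S, hS, hFS, y, hy, hSy⟩ := M.exists_face_of_boundary hp'.1
    (Finset.singleton_subset_iff.2 hp'.2) (posCombo_singleton z) hz
  have hzS := Finset.singleton_subset_iff.1 hFS
  have hc := M.card_lt_of_ne_emb hq hS (M.ne_emb_of_frontier hq hy.1 hSy)
  have hc1 := Finset.card_pos.2 ⟨z, hzS⟩
  by_cases hcn : S.card = n
  · exact ⟨q, hq, S, hS, hzS, hcn, M.convexHull_subset_boundary_of_frontier hq hS hSy
      ⟨mem_iUnion.2 ⟨q.1, hy.1⟩, hy.2⟩⟩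
  -- There remains the plane case where the face found is `z` alone, on a frontier and off the
  -- bifurcations. As the frontier has no isolated points, a second frontier point close to `z`,
  -- still off the bifurcations, provides the edge.
  have hn2 : n = 2 := by omega
  obtain ⟨a, rfl⟩ := Finset.card_eq_one.1 (show S.card = 1 by omega)
  obtain rfl := Finset.mem_singleton.1 hzS
  obtain rfl := hSy.eq_of_singleton
  obtain ⟨⟨w, hw, hwy⟩, hyγ⟩ := hy
  obtain ⟨ε, hε, hball⟩ := M.exists_ball_vertex hp'.1 hp'.2
  have hcl : IsClosed (⋃ γ ∈ G.Γ, γ) :=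
    Set.Finite.isClosed_biUnion G.Γ.finite_toSet fun γ hγ => (G.bif_isCompact hγ).isClosed
  obtain ⟨δ, hδ, hδγ⟩ := Metric.isOpen_iff.1 hcl.isOpen_compl y hyγ
  obtain ⟨x, hx, hxw, hxd⟩ := (G.polytopal q.1).exists_frontier_ne (by omega) hw
    (lt_min hε hδ)
  have hd : dist (G.Φ q.1 x) y < min ε δ := by
    rwa [← hwy, (G.Φ q.1).dist_map]
  have hxγ : G.Φ q.1 x ∉ ⋃ γ ∈ G.Γ, γ := hδγ (hd.trans_le (min_le_right _ _))
  have hxf : G.Φ q.1 x ∈ G.Φ q.1 '' frontier (G.Ω q.1) := ⟨x, hx, rfl⟩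
  obtain ⟨q', hq', hqq', hxq'⟩ := M.mem_surf_iff.1
    (show G.Φ q.1 x ∈ G.surf q.1 from image_mono frontier_subset_closure hxf)
  obtain ⟨S, hS, hSx⟩ := exists_posCombo hxq'
  have hzS := hball _ (hd.trans_le (min_le_left _ _)) q' hq' S hS hSx.mem_convexHull
  have h2 := two_le_card hzS hSx fun h => hxw ((G.Φ q.1).injective (h.trans hwy.symm))
  have h3 := M.card_lt_of_ne_emb hq' hS (M.ne_emb_of_frontier hq' (by rwa [hqq']) hSx)
  exact ⟨q', hq', S, hS, hzS, by omega, M.convexHull_subset_boundary_of_frontier hq' hS hSx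
      ⟨mem_iUnion.2 ⟨q.1, hxf⟩, hxγ⟩⟩

end Network.Mesh
end HyperDG

namespace HyperDG

/-! ### Piecewise affine functions and their weak gradients -/

/-- A function that is Lipschitz on each member of a finite closed cover is Lipschitz. -/
lemma lipschitzWith_of_closed_cover {V ι : Type*} [NormedAddCommGroup V] [NormedSpace ℝ V]
    [Finite ι] {A : ι → Set V} (hA : ∀ i, IsClosed (A i)) (hcov : ⋃ i, A i = univ) {f : V → ℝ}
    {C : NNReal} (hf : ∀ i, LipschitzOnWith C f (A i)) : LipschitzWith C f := by
  have hcont : Continuous f := by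
    rw [← continuousOn_univ, ← hcov]
    exact (locallyFinite_of_finite A).continuousOn_iUnion hA fun i => (hf i).continuousOn
  have key : ∀ x y : V, f y - f x ≤ C * ‖x - y‖ := by
    intro x y
    set c : ℝ → V := fun t => AffineMap.lineMap x y t with hc
    have hcc : Continuous c := by fun_prop
    set D : ℝ := C * ‖x - y‖ with hD
    -- A bound for the lower right Dini derivative suffices. Of the finitely many sets, one contains
    -- `c s` for parameters `s > t` arbitrarily close to `t`, and then also `c t`, being closed; its
    -- Lipschitz bound controls these slopes.
    have h := image_le_of_liminf_slope_right_le_deriv_boundary (f := fun t => f (c t) - f x)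
      (a := 0) (b := 1) (B := fun t => D * t) (B' := fun _ => D)
      ((hcont.comp hcc).sub continuous_const).continuousOn (by simp [hc])
      (by fun_prop) (fun t _ => by
        simpa using ((hasDerivAt_id t).const_mul D).hasDerivWithinAt) ?_
      (x := 1) (right_mem_Icc.2 zero_le_one)
    · simpa [hc] using h
    · intro t _ r hr
      have h1 : ∃ᶠ s in 𝓝[>] t, ∃ i, c s ∈ A i := by
        refine (Eventually.of_forall fun s => ?_).frequently
        exact mem_iUnion.1 (hcov ▸ mem_univ (c s))
      obtain ⟨i, hi⟩ := frequently_exists.1 h1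
      have hti : c t ∈ A i := by
        have hcl : IsClosed (c ⁻¹' A i) := (hA i).preimage hcc
        refine hcl.closure_subset (mem_closure_iff_frequently.2 ?_)
        exact hi.filter_mono nhdsWithin_le_nhds
      refine (hi.and_eventually self_mem_nhdsWithin).mono fun s hs => ?_
      have hts : 0 < s - t := sub_pos.2 hs.2
      have hl := (hf i).dist_le_mul _ hs.1 _ hti
      rw [Real.dist_eq] at hl
      have hd : dist (c s) (c t) = (s - t) * ‖x - y‖ := by
        rw [hc, dist_lineMap_lineMap, Real.dist_eq, abs_of_pos hts, dist_eq_norm]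
      rw [hd] at hl
      refine lt_of_le_of_lt ?_ hr
      rw [slope_def_field, div_le_iff₀ hts]
      calc f (c s) - f x - (f (c t) - f x) = f (c s) - f (c t) := by ring
        _ ≤ |f (c s) - f (c t)| := le_abs_self _
        _ ≤ C * ((s - t) * ‖x - y‖) := hl
        _ = D * (s - t) := by rw [hD]; ring
  refine LipschitzWith.of_dist_le_mul fun x y => ?_
  rw [Real.dist_eq, dist_eq_norm, abs_sub_le_iff]
  exact ⟨norm_sub_rev x y ▸ key y x, key x y⟩

variable {n : ℕ}

/-- The gradient of an affine function. -/
def affineGrad (p : E n →ᵃ[ℝ] ℝ) : E n :=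
  (InnerProductSpace.toDual ℝ (E n)).symm (LinearMap.toContinuousLinearMap p.linear)

lemma inner_affineGrad (p : E n →ᵃ[ℝ] ℝ) (u : E n) : inner ℝ (affineGrad p) u = p.linear u := by
  rw [affineGrad, InnerProductSpace.toDual_symm_apply, LinearMap.coe_toContinuousLinearMap']

lemma continuous_affine (p : E n →ᵃ[ℝ] ℝ) : Continuous p := p.continuous_of_finiteDimensional

lemma contDiff_affine (p : E n →ᵃ[ℝ] ℝ) : ContDiff ℝ ∞ p := by
  have : (p : E n → ℝ) = fun x => LinearMap.toContinuousLinearMap p.linear x + p 0 := by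
    ext x
    exact congrFun p.decomp x
  rw [this]
  fun_prop

lemma hasGradientAt_affine (p : E n →ᵃ[ℝ] ℝ) (x : E n) : HasGradientAt p (affineGrad p) x := by
  rw [hasGradientAt_iff_hasFDerivAt, affineGrad, LinearIsometryEquiv.apply_symm_apply]
  have : (p : E n → ℝ) = fun x => LinearMap.toContinuousLinearMap p.linear x + p 0 := by
    ext x
    exact congrFun p.decomp x
  rw [this]
  exact (ContinuousLinearMap.hasFDerivAt _).add_const _

lemma gradient_affine (p : E n →ᵃ[ℝ] ℝ) (x : E n) : ∇ (p : E n → ℝ) x = affineGrad p :=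
  (hasGradientAt_affine p x).gradient

lemma measurable_gradient (f : E n → ℝ) : Measurable (∇ f) :=
  (InnerProductSpace.toDual ℝ (E n)).symm.continuous.measurable.comp (measurable_fderiv ℝ f)

section Piecewise

variable {Ω : Set (E n)} {T : Finset (Finset (E n))} {w : E n → ℝ}
  {P : Finset (E n) → E n →ᵃ[ℝ] ℝ}

lemma continuousOn_piecewise (hcov : ⋃ K ∈ T, convexHull ℝ (K : Set (E n)) = closure Ω)
    (hw : ∀ K ∈ T, ∀ x ∈ convexHull ℝ (K : Set (E n)), w x = P K x) :
    ContinuousOn w (closure Ω) := by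
  have hcov' : ⋃ K : T, convexHull ℝ (K.1 : Set (E n)) = closure Ω := by
    rw [← hcov]
    exact iUnion_subtype (· ∈ T) fun K => convexHull ℝ (K.1 : Set (E n))
  rw [← hcov']
  refine (locallyFinite_of_finite _).continuousOn_iUnion (fun K => ?_) fun K => ?_
  · exact (K.1.finite_toSet.isCompact_convexHull (𝕜 := ℝ)).isClosed
  · exact (continuous_affine (P K.1)).continuousOn.congr fun x hx => hw K.1 K.2 x hx

lemma hasGradientAt_piecewise (hw : ∀ K ∈ T, ∀ x ∈ convexHull ℝ (K : Set (E n)), w x = P K x)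
    {K : Finset (E n)} (hK : K ∈ T) {x : E n} (hx : x ∈ interior (convexHull ℝ (K : Set (E n)))) :
    HasGradientAt w (affineGrad (P K)) x := by
  refine (hasGradientAt_affine (P K) x).congr_of_eventuallyEq ?_
  filter_upwards [isOpen_interior.mem_nhds hx] with y hy
  exact hw K hK y (interior_subset hy)

/-- Almost every point is in the interior of an element. -/
lemma ae_mem_interior (hcov : ⋃ K ∈ T, convexHull ℝ (K : Set (E n)) = closure Ω) :
    ∀ᵐ x : E n, x ∈ closure Ω → ∃ K ∈ T, x ∈ interior (convexHull ℝ (K : Set (E n))) := by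
  have h : ∀ᵐ x : E n, ∀ K ∈ T, x ∉ frontier (convexHull ℝ (K : Set (E n))) := by
    rw [Finset.eventually_all]
    intro K _
    exact measure_eq_zero_iff_ae_notMem.1 ((convex_convexHull ℝ _).addHaar_frontier _)
  filter_upwards [h] with x hx hxΩ
  rw [← hcov] at hxΩ
  simp only [mem_iUnion] at hxΩ
  obtain ⟨K, hK, hxK⟩ := hxΩ
  refine ⟨K, hK, ?_⟩
  by_contra hni
  exact hx K hK ⟨subset_closure hxK, hni⟩

lemma memLp_of_continuousOn_closure (hΩ : IsOpen Ω) (hb : Bornology.IsBounded Ω)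
    (hc : ContinuousOn w (closure Ω)) : MemLp w 2 (volume.restrict Ω) := by
  have hfin : IsFiniteMeasure (volume.restrict Ω) :=
    ⟨by rw [Measure.restrict_apply_univ]; exact hb.measure_lt_top⟩
  obtain ⟨C, hC⟩ := (hb.isCompact_closure.image_of_continuousOn hc).isBounded.exists_norm_le
  refine MemLp.of_bound ((hc.mono subset_closure).aestronglyMeasurable hΩ.measurableSet) C ?_
  filter_upwards [ae_restrict_mem hΩ.measurableSet] with x hx
  exact hC _ ⟨x, subset_closure hx, rfl⟩

lemma exists_gradient_bound (hΩ : IsOpen Ω)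
    (hcov : ⋃ K ∈ T, convexHull ℝ (K : Set (E n)) = closure Ω)
    (hw : ∀ K ∈ T, ∀ x ∈ convexHull ℝ (K : Set (E n)), w x = P K x) :
    ∃ C, ∀ᵐ x ∂volume.restrict Ω, ‖∇ w x‖ ≤ C := by
  refine ⟨∑ K ∈ T, ‖affineGrad (P K)‖, ?_⟩
  filter_upwards [ae_restrict_mem hΩ.measurableSet, ae_restrict_of_ae (ae_mem_interior hcov)]
    with x hx h
  obtain ⟨K, hK, hxK⟩ := h (subset_closure hx)
  rw [(hasGradientAt_piecewise hw hK hxK).gradient]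
  exact Finset.single_le_sum (f := fun K => ‖affineGrad (P K)‖) (fun _ _ => norm_nonneg _) hK

lemma memLp_gradient_piecewise (hΩ : IsOpen Ω) (hb : Bornology.IsBounded Ω)
    (hcov : ⋃ K ∈ T, convexHull ℝ (K : Set (E n)) = closure Ω)
    (hw : ∀ K ∈ T, ∀ x ∈ convexHull ℝ (K : Set (E n)), w x = P K x) :
    MemLp (∇ w) 2 (volume.restrict Ω) := by
  have hfin : IsFiniteMeasure (volume.restrict Ω) :=
    ⟨by rw [Measure.restrict_apply_univ]; exact hb.measure_lt_top⟩
  obtain ⟨C, hC⟩ := exists_gradient_bound hΩ hcov hw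
  exact MemLp.of_bound (measurable_gradient w).aestronglyMeasurable C hC

/-- The product of a continuous piecewise affine function with a test function is Lipschitz. -/
lemma exists_lipschitzWith_mul (hcov : ⋃ K ∈ T, convexHull ℝ (K : Set (E n)) = closure Ω)
    (hΩ : IsOpen Ω) (hw : ∀ K ∈ T, ∀ x ∈ convexHull ℝ (K : Set (E n)), w x = P K x)
    {φ : E n → ℝ} (hφ : ContDiff ℝ ∞ φ) (hφc : HasCompactSupport φ) (hφΩ : tsupport φ ⊆ Ω) :
    ∃ C, LipschitzWith C fun x => φ x * w x := by
  have h : ∀ K : T, ∃ C : NNReal, LipschitzWith C fun x => φ x * P K.1 x := fun K =>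
    ContDiff.lipschitzWith_of_hasCompactSupport hφc.mul_right (hφ.mul (contDiff_affine (P K.1)))
      (by simp)
  choose C hC using h
  -- The index `none` adds the complement of `Ω` to the cover, where the product vanishes; the sum
  -- of the constants dominates each of them.
  refine ⟨∑ K, C K, lipschitzWith_of_closed_cover
    (A := fun o : Option T => o.elim Ωᶜ fun K => convexHull ℝ (K.1 : Set (E n))) ?_ ?_ ?_⟩
  · rintro (_ | K)
    · exact hΩ.isClosed_compl
    · exact (K.1.finite_toSet.isCompact_convexHull (𝕜 := ℝ)).isClosed
  · refine eq_univ_of_forall fun x => ?_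
    by_cases hx : x ∈ Ω
    · have := subset_closure hx
      rw [← hcov] at this
      simp only [mem_iUnion] at this
      obtain ⟨K, hK, hxK⟩ := this
      exact mem_iUnion.2 ⟨some ⟨K, hK⟩, hxK⟩
    · exact mem_iUnion.2 ⟨none, hx⟩
  · rintro (_ | K)
    · have : EqOn (fun x => φ x * w x) (fun _ => 0) Ωᶜ := fun x hx => by
        simp [image_eq_zero_of_notMem_tsupport fun h => hx (hφΩ h)]
      intro x hx y hy
      rw [this hx, this hy]
      simp
    · have : EqOn (fun x => φ x * w x) (fun x => φ x * P K.1 x)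
          (convexHull ℝ (K.1 : Set (E n))) := fun x hx => by
        simp only [hw K.1 K.2 x hx]
      intro x hx y hy
      rw [this hx, this hy]
      exact ((hC K).weaken (Finset.single_le_sum (f := C) (fun _ _ => zero_le)
        (Finset.mem_univ K))) x y

/-- A continuous piecewise affine function has its elementwise gradient as weak gradient. -/
lemma hasWeakGradient_piecewise (hΩ : IsOpen Ω) (hb : Bornology.IsBounded Ω)
    (hcov : ⋃ K ∈ T, convexHull ℝ (K : Set (E n)) = closure Ω)
    (hw : ∀ K ∈ T, ∀ x ∈ convexHull ℝ (K : Set (E n)), w x = P K x) :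
    HasWeakGradient Ω w (∇ w) := by
  have hfin : IsFiniteMeasure (volume.restrict Ω) :=
    ⟨by rw [Measure.restrict_apply_univ]; exact hb.measure_lt_top⟩
  have hwL := memLp_of_continuousOn_closure hΩ hb (continuousOn_piecewise hcov hw)
  have hgL := memLp_gradient_piecewise hΩ hb hcov hw
  have hwi : IntegrableOn w Ω := hwL.integrable (by norm_num)
  have hgi : IntegrableOn (∇ w) Ω := hgL.integrable (by norm_num)
  refine ⟨hwi.locallyIntegrableOn, hgi.locallyIntegrableOn, ?_⟩
  intro φ hφ hφc hφΩ
  obtain ⟨C, hC⟩ := exists_lipschitzWith_mul hcov hΩ hw hφ hφc hφΩ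
  have hφg : Continuous (∇ φ) := (InnerProductSpace.toDual ℝ (E n)).symm.continuous.comp
    (hφ.continuous_fderiv (by simp))
  have hφ0 : ∀ x ∉ tsupport φ, φ x = 0 ∧ ∇ φ x = 0 := fun x hx =>
    ⟨image_eq_zero_of_notMem_tsupport hx, by
      rw [gradient, fderiv_of_notMem_tsupport ℝ hx, map_zero]⟩
  obtain ⟨C₁, hC₁⟩ := hφg.bounded_above_of_compact_support
    (HasCompactSupport.intro hφc.isCompact fun x hx => (hφ0 x hx).2)
  obtain ⟨C₂, hC₂⟩ := hφ.continuous.bounded_above_of_compact_support hφc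
  have hi1 : IntegrableOn (fun x => w x • ∇ φ x) Ω :=
    Integrable.smul_bdd hwi C₁ hφg.aestronglyMeasurable (ae_of_all _ hC₁)
  have hi2 : IntegrableOn (fun x => φ x • ∇ w x) Ω :=
    Integrable.bdd_smul hgi C₂ hφ.continuous.aestronglyMeasurable (ae_of_all _ hC₂)
  rw [eq_neg_iff_add_eq_zero, ← integral_add hi1 hi2]
  have hi : IntegrableOn (fun x => w x • ∇ φ x + φ x • ∇ w x) Ω := hi1.add hi2
  have hsupp : ∀ x ∉ Ω, w x • ∇ φ x + φ x • ∇ w x = 0 := fun x hx => by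
    have := hφ0 x fun h => hx (hφΩ h)
    simp [this.1, this.2]
  -- Tested with a direction `v`, the claim says that the derivative of the Lipschitz function `φ *
  -- w` along `v` has integral zero.
  refine ext_inner_left ℝ fun v => ?_
  rw [inner_zero_right, ← integral_inner hi v,
    setIntegral_eq_integral_of_forall_compl_eq_zero (fun x hx => by
      rw [hsupp x hx, inner_zero_right])]
  have hzero : ∫ x, lineDeriv ℝ (fun x => φ x * w x) x v = 0 := by
    -- Integration by parts against the constant one; the formula reverses the direction, hence
    -- `-v`.
    have h := (LipschitzWith.const' (K := 0) (1 : ℝ) (α := E n)).integral_lineDeriv_mul_eq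
      (μ := volume) hC hφc.mul_right (-v)
    have h0 : ∀ x : E n, lineDeriv ℝ (fun _ : E n => (1 : ℝ)) x (-v) = 0 := fun x => by
      simp [lineDeriv]
    simpa [h0] using h.symm
  rw [← hzero]
  refine integral_congr_ae ?_
  filter_upwards [ae_mem_interior hcov] with x hx
  by_cases hxs : x ∈ tsupport φ
  · obtain ⟨K, hK, hxK⟩ := hx (subset_closure (hφΩ hxs))
    have h1 := (hasGradientAt_piecewise hw hK hxK)
    have h2 : HasGradientAt φ (∇ φ x) x :=
      ((hφ.differentiable (by simp)) x).hasGradientAt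
    have h3 := (h2.hasFDerivAt.mul h1.hasFDerivAt).hasLineDerivAt v
    rw [show (fun x => φ x * w x) = φ * w from rfl, h3.lineDeriv, h1.gradient]
    simp only [_root_.add_apply, _root_.smul_apply,
      InnerProductSpace.toDual_apply_apply, inner_add_right, inner_smul_right, smul_eq_mul]
    rw [real_inner_comm v, real_inner_comm v]
    ring
  · have h2 : (fun x => φ x * w x) =ᶠ[𝓝 x] fun _ => 0 := by
      filter_upwards [(isClosed_tsupport φ).isOpen_compl.mem_nhds hxs] with y hy
      rw [(hφ0 y hy).1, zero_mul]
    rw [h2.lineDeriv_eq]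
    have := hφ0 x hxs
    simp [this.1, this.2, lineDeriv]

end Piecewise

/-- Weak gradients are unique. -/
lemma HasWeakGradient.ae_eq {Ω : Set (E n)} (hΩ : IsOpen Ω) {w : E n → ℝ} {W W' : E n → E n}
    (h : HasWeakGradient Ω w W) (h' : HasWeakGradient Ω w W') :
    W =ᵐ[volume.restrict Ω] W' := by
  have hint : ∀ U : E n → E n, LocallyIntegrableOn U Ω → ∀ φ : E n → ℝ, ContDiff ℝ ∞ φ →
      HasCompactSupport φ → tsupport φ ⊆ Ω → Integrable fun x => φ x • U x := by
    intro U hU φ hφ hφc hφΩ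
    have h1 : IntegrableOn U (tsupport φ) := hU.integrableOn_compact_subset hφΩ hφc
    obtain ⟨C, hC⟩ := hφ.continuous.bounded_above_of_compact_support hφc
    have h2 : IntegrableOn (fun x => φ x • U x) (tsupport φ) :=
      Integrable.bdd_smul h1 C hφ.continuous.aestronglyMeasurable (ae_of_all _ hC)
    refine (integrableOn_iff_integrable_of_support_subset fun x hx => ?_).1 h2
    by_contra hxs
    exact hx (by simp [image_eq_zero_of_notMem_tsupport hxs])
  have key := hΩ.ae_eq_zero_of_integral_contDiff_smul_eq_zero (μ := volume)
    (f := fun x => W x - W' x) (h.2.1.sub h'.2.1) ?_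
  · rw [EventuallyEq, ae_restrict_iff' hΩ.measurableSet]
    filter_upwards [key] with x hx hxΩ
    exact sub_eq_zero.1 (hx hxΩ)
  · intro φ hφ hφc hφΩ
    have hφ0 : ∀ x ∉ Ω, φ x = 0 := fun x hx =>
      image_eq_zero_of_notMem_tsupport fun h => hx (hφΩ h)
    have e : ∀ U : E n → E n, ∫ x in Ω, φ x • U x = ∫ x, φ x • U x := fun U =>
      setIntegral_eq_integral_of_forall_compl_eq_zero fun x hx => by rw [hφ0 x hx, zero_smul]
    have h1 := h.2.2 φ hφ hφc hφΩ
    rw [h'.2.2 φ hφ hφc hφΩ, e, e, neg_inj] at h1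
    simp only [smul_sub]
    rw [integral_sub (hint W h.2.1 φ hφ hφc hφΩ) (hint W' h'.2.1 φ hφ hφc hφΩ), h1, sub_self]

lemma HasWeakGradient.weakGrad_ae_eq {Ω : Set (E n)} (hΩ : IsOpen Ω) {w : E n → ℝ}
    {W : E n → E n} (h : HasWeakGradient Ω w W) : weakGrad Ω w =ᵐ[volume.restrict Ω] W := by
  have hex : ∃ W, HasWeakGradient Ω w W := ⟨W, h⟩
  rw [weakGrad, dif_pos hex]
  exact hex.choose_spec.ae_eq hΩ h

end HyperDG

namespace HyperDG

/-! ### Affine functions on elements -/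

section Simplex

variable {n : ℕ} {K : Finset (E n)}

lemma affineSpan_eq_top (hK : AffineIndependent ℝ ((↑) : K → E n)) (hc : K.card = n + 1) :
    affineSpan ℝ (K : Set (E n)) = ⊤ := by
  have := hK.affineSpan_eq_top_iff_card_eq_finrank_add_one
  rw [Subtype.range_coe_subtype] at this
  exact this.2 (by simpa using hc)

lemma affineMap_finset_sum_apply {ι : Type*} (s : Finset ι) (f : ι → E n →ᵃ[ℝ] ℝ) (x : E n) :
    (∑ a ∈ s, f a) x = ∑ a ∈ s, f a x := by
  induction s using Finset.induction_on with
  | empty => simp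
  | insert a s ha ih => rw [Finset.sum_insert ha, Finset.sum_insert ha, ← ih]; rfl

lemma exists_affine_interpolation (hK : AffineIndependent ℝ ((↑) : K → E n))
    (hc : K.card = n + 1) (c : E n → ℝ) : ∃ p : E n →ᵃ[ℝ] ℝ, ∀ y ∈ K, p y = c y := by
  let b : AffineBasis K ℝ (E n) := ⟨(↑), hK, by
    rw [Subtype.range_coe_subtype]
    exact affineSpan_eq_top hK hc⟩
  refine ⟨∑ a : K, c a.1 • b.coord a, fun y hy => ?_⟩
  have hb : ∀ a : K, b.coord a y = if a = ⟨y, hy⟩ then 1 else 0 := fun a =>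
    b.coord_apply a ⟨y, hy⟩
  rw [affineMap_finset_sum_apply]
  simp [hb]

/-- By continuity, equality almost everywhere is equality on the interior of the element, a nonempty
open set, which spans the space affinely. -/
lemma AgreesOn.unique (hK : AffineIndependent ℝ ((↑) : K → E n)) (hc : K.card = n + 1)
    {w : E n → ℝ} {p q : E n →ᵃ[ℝ] ℝ} (hp : AgreesOn w K p) (hq : AgreesOn w K q) : p = q := by
  have h := hp.symm.trans hq
  have h1 : (p : E n → ℝ) =ᵐ[volume.restrict (interior (convexHull ℝ (K : Set (E n))))] q :=
    ae_restrict_of_ae_restrict_of_subset interior_subset h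
  have h2 := Measure.eqOn_open_of_ae_eq h1 isOpen_interior (continuous_affine p).continuousOn
    (continuous_affine q).continuousOn
  have hne : (interior (convexHull ℝ (K : Set (E n)))).Nonempty :=
    interior_convexHull_nonempty hK (by simpa using hc)
  exact AffineMap.ext_on (isOpen_interior.affineSpan_eq_top hne) h2

lemma agreesOn_elemPoly {w : E n → ℝ} (h : ∃ p, AgreesOn w K p) : AgreesOn w K (elemPoly w K) := by
  rw [elemPoly, dif_pos h]
  exact h.choose_spec

lemma elemPoly_eq (hK : AffineIndependent ℝ ((↑) : K → E n)) (hc : K.card = n + 1)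
    {w : E n → ℝ} {p : E n →ᵃ[ℝ] ℝ} (hp : AgreesOn w K p) : elemPoly w K = p :=
  (agreesOn_elemPoly ⟨p, hp⟩).unique hK hc hp

end Simplex

/-- The faces of codimension one have finite measure. -/
lemma hausdorffMeasure_convexHull_lt_top {n k : ℕ} (hn : n = 1 ∨ n = 2) {S : Finset (E k)}
    (hS : S.card = n) : μH[(n : ℝ) - 1] (convexHull ℝ (S : Set (E k))) < ⊤ := by
  rcases hn with rfl | rfl
  · obtain ⟨a, rfl⟩ := Finset.card_eq_one.1 hS
    simp
  · obtain ⟨a, b, -, rfl⟩ := Finset.card_eq_two.1 hS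
    have : ((2 : ℕ) : ℝ) - 1 = 1 := by norm_num
    rw [this, Finset.coe_pair, convexHull_pair, hausdorffMeasure_segment]
    exact edist_lt_top a b

namespace Network.Mesh

variable {n d N : ℕ} {G : Network n d N} (M : G.Mesh)

/-- The relative interior of an element lies in `Ω`, so a frontier point has a proper minimal face,
and finitely many faces of codimension one cover the frontier. This makes bounded traces square
integrable. -/
lemma hausdorffMeasure_frontier_lt_top (M : G.Mesh) (hn : n = 1 ∨ n = 2) (i : Fin N) :
    μH[(n : ℝ) - 1] (frontier (G.Ω i)) < ⊤ := by
  have hsub : frontier (G.Ω i) ⊆ ⋃ K ∈ M.T i, ⋃ S ∈ K.powersetCard n,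
      convexHull ℝ (S : Set (E n)) := by
    intro y hy
    rw [(G.polytopal i).frontier_eq, ← M.cover i] at hy
    obtain ⟨hy, hyΩ⟩ := hy
    simp only [mem_iUnion] at hy ⊢
    obtain ⟨K, hK, hyK⟩ := hy
    obtain ⟨F, hF, hFy⟩ := exists_posCombo hyK
    have hne : F ≠ K := by
      rintro rfl
      exact hyΩ (M.interior_subset_domain hK (hFy.mem_interior (M.interior_nonempty hK)))
    have h1 := Finset.card_lt_card (Finset.ssubset_iff_subset_ne.2 ⟨hF, hne⟩)
    have h2 := M.card_eq i K hK
    obtain ⟨S, hFS, hSK, hS⟩ := Finset.exists_subsuperset_card_eq hF (n := n) (by omega)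
      (by omega)
    exact ⟨K, hK, S, Finset.mem_powersetCard.2 ⟨hSK, hS⟩,
      convexHull_mono (Finset.coe_subset.2 hFS) hFy.mem_convexHull⟩
  refine (measure_mono hsub).trans_lt ?_
  refine measure_biUnion_lt_top (M.T i).finite_toSet fun K _ => ?_
  refine measure_biUnion_lt_top (K.powersetCard n).finite_toSet fun S hS => ?_
  exact hausdorffMeasure_convexHull_lt_top hn (Finset.mem_powersetCard.1 hS).2

/-- Affine functions on two elements that agree at the common vertices agree on the
intersection. -/
lemma eq_of_eq_on_vertices {p q : Σ _ : Fin N, Finset (E n)} (hp : p ∈ M.elems)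
    (hq : q ∈ M.elems) {f g : E n →ᵃ[ℝ] ℝ}
    (h : ∀ a ∈ p.2, ∀ b ∈ q.2, G.Φ p.1 a = G.Φ q.1 b → f a = g b) {x y : E n}
    (hx : x ∈ convexHull ℝ (p.2 : Set (E n))) (hy : y ∈ convexHull ℝ (q.2 : Set (E n)))
    (hxy : G.Φ p.1 x = G.Φ q.1 y) : f x = g y := by
  have hxp : G.Φ p.1 x ∈ convexHull ℝ (M.emb p : Set (E d)) := by
    rw [convexHull_emb]; exact ⟨x, hx, rfl⟩
  have hxq : G.Φ p.1 x ∈ convexHull ℝ (M.emb q : Set (E d)) := by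
    rw [convexHull_emb]; exact ⟨y, hy, hxy.symm⟩
  -- By conformity the common point is a combination of common vertices, with the same weights in
  -- both coordinate systems.
  obtain ⟨w, -, hw1, hw2⟩ := Finset.mem_convexHull'.1 (M.conforming' hp hq hxp hxq)
  set S := M.emb p ∩ M.emb q
  have hpc : ∀ a ∈ S, G.Φ p.1 (G.coord p.1 a) = a ∧ G.coord p.1 a ∈ p.2 := by
    intro a ha
    obtain ⟨b, hb, rfl⟩ := M.mem_emb.1 (Finset.mem_inter.1 ha).1
    rw [coord_apply]
    exact ⟨rfl, hb⟩
  have hqc : ∀ a ∈ S, G.Φ q.1 (G.coord q.1 a) = a ∧ G.coord q.1 a ∈ q.2 := by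
    intro a ha
    obtain ⟨b, hb, rfl⟩ := M.mem_emb.1 (Finset.mem_inter.1 ha).2
    rw [coord_apply]
    exact ⟨rfl, hb⟩
  have hx' : x = ∑ a ∈ S, w a • G.coord p.1 a := by
    apply (G.Φ p.1).injective
    have := affineMap_sum_smul (G.Φ p.1).toAffineMap S w (fun a => G.coord p.1 a) hw1
    refine Eq.trans ?_ this.symm
    rw [← hw2]
    exact Finset.sum_congr rfl fun a ha => congrArg (w a • ·) (hpc a ha).1.symm
  have hy' : y = ∑ a ∈ S, w a • G.coord q.1 a := by
    apply (G.Φ q.1).injective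
    have := affineMap_sum_smul (G.Φ q.1).toAffineMap S w (fun a => G.coord q.1 a) hw1
    refine Eq.trans ?_ this.symm
    rw [← hxy, ← hw2]
    exact Finset.sum_congr rfl fun a ha => congrArg (w a • ·) (hqc a ha).1.symm
  rw [hx', hy', affineMap_sum_smul _ _ _ _ hw1, affineMap_sum_smul _ _ _ _ hw1]
  refine Finset.sum_congr rfl fun a ha => ?_
  rw [h _ (hpc a ha).2 _ (hqc a ha).2 ((hpc a ha).1.trans (hqc a ha).1.symm)]

/-! #### The enriched function -/

lemma bary_apply {i : Fin N} {K : Finset (E n)} (hK : K ∈ M.T i) (z : E d) {y : E n}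
    (hy : y ∈ K) : M.bary i K z y = if G.Φ i y = z then 1 else 0 := by
  have h := exists_affine_interpolation (M.indep i K hK) (M.card_eq i K hK)
    (fun y => if G.Φ i y = z then 1 else 0)
  rw [bary, dif_pos h]
  exact h.choose_spec y hy

/-- The element chosen in `hat` does not matter: the local basis functions of two elements agree at
common vertices, hence where the elements meet. -/
lemma hat_apply {i : Fin N} {K : Finset (E n)} (hK : K ∈ M.T i) (z : E d) {x : E n}
    (hx : x ∈ convexHull ℝ (K : Set (E n))) : M.hat z i x = M.bary i K z x := by
  have h : ∃ K ∈ M.T i, x ∈ convexHull ℝ (K : Set (E n)) := ⟨K, hK, hx⟩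
  rw [hat, dif_pos h]
  refine M.eq_of_eq_on_vertices (p := ⟨i, h.choose⟩) (q := ⟨i, K⟩)
    (M.mk_mem_elems.2 h.choose_spec.1) (M.mk_mem_elems.2 hK) ?_ h.choose_spec.2 hx rfl
  intro a ha b hb hab
  rw [M.bary_apply h.choose_spec.1 z ha, M.bary_apply hK z hb, hab]

/-- The values of `E_h v` at the vertices. -/
def nodeVal (v : Fin N → E n → ℝ) (z : E d) : ℝ := if z ∈ M.nodes then M.nodalAvg v z else 0

/-- The restriction of `E_h v` to an element. -/
def enrichPoly (v : Fin N → E n → ℝ) (i : Fin N) (K : Finset (E n)) : E n →ᵃ[ℝ] ℝ :=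
  ∑ z ∈ M.nodes, M.nodalAvg v z • M.bary i K z

variable (v : Fin N → E n → ℝ)

lemma enrich_apply {i : Fin N} {K : Finset (E n)} (hK : K ∈ M.T i) {x : E n}
    (hx : x ∈ convexHull ℝ (K : Set (E n))) : M.enrich v i x = M.enrichPoly v i K x := by
  rw [enrich, enrichPoly, affineMap_finset_sum_apply]
  refine Finset.sum_congr rfl fun z _ => ?_
  rw [M.hat_apply hK z hx]
  rfl

lemma enrichPoly_vertex {i : Fin N} {K : Finset (E n)} (hK : K ∈ M.T i) {y : E n}
    (hy : y ∈ K) : M.enrichPoly v i K y = M.nodeVal v (G.Φ i y) := by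
  rw [enrichPoly, affineMap_finset_sum_apply, nodeVal]
  simp [M.bary_apply hK _ hy]

lemma agreesOn_enrich {i : Fin N} {K : Finset (E n)} (hK : K ∈ M.T i) :
    AgreesOn (M.enrich v i) K (M.enrichPoly v i K) := by
  rw [AgreesOn, EventuallyEq, ae_restrict_iff' (K.finite_toSet.isCompact_convexHull
    (𝕜 := ℝ)).isClosed.measurableSet]
  exact ae_of_all _ fun x hx => M.enrich_apply v hK hx

lemma elemPoly_enrich {i : Fin N} {K : Finset (E n)} (hK : K ∈ M.T i) :
    elemPoly (M.enrich v i) K = M.enrichPoly v i K :=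
  elemPoly_eq (M.indep i K hK) (M.card_eq i K hK) (M.agreesOn_enrich v hK)

lemma continuousOn_enrich (i : Fin N) : ContinuousOn (M.enrich v i) (closure (G.Ω i)) :=
  continuousOn_piecewise (M.cover i) fun _ hK _ hx => M.enrich_apply v hK hx

lemma memLp_enrich (i : Fin N) : MemLp (M.enrich v i) 2 (volume.restrict (G.Ω i)) :=
  memLp_of_continuousOn_closure (G.polytopal i).isOpen (G.polytopal i).isBounded
    (M.continuousOn_enrich v i)

lemma memV_enrich : M.MemV (M.enrich v) := fun i =>
  ⟨M.memLp_enrich v i, fun _ hK => ⟨_, M.agreesOn_enrich v hK⟩⟩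

lemma hasWeakGradient_enrich (i : Fin N) :
    HasWeakGradient (G.Ω i) (M.enrich v i) (∇ (M.enrich v i)) :=
  hasWeakGradient_piecewise (G.polytopal i).isOpen (G.polytopal i).isBounded (M.cover i)
    fun _ hK _ hx => M.enrich_apply v hK hx

lemma memLp_gradient_enrich (i : Fin N) :
    MemLp (∇ (M.enrich v i)) 2 (volume.restrict (G.Ω i)) :=
  memLp_gradient_piecewise (G.polytopal i).isOpen (G.polytopal i).isBounded (M.cover i)
    fun _ hK _ hx => M.enrich_apply v hK hx

/-- As the function is continuous up to the boundary, the constant sequence serves as approximation.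
-/
lemma hasTrace_enrich (hn : n = 1 ∨ n = 2) (i : Fin N) :
    HasTrace (G.Ω i) (M.enrich v i) (M.enrich v i) := by
  have hc := M.continuousOn_enrich v i
  have hw := M.hasWeakGradient_enrich v i
  refine ⟨?_, fun _ => M.enrich v i, fun _ => ∇ (M.enrich v i), ∇ (M.enrich v i),
    fun _ => ⟨hc, M.memLp_enrich v i, hw, M.memLp_gradient_enrich v i⟩, hw, ?_, ?_, ?_⟩
  · have hfin : IsFiniteMeasure (μH[(n : ℝ) - 1].restrict (frontier (G.Ω i))) :=
      ⟨by rw [Measure.restrict_apply_univ]; exact M.hausdorffMeasure_frontier_lt_top hn i⟩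
    obtain ⟨C, hC⟩ := ((G.polytopal i).isBounded.isCompact_closure.image_of_continuousOn
      hc).isBounded.exists_norm_le
    have hm : MeasurableSet (frontier (G.Ω i)) := isClosed_frontier.measurableSet
    refine MemLp.of_bound ((hc.mono frontier_subset_closure).aestronglyMeasurable hm) C ?_
    filter_upwards [ae_restrict_mem hm] with x hx
    exact hC _ ⟨x, frontier_subset_closure hx, rfl⟩
  all_goals simp

/-- `E_h v` has the same values on all domains that meet at a point. -/
lemma enrich_eq_of_eq {i j : Fin N} {x y : E n} (hx : x ∈ closure (G.Ω i))
    (hy : y ∈ closure (G.Ω j)) (hxy : G.Φ i x = G.Φ j y) :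
    M.enrich v i x = M.enrich v j y := by
  rw [← M.cover] at hx hy
  simp only [mem_iUnion] at hx hy
  obtain ⟨K, hK, hxK⟩ := hx
  obtain ⟨L, hL, hyL⟩ := hy
  rw [M.enrich_apply v hK hxK, M.enrich_apply v hL hyL]
  refine M.eq_of_eq_on_vertices (p := ⟨i, K⟩) (q := ⟨j, L⟩) (M.mk_mem_elems.2 hK)
    (M.mk_mem_elems.2 hL) ?_ hxK hyL hxy
  intro a ha b hb hab
  rw [M.enrichPoly_vertex v hK ha, M.enrichPoly_vertex v hL hb, hab]

/-- The minimal face of a point of `∂G` lies in `∂G`, so none of its vertices is a node; an affine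
function vanishing at the vertices vanishes on the face. -/
lemma enrich_eq_zero_of_boundary {i : Fin N} {y : E n} (hy : y ∈ closure (G.Ω i))
    (hb : G.Φ i y ∈ G.boundary) : M.enrich v i y = 0 := by
  rw [← M.cover] at hy
  simp only [mem_iUnion] at hy
  obtain ⟨K, hK, hyK⟩ := hy
  obtain ⟨F, hF, hFy⟩ := exists_posCombo hyK
  have hFb := M.convexHull_subset_boundary (p := ⟨i, K⟩) (M.mk_mem_elems.2 hK)
    (F := F.image (G.Φ i).toAffineMap) (by
      rw [emb_eq]
      exact Finset.image_subset_image hF) (hFy.image (G.Φ i).injective) hb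
  rw [M.enrich_apply v hK hyK]
  obtain ⟨w, -, h1, rfl⟩ := hFy
  rw [affineMap_sum_smul _ _ _ _ h1]
  refine Finset.sum_eq_zero fun a ha => ?_
  rw [M.enrichPoly_vertex v hK (hF ha), nodeVal, if_neg, smul_zero]
  intro hnode
  exact (Finset.mem_filter.1 hnode).2 (hFb (subset_convexHull ℝ _
    (Finset.mem_coe.2 (Finset.mem_image_of_mem _ ha))))

lemma memH10_enrich (hn : n = 1 ∨ n = 2) : G.MemH10 (M.enrich v) := by
  refine ⟨fun i => ⟨M.memLp_enrich v i, _, M.hasWeakGradient_enrich v i,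
    M.memLp_gradient_enrich v i⟩, M.enrich v, M.hasTrace_enrich v hn, ?_, ?_⟩
  · intro γ hγ i hi j hj
    refine ae_restrict_of_forall_mem (G.bif_isCompact hγ).isClosed.measurableSet fun x hx => ?_
    obtain ⟨y, hy, rfl⟩ := G.mem_I.1 hi hx
    obtain ⟨y', hy', hyy⟩ := G.mem_I.1 hj hx
    rw [G.coord_apply, ← hyy, G.coord_apply]
    exact M.enrich_eq_of_eq v hy hy' hyy.symm
  · intro i
    have hcl : IsClosed (G.Φ i '' frontier (G.Ω i)) :=
      (G.Φ i).isometry.isClosedEmbedding.isClosedMap _ isClosed_frontier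
    refine ae_restrict_of_forall_mem (hcl.inter isClosed_closure).measurableSet ?_
    rintro x ⟨⟨y, hy, rfl⟩, hxb⟩
    rw [G.coord_apply]
    exact M.enrich_eq_zero_of_boundary v (frontier_subset_closure hy) hxb

lemma val_apply {i : Fin N} {K : Finset (E n)} {y : E n} :
    M.val v i K (G.Φ i y) = elemPoly (v i) K y := by
  rw [val, coord_apply]

lemma val_enrich {z : E d} {p : Σ _ : Fin N, Finset (E n)} (hp : p ∈ M.patch z) :
    M.val (M.enrich v) p.1 p.2 z = M.nodeVal v z := by
  obtain ⟨he, hz⟩ := M.mem_patch.1 hp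
  obtain ⟨y, hy, rfl⟩ := M.mem_emb.1 hz
  rw [val_apply, M.elemPoly_enrich v (M.mem_elems.1 he),
    M.enrichPoly_vertex v (M.mem_elems.1 he) hy]

end Network.Mesh
end HyperDG

namespace HyperDG

/-! ### Lower bounds for the norms on faces -/

/-- `f` is affine on the segments between the points of `F`. -/
def AffineAlong {k : ℕ} (F : Finset (E k)) (f : E k → ℝ) : Prop :=
  ∀ a ∈ F, ∀ b ∈ F, ∀ t : ℝ, f (AffineMap.lineMap a b t) = (1 - t) * f a + t * f b

lemma AffineAlong.sub {k : ℕ} {F : Finset (E k)} {f g : E k → ℝ} (hf : AffineAlong F f)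
    (hg : AffineAlong F g) : AffineAlong F fun x => f x - g x := by
  intro a ha b hb t
  simp only [hf a ha b hb t, hg a ha b hb t]
  ring

/-- An affine function on `[0, 1]` with value `A` at `0` is at least `|A| / 2` in modulus on the
first quarter if its slope is at most `2 * |A|`, and on the last quarter if the slope is larger. -/
lemma exists_quarter_interval (A B : ℝ) : ∃ t₀ : ℝ, 0 ≤ t₀ ∧ t₀ + 1 / 4 ≤ 1 ∧
    ∀ t ∈ Icc t₀ (t₀ + 1 / 4), A ^ 2 / 4 ≤ ((1 - t) * A + t * B) ^ 2 := by
  have key : ∀ t : ℝ, |A| / 2 ≤ |(1 - t) * A + t * B| → A ^ 2 / 4 ≤ ((1 - t) * A + t * B) ^ 2 := by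
    intro t h
    have := pow_le_pow_left₀ (by positivity) h 2
    rw [sq_abs, div_pow, sq_abs] at this
    linarith
  have hg : ∀ t : ℝ, (1 - t) * A + t * B = A + t * (B - A) := fun t => by ring
  rcases le_total |B - A| (2 * |A|) with h | h
  · refine ⟨0, le_rfl, by norm_num, fun t ht => key t ?_⟩
    rw [hg]
    have h1 := abs_sub_abs_le_abs_add A (t * (B - A))
    rw [abs_mul, abs_of_nonneg ht.1] at h1
    nlinarith [ht.2, ht.1, abs_nonneg (B - A), abs_nonneg A]
  · refine ⟨3 / 4, by norm_num, by norm_num, fun t ht => key t ?_⟩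
    rw [hg, add_comm]
    have h1 := abs_sub_abs_le_abs_add (t * (B - A)) A
    rw [abs_mul, abs_of_nonneg (by linarith [ht.1])] at h1
    nlinarith [ht.2, ht.1, abs_nonneg (B - A), abs_nonneg A]

/-- On a quarter of the segment the square is at least a quarter of `f z ^ 2`, hence the factor 16.
-/
lemma integral_segment_sq_ge {k : ℕ} {z a : E k} {f : E k → ℝ} (hf : AffineAlong {z, a} f) :
    dist z a / 16 * f z ^ 2 ≤ ∫ x in segment ℝ z a, f x ^ 2 ∂μH[1] := by
  have hline : ∀ t : ℝ, f (AffineMap.lineMap z a t) = (1 - t) * f z + t * f a :=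
    hf z (by simp) a (by simp)
  by_cases hza : z = a
  · rw [hza, dist_self, zero_div, zero_mul]
    exact integral_nonneg fun _ => sq_nonneg _
  have hd : 0 < dist z a := dist_pos.2 hza
  have hμ : ∀ x y : E k, μH[1] (segment ℝ x y) ≠ ⊤ := fun x y => by
    rw [hausdorffMeasure_segment]
    exact edist_ne_top x y
  have hm : ∀ x y : E k, MeasurableSet (segment ℝ x y) := fun x y => by
    rw [← convexHull_pair]
    exact ((Set.toFinite {x, y}).isCompact_convexHull (𝕜 := ℝ)).isClosed.measurableSet
  have hint : IntegrableOn (fun x => f x ^ 2) (segment ℝ z a) μH[1] := by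
    -- Off the segment nothing is known of `f`. On it, `f` is a continuous function of the distance
    -- to `z`, which yields integrability.
    have hg : Continuous fun x : E k => (f z + dist z x / dist z a * (f a - f z)) ^ 2 := by
      fun_prop
    have heq : ∀ x ∈ segment ℝ z a, f x ^ 2 = (f z + dist z x / dist z a * (f a - f z)) ^ 2 := by
      intro x hx
      rw [segment_eq_image_lineMap] at hx
      obtain ⟨t, ht, rfl⟩ := hx
      rw [hline, dist_left_lineMap, Real.norm_of_nonneg ht.1, mul_div_assoc, div_self hd.ne']
      ring
    have hfin : IsFiniteMeasure ((μH[1] : Measure (E k)).restrict (segment ℝ z a)) :=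
      ⟨by rw [Measure.restrict_apply_univ]; exact (hμ z a).lt_top⟩
    have hcomp : IsCompact (segment ℝ z a) := by
      rw [← convexHull_pair]
      exact (Set.toFinite {z, a}).isCompact_convexHull (𝕜 := ℝ)
    obtain ⟨C, hC⟩ := (hcomp.image hg).isBounded.exists_norm_le
    refine IntegrableOn.congr_fun (f := fun x => (f z + dist z x / dist z a * (f a - f z)) ^ 2)
      ?_ (fun x hx => (heq x hx).symm) (hm z a)
    refine Integrable.of_bound hg.aestronglyMeasurable C ?_
    filter_upwards [ae_restrict_mem (hm z a)] with x hx
    exact hC _ ⟨x, hx, rfl⟩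
  obtain ⟨t₀, h0, h1, ht⟩ := exists_quarter_interval (f z) (f a)
  set z' : E k := AffineMap.lineMap z a t₀
  set a' : E k := AffineMap.lineMap z a (t₀ + 1 / 4)
  have hpar : ∀ x ∈ segment ℝ z' a', ∃ t ∈ Icc t₀ (t₀ + 1 / 4), x = AffineMap.lineMap z a t := by
    intro x hx
    rw [segment_eq_image_lineMap] at hx
    obtain ⟨s, hs, rfl⟩ := hx
    refine ⟨AffineMap.lineMap t₀ (t₀ + 1 / 4) s, ?_, ?_⟩
    · rw [AffineMap.lineMap_apply_ring']
      constructor <;> nlinarith [hs.1, hs.2]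
    · exact ((AffineMap.lineMap z a).apply_lineMap t₀ (t₀ + 1 / 4) s).symm
  have hsub : segment ℝ z' a' ⊆ segment ℝ z a := by
    intro x hx
    obtain ⟨t, htI, rfl⟩ := hpar x hx
    rw [segment_eq_image_lineMap]
    exact ⟨t, ⟨h0.trans htI.1, htI.2.trans h1⟩, rfl⟩
  have hlen : (μH[1] : Measure (E k)).real (segment ℝ z' a') = dist z a / 4 := by
    rw [Measure.real, hausdorffMeasure_segment, edist_dist, ENNReal.toReal_ofReal dist_nonneg,
      dist_lineMap_lineMap, Real.dist_eq]
    have : |t₀ - (t₀ + 1 / 4)| = 1 / 4 := by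
      rw [sub_add_cancel_left, abs_neg, abs_of_pos (by norm_num)]
    rw [this]
    ring
  calc dist z a / 16 * f z ^ 2
      = ∫ _ in segment ℝ z' a', f z ^ 2 / 4 ∂μH[1] := by
        rw [setIntegral_const, hlen, smul_eq_mul]
        ring
    _ ≤ ∫ x in segment ℝ z' a', f x ^ 2 ∂μH[1] := by
        refine setIntegral_mono_on (integrableOn_const (hμ z' a')) (hint.mono_set hsub)
          (hm z' a') fun x hx => ?_
        obtain ⟨t, htI, rfl⟩ := hpar x hx
        rw [hline]
        exact ht t htI
    _ ≤ _ := setIntegral_mono_set hint (ae_of_all _ fun _ => sq_nonneg _)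
        (LE.le.eventuallyLE hsub)

/-- The weight `x ^ n / x ^ 2` is the scaling factor of squared gradient norms; in this form it
covers both dimensions. -/
lemma pow_div_sq_of_eq_one {n : ℕ} (hn : n = 1) {x : ℝ} (hx : 0 < x) :
    x ^ n / x ^ 2 = 1 / x := by
  subst hn
  field_simp

lemma pow_div_sq_of_eq_two {n : ℕ} (hn : n = 2) {x : ℝ} (hx : 0 < x) : x ^ n / x ^ 2 = 1 := by
  subst hn
  exact div_self (by positivity)

lemma size_pair {k : ℕ} (a b : E k) : size {a, b} = dist a b := by
  rw [size, convexHull_diam, Finset.coe_pair, Metric.diam_pair]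

lemma size_nonneg {k : ℕ} (K : Finset (E k)) : 0 ≤ size K := Metric.diam_nonneg

lemma dist_le_size {k : ℕ} {K : Finset (E k)} {x y : E k}
    (hx : x ∈ convexHull ℝ (K : Set (E k))) (hy : y ∈ convexHull ℝ (K : Set (E k))) :
    dist x y ≤ size K :=
  Metric.dist_le_diam_of_mem (K.finite_toSet.isCompact_convexHull (𝕜 := ℝ)).isBounded hx hy

/-- A bound along a chain in a finite set. -/
lemma abs_sub_le_of_chain {α : Type*} (P : Finset α) {R : α → α → Prop}
    (hR : ∀ a b, R a b → a ∈ P ∧ b ∈ P) {f : α → ℝ} {B : ℝ} (hB : 0 ≤ B)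
    (hf : ∀ a b, R a b → |f a - f b| ≤ B) {p q : α} (hp : p ∈ P)
    (h : Relation.ReflTransGen R p q) : |f p - f q| ≤ P.card * B := by
  -- In a graph the chain can be shortened to a path without repetitions, which has fewer steps than
  -- `P` has points. Symmetrising `R` is harmless since `|f a - f b|` is symmetric.
  let G := SimpleGraph.fromRel R
  have hG : ∀ a b, G.Adj a b → a ∈ P ∧ b ∈ P ∧ |f a - f b| ≤ B := by
    intro a b hab
    rw [SimpleGraph.fromRel_adj] at hab
    rcases hab.2 with h | h
    · exact ⟨(hR _ _ h).1, (hR _ _ h).2, hf _ _ h⟩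
    · exact ⟨(hR _ _ h).2, (hR _ _ h).1, abs_sub_comm (f a) (f b) ▸ hf _ _ h⟩
  have hreach : G.Reachable p q := by
    induction h with
    | refl => exact SimpleGraph.Reachable.refl _
    | @tail b c _ hbc ih =>
      by_cases hbc' : b = c
      · exact hbc' ▸ ih
      · exact ih.trans (SimpleGraph.Adj.reachable
          ((SimpleGraph.fromRel_adj _ _ _).2 ⟨hbc', Or.inl hbc⟩))
  have hwalk : ∀ {a b : α} (w : G.Walk a b), |f a - f b| ≤ w.length * B := by
    intro a b w
    induction w with
    | nil => simp
    | @cons a b c hab w ih =>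
      rw [SimpleGraph.Walk.length_cons]
      push_cast
      calc |f a - f c| ≤ |f a - f b| + |f b - f c| := abs_sub_le _ _ _
        _ ≤ B + w.length * B := add_le_add (hG _ _ hab).2.2 ih
        _ = (w.length + 1) * B := by ring
  have hsupp : ∀ {a b : α} (w : G.Walk a b), a ∈ P → ∀ c ∈ w.support, c ∈ P := by
    intro a b w
    induction w with
    | nil => simp
    | @cons a b c hab w ih =>
      intro ha c hc
      rw [SimpleGraph.Walk.support_cons, List.mem_cons] at hc
      rcases hc with rfl | hc
      · exact ha
      · exact ih (hG _ _ hab).2.1 c hc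
  obtain ⟨w⟩ := hreach
  have hpath := w.bypass_isPath
  refine (hwalk w.bypass).trans (mul_le_mul_of_nonneg_right ?_ hB)
  have h1 : w.bypass.support.toFinset.card = w.bypass.length + 1 := by
    rw [List.toFinset_card_of_nodup hpath.support_nodup, SimpleGraph.Walk.length_support]
  have h2 := Finset.card_le_card (s := w.bypass.support.toFinset) (t := P) fun c hc =>
    hsupp _ hp c (List.mem_toFinset.1 hc)
  exact_mod_cast (by omega : w.bypass.length ≤ P.card)

/-! ### Face norms, sizes and the number of elements at a vertex. -/

namespace Network.Mesh

variable {n d N : ℕ} {G : Network n d N} (M : G.Mesh)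

lemma faceSq_nonneg (F : Finset (E d)) (f : E d → ℝ) : 0 ≤ M.faceSq F f :=
  integral_nonneg fun _ => sq_nonneg _

lemma faceSq_sub_comm (F : Finset (E d)) (f g : E d → ℝ) :
    M.faceSq F (fun x => f x - g x) = M.faceSq F fun x => g x - f x := by
  unfold faceSq
  congr 1
  ext x
  ring

lemma size_pos {p : Σ _ : Fin N, Finset (E n)} (hn : 0 < n) (hp : p ∈ M.elems) :
    0 < size p.2 := by
  have hc := M.card_eq _ _ (M.mem_elems.1 hp)
  obtain ⟨a, ha, b, hb, hab⟩ := Finset.one_lt_card.1 (show 1 < p.2.card by omega)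
  exact (dist_pos.2 hab).trans_le
    (dist_le_size (subset_convexHull ℝ _ ha) (subset_convexHull ℝ _ hb))

lemma size_le_h {p : Σ _ : Fin N, Finset (E n)} (hp : p ∈ M.elems) : size p.2 ≤ M.h :=
  le_ciSup (f := fun p : M.elems => size p.1.2) (Set.finite_range _).bddAbove ⟨p, hp⟩

lemma size_le_hF (hn : n = 1) {p : Σ _ : Fin N, Finset (E n)} (hp : p ∈ M.elems)
    {F : Finset (E d)} (hF : F ⊆ M.emb p) : size p.2 ≤ M.hF F := by
  rw [Network.Mesh.hF, if_pos hn]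
  exact le_ciSup (f := fun p : M.elems.filter (fun p => F ⊆ M.emb p) => size p.1.2)
    (Set.finite_range _).bddAbove ⟨p, Finset.mem_filter.2 ⟨hp, hF⟩⟩

lemma hF_pos (hn : n = 1 ∨ n = 2) {F : Finset (E d)} (hF : F ∈ M.faces) : 0 < M.hF F := by
  obtain ⟨p, hp, hFp, hc⟩ := M.mem_faces.1 hF
  by_cases h1 : n = 1
  · exact (M.size_pos (by omega) hp).trans_le (M.size_le_hF h1 hp hFp)
  · rw [Network.Mesh.hF, if_neg h1]
    obtain ⟨a, b, hab, rfl⟩ := Finset.card_eq_two.1 (show F.card = 2 by omega)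
    rw [size_pair]
    exact dist_pos.2 hab

/-- The squared value of an affine function at an endpoint of a face is controlled by its norm on
the face. -/
lemma faceSq_ge (hn : n = 1 ∨ n = 2) {F : Finset (E d)} (hF : F ∈ M.faces) {z : E d}
    (hz : z ∈ F) {f : E d → ℝ} (hf : AffineAlong F f) :
    M.hF F ^ n / M.hF F ^ 2 * f z ^ 2 ≤ 16 * (1 / M.hF F * M.faceSq F f) := by
  have hpos := M.hF_pos hn hF
  obtain ⟨p, hp, hFp, hc⟩ := M.mem_faces.1 hF
  rcases hn with hn | hn
  · obtain ⟨a, rfl⟩ := Finset.card_eq_one.1 (hc.trans hn)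
    obtain rfl := Finset.mem_singleton.1 hz
    have h0 : (n : ℝ) - 1 = 0 := by rw [hn]; norm_num
    have : M.faceSq {z} f = f z ^ 2 := by
      rw [faceSq, h0, Finset.coe_singleton, convexHull_singleton, integral_singleton, Measure.real,
        Measure.hausdorffMeasure_zero_singleton]
      simp
    rw [this, pow_div_sq_of_eq_one hn hpos]
    have : 0 ≤ 1 / M.hF {z} * f z ^ 2 := by positivity
    linarith
  · obtain ⟨a, ha⟩ : ∃ a, F = {z, a} := by
      obtain ⟨x, y, -, rfl⟩ := Finset.card_eq_two.1 (hc.trans hn)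
      rw [Finset.mem_insert, Finset.mem_singleton] at hz
      rcases hz with rfl | rfl
      · exact ⟨y, rfl⟩
      · exact ⟨x, Finset.pair_comm _ _⟩
    have hh : M.hF F = dist z a := by
      rw [Network.Mesh.hF, if_neg (by omega), ha, size_pair]
    have h1 : (n : ℝ) - 1 = 1 := by rw [hn]; norm_num
    have hs := integral_segment_sq_ge (ha ▸ hf)
    have hfs : M.faceSq F f = ∫ x in segment ℝ z a, f x ^ 2 ∂μH[1] := by
      rw [faceSq, h1, ha, Finset.coe_pair, convexHull_pair]
    rw [← hfs] at hs
    rw [pow_div_sq_of_eq_two hn hpos, one_mul, hh]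
    rw [hh] at hpos
    calc f z ^ 2 = 16 * (1 / dist z a * (dist z a / 16 * f z ^ 2)) := by field_simp
      _ ≤ _ := by gcongr

lemma affineAlong_val (v : Fin N → E n → ℝ) {p : Σ _ : Fin N, Finset (E n)} {F : Finset (E d)}
    (hF : F ⊆ M.emb p) : AffineAlong F (M.val v p.1 p.2) := by
  intro a ha b hb t
  obtain ⟨a, ha', rfl⟩ := M.mem_emb.1 (hF ha)
  obtain ⟨b, hb', rfl⟩ := M.mem_emb.1 (hF hb)
  have h : AffineMap.lineMap (G.Φ p.1 a) (G.Φ p.1 b) t = G.Φ p.1 (AffineMap.lineMap a b t) :=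
    ((G.Φ p.1).toAffineMap.apply_lineMap a b t).symm
  rw [h, val_apply, val_apply, val_apply, AffineMap.apply_lineMap, AffineMap.lineMap_apply_ring]

/-- The weights of the elements and of the faces at a vertex are comparable. -/
lemma weight_le (hn : n = 1 ∨ n = 2) {ρ : ℝ} (hM : M.ShapeRegular ρ) {z : E d}
    {p : Σ _ : Fin N, Finset (E n)} (hp : p ∈ M.patch z) {F : Finset (E d)} (hF : F ∈ M.faces)
    (hz : z ∈ F) :
    size p.2 ^ n / size p.2 ^ 2 ≤ max 1 ρ * (M.hF F ^ n / M.hF F ^ 2) := by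
  have hpos := M.hF_pos hn hF
  obtain ⟨hpe, hpz⟩ := M.mem_patch.1 hp
  have hs := M.size_pos (by omega) hpe
  rcases hn with hn | hn
  · have h1 : M.hF F ≤ ρ * size p.2 := by
      obtain ⟨q, hq, hFq, hc⟩ := M.mem_faces.1 hF
      rw [Network.Mesh.hF, if_pos hn]
      have : Nonempty (M.elems.filter (fun p => F ⊆ M.emb p)) :=
        ⟨⟨q, Finset.mem_filter.2 ⟨hq, hFq⟩⟩⟩
      refine ciSup_le fun r => ?_
      have hr := Finset.mem_filter.1 r.2
      exact hM.2 hn _ hr.1 _ hpe ⟨z, Finset.mem_inter.2 ⟨hr.2 hz, hpz⟩⟩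
    rw [pow_div_sq_of_eq_one hn hs, pow_div_sq_of_eq_one hn hpos, mul_one_div, div_le_div_iff₀ hs hpos, one_mul]
    exact h1.trans (mul_le_mul_of_nonneg_right (le_max_right _ _) hs.le)
  · rw [pow_div_sq_of_eq_two hn hs, pow_div_sq_of_eq_two hn hpos, mul_one]
    exact le_max_left _ _

/-- Two elements of a domain overlap in a null set only. -/
lemma aedisjoint {i : Fin N} {K L : Finset (E n)} (hK : K ∈ M.T i) (hL : L ∈ M.T i)
    (hKL : K ≠ L) :
    volume (convexHull ℝ (K : Set (E n)) ∩ convexHull ℝ (L : Set (E n))) = 0 := by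
  have hsub : convexHull ℝ (K : Set (E n)) ∩ convexHull ℝ (L : Set (E n)) ⊆
      convexHull ℝ ((K ∩ L : Finset (E n)) : Set (E n)) := by
    rintro x ⟨hxK, hxL⟩
    have h := M.conforming i i K hK L hL ⟨⟨x, hxK, rfl⟩, ⟨x, hxL, rfl⟩⟩
    rw [← image_inter (G.Φ i).injective, ← Finset.coe_inter] at h
    have h2 := (G.Φ i).toAffineMap.image_convexHull ((K ∩ L : Finset (E n)) : Set (E n))
    obtain ⟨y, hy, hyx⟩ := h2.ge h
    obtain rfl := (G.Φ i).injective hyx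
    exact hy
  refine measure_mono_null hsub (volume_convexHull_eq_zero volume (M.indep i K hK)
    (by simpa using M.card_eq i K hK) (Finset.ssubset_iff_subset_ne.2
      ⟨Finset.inter_subset_left, fun h => hKL ?_⟩))
  exact Finset.eq_of_subset_of_card_le (Finset.inter_eq_left.1 h)
    (by rw [M.card_eq i K hK, M.card_eq i L hL])

/-- The number of elements of a shape regular mesh of a domain that share a vertex is bounded. -/
lemma card_filter_le (hn : 0 < n) {ρ : ℝ} (hρ : 0 < ρ) (hM : M.ShapeRegular ρ) (i : Fin N)
    (y : E n) : (((M.T i).filter fun K => y ∈ K).card : ℝ) ≤ ρ ^ n := by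
  set S := (M.T i).filter fun K => y ∈ K with hS
  have hST : ∀ K ∈ S, K ∈ M.T i := fun K hK => (Finset.mem_filter.1 hK).1
  rcases S.eq_empty_or_nonempty with h | hne
  · rw [h]
    simp only [Finset.card_empty, Nat.cast_zero]
    positivity
  -- Volume count at the scale `r` of the smallest element: each `K`, shrunk towards `y` by the
  -- factor `r / size K`, stays inside itself and contains a ball of radius `r / ρ` within distance
  -- `r` of `y`. These balls overlap in null sets only, so at most `ρ ^ n` of them fit.
  obtain ⟨K₀, hK₀, hmin⟩ := S.exists_min_image size hne
  set r := size K₀ with hr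
  have hr0 : 0 < r := M.size_pos (p := ⟨i, K₀⟩) hn (M.mk_mem_elems.2 (hST _ hK₀))
  have hball : ∀ K ∈ S, ∃ b : E n, Metric.closedBall b (r / ρ) ⊆ convexHull ℝ (K : Set (E n)) ∧
      Metric.closedBall b (r / ρ) ⊆ Metric.closedBall y r := by
    intro K hK
    have hKe := M.mk_mem_elems.2 (hST K hK)
    obtain ⟨c, hc⟩ := hM.1 ⟨i, K⟩ hKe
    simp only at hc
    have hs : 0 < size K := M.size_pos (p := ⟨i, K⟩) hn hKe
    have hyK : y ∈ convexHull ℝ (K : Set (E n)) :=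
      subset_convexHull ℝ _ (Finset.mem_filter.1 hK).2
    set t := r / size K with ht
    have ht0 : 0 < t := by positivity
    have ht1 : t ≤ 1 := (div_le_one hs).2 (hmin K hK)
    have key : ∀ x ∈ Metric.closedBall (y + t • (c - y)) (r / ρ),
        ∃ x' ∈ convexHull ℝ (K : Set (E n)), x = y + t • (x' - y) := by
      intro x hx
      refine ⟨y + t⁻¹ • (x - y), hc ?_, ?_⟩
      · rw [Metric.mem_closedBall, dist_eq_norm] at hx ⊢
        have : x - (y + t • (c - y)) = t • (y + t⁻¹ • (x - y) - c) := by
          have h1 : t • t⁻¹ • (x - y) = x - y := smul_inv_smul₀ ht0.ne' _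
          rw [smul_sub t _ c, smul_add, h1, smul_sub]
          abel
        rw [this, norm_smul, Real.norm_of_nonneg ht0.le] at hx
        have h2 : r / ρ = t * (size K / ρ) := by
          rw [ht]; field_simp
        rw [h2] at hx
        exact le_of_mul_le_mul_left hx ht0
      · rw [add_sub_cancel_left, smul_smul, mul_inv_cancel₀ ht0.ne', one_smul]
        abel
    refine ⟨y + t • (c - y), fun x hx => ?_, fun x hx => ?_⟩
    · obtain ⟨x', hx', rfl⟩ := key x hx
      exact (convex_convexHull ℝ _).add_smul_sub_mem hyK hx' ⟨ht0.le, ht1⟩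
    · obtain ⟨x', hx', rfl⟩ := key x hx
      rw [Metric.mem_closedBall, dist_eq_norm, add_sub_cancel_left, norm_smul,
        Real.norm_of_nonneg ht0.le, ← dist_eq_norm]
      calc t * dist x' y ≤ t * size K := by
            gcongr
            exact dist_le_size hx' hyK
        _ = r := by rw [ht]; field_simp
  choose! b hb1 hb2 using hball
  have hdisj : (S : Set (Finset (E n))).Pairwise
      (Function.onFun (AEDisjoint volume) fun K => Metric.closedBall (b K) (r / ρ)) := by
    intro K hK L hL hKL
    exact measure_mono_null (inter_subset_inter (hb1 K hK) (hb1 L hL))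
      (M.aedisjoint (hST K hK) (hST L hL) hKL)
  have hun := measure_biUnion_finset₀ hdisj fun K _ =>
    Metric.isClosed_closedBall.measurableSet.nullMeasurableSet
  have hle : volume (⋃ K ∈ S, Metric.closedBall (b K) (r / ρ)) ≤
      volume (Metric.closedBall y r) := measure_mono (iUnion₂_subset hb2)
  have hV : volume (Metric.ball (0 : E n) 1) ≠ 0 := (Metric.measure_ball_pos _ _ one_pos).ne'
  have hV' : volume (Metric.ball (0 : E n) 1) ≠ ⊤ := measure_ball_lt_top.ne
  rw [hun] at hle
  simp_rw [Measure.addHaar_closedBall volume (_ : E n) (show 0 ≤ r / ρ by positivity),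
    Measure.addHaar_closedBall volume (_ : E n) hr0.le] at hle
  rw [Finset.sum_const, nsmul_eq_mul, ← mul_assoc, ENNReal.mul_le_mul_iff_left hV hV',
    finrank_euclideanSpace_fin, ← ENNReal.ofReal_natCast, ← ENNReal.ofReal_mul (by positivity),
    ENNReal.ofReal_le_ofReal_iff (by positivity), div_pow, mul_div_assoc',
    div_le_iff₀ (by positivity), mul_comm (r ^ n)] at hle
  exact le_of_mul_le_mul_right hle (by positivity)

/-- Each of the `N` domains contributes at most `ρ ^ n` elements. Only through `N` and `n` does the
final constant depend on the network. -/
lemma card_patch_le (hn : 0 < n) {ρ : ℝ} (hρ : 0 < ρ) (hM : M.ShapeRegular ρ) (z : E d) :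
    ((M.patch z).card : ℝ) ≤ N * ρ ^ n := by
  have h : M.patch z = Finset.univ.sigma fun i => (M.T i).filter fun K => z ∈ M.emb ⟨i, K⟩ := by
    ext ⟨i, K⟩
    simp [mem_patch, mk_mem_elems]
  rw [h, Finset.card_sigma]
  push_cast
  have hi : ∀ i, ((((M.T i).filter fun K => z ∈ M.emb ⟨i, K⟩).card : ℕ) : ℝ) ≤ ρ ^ n := by
    intro i
    refine le_trans ?_ (M.card_filter_le hn hρ hM i (G.coord i z))
    norm_cast
    refine Finset.card_le_card fun K hK => ?_
    rw [Finset.mem_filter] at hK ⊢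
    obtain ⟨y, hy, rfl⟩ := M.mem_emb.1 hK.2
    rw [coord_apply]
    exact ⟨hK.1, hy⟩
  calc _ ≤ ∑ _ : Fin N, ρ ^ n := Finset.sum_le_sum fun i _ => hi i
    _ = N * ρ ^ n := by simp

end Network.Mesh
end HyperDG

namespace HyperDG.Network.Mesh

variable {n d N : ℕ} {G : Network n d N} (M : G.Mesh)

/-! ### The penalty terms of the DG norm -/

/-- The penalty term of an interior face. -/
def intTerm (ηF : Fin N → Finset (E d) → ℝ) (v : Fin N → E n → ℝ) (i : Fin N)
    (F : Finset (E d)) : ℝ :=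
  ηF i F / M.hF F * (1 / 2 * ∑ q ∈ (M.elemsAt i F).offDiag,
    M.faceSq F fun x => M.val v i q.1 x - M.val v i q.2 x)

/-- The penalty term of a boundary face. -/
def bdTerm (ηF : Fin N → Finset (E d) → ℝ) (v : Fin N → E n → ℝ) (i : Fin N)
    (F : Finset (E d)) : ℝ :=
  ηF i F / M.hF F * ∑ K ∈ M.elemsAt i F, M.faceSq F fun x => M.val v i K x

/-- The penalty term of a face on a bifurcation. -/
def bifTerm (ηΓ : Set (E d) → ℝ) (v : Fin N → E n → ℝ) (γ : Set (E d)) (F : Finset (E d)) : ℝ :=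
  ηΓ γ * (1 / M.hF F * ∑ p ∈ G.D γ, ∑ K ∈ M.elemsAt p.1 F, ∑ L ∈ M.elemsAt p.2 F,
    M.faceSq F fun x => M.val v p.1 K x - M.val v p.2 L x)

/-- The sum of the penalty terms with weights `c F`. -/
def penalty (ηF : Fin N → Finset (E d) → ℝ) (ηΓ : Set (E d) → ℝ) (v : Fin N → E n → ℝ)
    (c : Finset (E d) → ℝ) : ℝ :=
  ∑ i, (∑ F ∈ M.intFaces i, c F * M.intTerm ηF v i F + ∑ F ∈ M.bdFaces i, c F * M.bdTerm ηF v i F)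
    + ∑ γ ∈ G.Γ, ∑ F ∈ M.bifFaces γ, c F * M.bifTerm ηΓ v γ F

/-- The sum of the penalty terms of the faces with the vertex `z`. -/
def localPenalty (ηF : Fin N → Finset (E d) → ℝ) (ηΓ : Set (E d) → ℝ) (v : Fin N → E n → ℝ)
    (z : E d) : ℝ :=
  M.penalty ηF ηΓ v fun F => if z ∈ F then 1 else 0

variable {ηF : Fin N → Finset (E d) → ℝ} {ηΓ : Set (E d) → ℝ} (v : Fin N → E n → ℝ)

lemma penalty_add (c c' : Finset (E d) → ℝ) :
    M.penalty ηF ηΓ v (fun F => c F + c' F) = M.penalty ηF ηΓ v c + M.penalty ηF ηΓ v c' := by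
  simp only [penalty, add_mul, Finset.sum_add_distrib]
  ring

/-- Linearity in the weights turns the sum of the local penalties into one penalty that weights each
face by the number of its vertices. -/
lemma penalty_sum {α : Type*} (s : Finset α) (c : α → Finset (E d) → ℝ) :
    M.penalty ηF ηΓ v (fun F => ∑ a ∈ s, c a F) = ∑ a ∈ s, M.penalty ηF ηΓ v (c a) := by
  induction s using Finset.induction_on with
  | empty => simp [penalty]
  | insert a s ha ih => simp only [Finset.sum_insert ha, penalty_add, ih]

lemma penalty_const (a : ℝ) :
    M.penalty ηF ηΓ v (fun _ => a) = a * M.penalty ηF ηΓ v fun _ => 1 := by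
  simp only [penalty, ← Finset.mul_sum, ← mul_add, one_mul]

lemma mem_intFaces {i : Fin N} {F : Finset (E d)} :
    F ∈ M.intFaces i ↔ F ∈ M.faces ∧ 2 ≤ (M.elemsAt i F).card := by
  rw [intFaces, Finset.mem_filter]

lemma mem_bdFaces {i : Fin N} {F : Finset (E d)} :
    F ∈ M.bdFaces i ↔ F ∈ M.faces ∧ (M.elemsAt i F).Nonempty ∧
      convexHull ℝ (F : Set (E d)) ⊆ G.boundary := by
  rw [bdFaces, Finset.mem_filter]

lemma mem_bifFaces {γ : Set (E d)} {F : Finset (E d)} :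
    F ∈ M.bifFaces γ ↔ F ∈ M.faces ∧ convexHull ℝ (F : Set (E d)) ⊆ γ := by
  rw [bifFaces, Finset.mem_filter]

lemma hF_nonneg (F : Finset (E d)) : 0 ≤ M.hF F := by
  rw [hF]
  split_ifs
  · exact Real.iSup_nonneg fun _ => size_nonneg _
  · exact size_nonneg _

lemma intTerm_nonneg (hηF : ∀ i F, 0 ≤ ηF i F) (i : Fin N) (F : Finset (E d)) :
    0 ≤ M.intTerm ηF v i F :=
  mul_nonneg (div_nonneg (hηF i F) (M.hF_nonneg F)) (mul_nonneg (by norm_num)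
    (Finset.sum_nonneg fun _ _ => M.faceSq_nonneg _ _))

lemma bdTerm_nonneg (hηF : ∀ i F, 0 ≤ ηF i F) (i : Fin N) (F : Finset (E d)) :
    0 ≤ M.bdTerm ηF v i F :=
  mul_nonneg (div_nonneg (hηF i F) (M.hF_nonneg F))
    (Finset.sum_nonneg fun _ _ => M.faceSq_nonneg _ _)

lemma bifTerm_nonneg (hηΓ : ∀ γ, 0 ≤ ηΓ γ) (γ : Set (E d)) (F : Finset (E d)) :
    0 ≤ M.bifTerm ηΓ v γ F :=
  mul_nonneg (hηΓ γ) (mul_nonneg (one_div_nonneg.2 (M.hF_nonneg F))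
    (Finset.sum_nonneg fun _ _ => Finset.sum_nonneg fun _ _ => Finset.sum_nonneg fun _ _ =>
      M.faceSq_nonneg _ _))

lemma intTerm_le_penalty (hηF : ∀ i F, 0 ≤ ηF i F) (hηΓ : ∀ γ, 0 ≤ ηΓ γ)
    {c : Finset (E d) → ℝ} (hc : ∀ F, 0 ≤ c F) {i : Fin N} {F : Finset (E d)}
    (hF : F ∈ M.intFaces i) : c F * M.intTerm ηF v i F ≤ M.penalty ηF ηΓ v c := by
  have h1 : ∀ i F, 0 ≤ c F * M.intTerm ηF v i F := fun i F =>
    mul_nonneg (hc F) (M.intTerm_nonneg v hηF i F)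
  have h2 : ∀ i F, 0 ≤ c F * M.bdTerm ηF v i F := fun i F =>
    mul_nonneg (hc F) (M.bdTerm_nonneg v hηF i F)
  have h3 : ∀ γ F, 0 ≤ c F * M.bifTerm ηΓ v γ F := fun γ F =>
    mul_nonneg (hc F) (M.bifTerm_nonneg v hηΓ γ F)
  calc c F * M.intTerm ηF v i F ≤ ∑ F ∈ M.intFaces i, c F * M.intTerm ηF v i F :=
        Finset.single_le_sum (f := fun F => c F * M.intTerm ηF v i F) (fun F _ => h1 i F) hF
    _ ≤ ∑ F ∈ M.intFaces i, c F * M.intTerm ηF v i F +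
          ∑ F ∈ M.bdFaces i, c F * M.bdTerm ηF v i F :=
        le_add_of_nonneg_right (Finset.sum_nonneg fun F _ => h2 i F)
    _ ≤ ∑ i, (∑ F ∈ M.intFaces i, c F * M.intTerm ηF v i F +
          ∑ F ∈ M.bdFaces i, c F * M.bdTerm ηF v i F) :=
        Finset.single_le_sum (f := fun i => ∑ F ∈ M.intFaces i, c F * M.intTerm ηF v i F +
          ∑ F ∈ M.bdFaces i, c F * M.bdTerm ηF v i F) (fun i _ => add_nonneg
            (Finset.sum_nonneg fun F _ => h1 i F) (Finset.sum_nonneg fun F _ => h2 i F))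
          (Finset.mem_univ i)
    _ ≤ M.penalty ηF ηΓ v c := le_add_of_nonneg_right
        (Finset.sum_nonneg fun γ _ => Finset.sum_nonneg fun F _ => h3 γ F)

lemma bdTerm_le_penalty (hηF : ∀ i F, 0 ≤ ηF i F) (hηΓ : ∀ γ, 0 ≤ ηΓ γ)
    {c : Finset (E d) → ℝ} (hc : ∀ F, 0 ≤ c F) {i : Fin N} {F : Finset (E d)}
    (hF : F ∈ M.bdFaces i) : c F * M.bdTerm ηF v i F ≤ M.penalty ηF ηΓ v c := by
  have h1 : ∀ i F, 0 ≤ c F * M.intTerm ηF v i F := fun i F =>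
    mul_nonneg (hc F) (M.intTerm_nonneg v hηF i F)
  have h2 : ∀ i F, 0 ≤ c F * M.bdTerm ηF v i F := fun i F =>
    mul_nonneg (hc F) (M.bdTerm_nonneg v hηF i F)
  have h3 : ∀ γ F, 0 ≤ c F * M.bifTerm ηΓ v γ F := fun γ F =>
    mul_nonneg (hc F) (M.bifTerm_nonneg v hηΓ γ F)
  calc c F * M.bdTerm ηF v i F ≤ ∑ F ∈ M.bdFaces i, c F * M.bdTerm ηF v i F :=
        Finset.single_le_sum (f := fun F => c F * M.bdTerm ηF v i F) (fun F _ => h2 i F) hF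
    _ ≤ ∑ F ∈ M.intFaces i, c F * M.intTerm ηF v i F +
          ∑ F ∈ M.bdFaces i, c F * M.bdTerm ηF v i F :=
        le_add_of_nonneg_left (Finset.sum_nonneg fun F _ => h1 i F)
    _ ≤ ∑ i, (∑ F ∈ M.intFaces i, c F * M.intTerm ηF v i F +
          ∑ F ∈ M.bdFaces i, c F * M.bdTerm ηF v i F) :=
        Finset.single_le_sum (f := fun i => ∑ F ∈ M.intFaces i, c F * M.intTerm ηF v i F +
          ∑ F ∈ M.bdFaces i, c F * M.bdTerm ηF v i F) (fun i _ => add_nonneg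
            (Finset.sum_nonneg fun F _ => h1 i F) (Finset.sum_nonneg fun F _ => h2 i F))
          (Finset.mem_univ i)
    _ ≤ M.penalty ηF ηΓ v c := le_add_of_nonneg_right
        (Finset.sum_nonneg fun γ _ => Finset.sum_nonneg fun F _ => h3 γ F)

lemma bifTerm_le_penalty (hηF : ∀ i F, 0 ≤ ηF i F) (hηΓ : ∀ γ, 0 ≤ ηΓ γ)
    {c : Finset (E d) → ℝ} (hc : ∀ F, 0 ≤ c F) {γ : Set (E d)} (hγ : γ ∈ G.Γ)
    {F : Finset (E d)} (hF : F ∈ M.bifFaces γ) :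
    c F * M.bifTerm ηΓ v γ F ≤ M.penalty ηF ηΓ v c := by
  have h1 : ∀ i F, 0 ≤ c F * M.intTerm ηF v i F := fun i F =>
    mul_nonneg (hc F) (M.intTerm_nonneg v hηF i F)
  have h2 : ∀ i F, 0 ≤ c F * M.bdTerm ηF v i F := fun i F =>
    mul_nonneg (hc F) (M.bdTerm_nonneg v hηF i F)
  have h3 : ∀ γ F, 0 ≤ c F * M.bifTerm ηΓ v γ F := fun γ F =>
    mul_nonneg (hc F) (M.bifTerm_nonneg v hηΓ γ F)
  calc c F * M.bifTerm ηΓ v γ F ≤ ∑ F ∈ M.bifFaces γ, c F * M.bifTerm ηΓ v γ F :=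
        Finset.single_le_sum (f := fun F => c F * M.bifTerm ηΓ v γ F) (fun F _ => h3 γ F) hF
    _ ≤ ∑ γ ∈ G.Γ, ∑ F ∈ M.bifFaces γ, c F * M.bifTerm ηΓ v γ F :=
        Finset.single_le_sum (f := fun γ => ∑ F ∈ M.bifFaces γ, c F * M.bifTerm ηΓ v γ F)
          (fun γ _ => Finset.sum_nonneg fun F _ => h3 γ F) hγ
    _ ≤ M.penalty ηF ηΓ v c := le_add_of_nonneg_left
        (Finset.sum_nonneg fun i _ => add_nonneg (Finset.sum_nonneg fun F _ => h1 i F)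
          (Finset.sum_nonneg fun F _ => h2 i F))

lemma penalty_nonneg (hηF : ∀ i F, 0 ≤ ηF i F) (hηΓ : ∀ γ, 0 ≤ ηΓ γ)
    {c : Finset (E d) → ℝ} (hc : ∀ F, 0 ≤ c F) : 0 ≤ M.penalty ηF ηΓ v c :=
  add_nonneg (Finset.sum_nonneg fun i _ => add_nonneg
      (Finset.sum_nonneg fun F _ => mul_nonneg (hc F) (M.intTerm_nonneg v hηF i F))
      (Finset.sum_nonneg fun F _ => mul_nonneg (hc F) (M.bdTerm_nonneg v hηF i F)))
    (Finset.sum_nonneg fun γ _ => Finset.sum_nonneg fun F _ =>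
      mul_nonneg (hc F) (M.bifTerm_nonneg v hηΓ γ F))

lemma penalty_mono (hηF : ∀ i F, 0 ≤ ηF i F) (hηΓ : ∀ γ, 0 ≤ ηΓ γ)
    {c c' : Finset (E d) → ℝ} (h : ∀ F ∈ M.faces, c F ≤ c' F) :
    M.penalty ηF ηΓ v c ≤ M.penalty ηF ηΓ v c' := by
  refine add_le_add (Finset.sum_le_sum fun i _ => add_le_add
    (Finset.sum_le_sum fun F hF => ?_) (Finset.sum_le_sum fun F hF => ?_))
    (Finset.sum_le_sum fun γ _ => Finset.sum_le_sum fun F hF => ?_)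
  · exact mul_le_mul_of_nonneg_right (h F (M.mem_intFaces.1 hF).1) (M.intTerm_nonneg v hηF i F)
  · exact mul_le_mul_of_nonneg_right (h F (M.mem_bdFaces.1 hF).1) (M.bdTerm_nonneg v hηF i F)
  · exact mul_le_mul_of_nonneg_right (h F (M.mem_bifFaces.1 hF).1) (M.bifTerm_nonneg v hηΓ γ F)

/-- Each face has `n` vertices. -/
lemma sum_localPenalty_le (hηF : ∀ i F, 0 ≤ ηF i F) (hηΓ : ∀ γ, 0 ≤ ηΓ γ) (V : Finset (E d)) :
    ∑ z ∈ V, M.localPenalty ηF ηΓ v z ≤ n * M.penalty ηF ηΓ v fun _ => 1 := by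
  simp only [localPenalty]
  rw [← penalty_sum, ← penalty_const]
  refine M.penalty_mono v hηF hηΓ fun F hF => ?_
  obtain ⟨p, -, -, hc⟩ := M.mem_faces.1 hF
  rw [Finset.sum_boole, ← hc]
  exact_mod_cast Finset.card_le_card fun z hz => (Finset.mem_filter.1 hz).2

lemma dgNorm_sq (hηF : ∀ i F, 0 ≤ ηF i F) (hηΓ : ∀ γ, 0 ≤ ηΓ γ) :
    M.dgNorm ηF ηΓ v ^ 2 = ∑ i, ∑ K ∈ M.T i, (∫ _ in convexHull ℝ (K : Set (E n)),
      ‖affineGrad (elemPoly (v i) K)‖ ^ 2) + M.penalty ηF ηΓ v fun _ => 1 := by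
  have hA : (0 : ℝ) ≤ ∑ i, ∑ K ∈ M.T i, (∫ _ in convexHull ℝ (K : Set (E n)),
      ‖affineGrad (elemPoly (v i) K)‖ ^ 2) :=
    Finset.sum_nonneg fun i _ => Finset.sum_nonneg fun K _ => integral_nonneg fun _ => sq_nonneg _
  have hB := M.penalty_nonneg v hηF hηΓ (c := fun _ => 1) fun _ => zero_le_one
  have hsum : ∑ i, M.dgSqDom ηF v i + ∑ γ ∈ G.Γ, ηΓ γ * ∑ F ∈ M.bifFaces γ, 1 / M.hF F *
      ∑ p ∈ G.D γ, ∑ K ∈ M.elemsAt p.1 F, ∑ L ∈ M.elemsAt p.2 F,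
        M.faceSq F (fun x => M.val v p.1 K x - M.val v p.2 L x) =
      ∑ i, ∑ K ∈ M.T i, (∫ _ in convexHull ℝ (K : Set (E n)),
        ‖affineGrad (elemPoly (v i) K)‖ ^ 2) + M.penalty ηF ηΓ v fun _ => 1 := by
    simp only [dgSqDom, penalty, intTerm, bdTerm, bifTerm, gradient_affine, one_mul,
      Finset.sum_add_distrib, Finset.mul_sum (s := M.bifFaces _)]
    ring
  rw [dgNorm, hsum, Real.sq_sqrt (add_nonneg hA hB)]

/-! ### Jumps at a vertex -/

/-- The squared value at `z` of a function that is affine on a face at `z` is bounded by its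
penalty on the face. -/
lemma weight_mul_sq_le (hn : n = 1 ∨ n = 2) {ρ : ℝ} (hM : M.ShapeRegular ρ) {z : E d}
    {p : Σ _ : Fin N, Finset (E n)} (hp : p ∈ M.patch z) {F : Finset (E d)} (hF : F ∈ M.faces)
    (hz : z ∈ F) {f : E d → ℝ} (hf : AffineAlong F f) {η₀ X : ℝ} (hη₀ : 0 < η₀)
    (hX : η₀ * (1 / 2 * (1 / M.hF F * M.faceSq F f)) ≤ X) :
    size p.2 ^ n / size p.2 ^ 2 * f z ^ 2 ≤ 32 * max 1 ρ / η₀ * X := by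
  have hm : 0 < max 1 ρ := lt_max_of_lt_left one_pos
  calc size p.2 ^ n / size p.2 ^ 2 * f z ^ 2
      ≤ max 1 ρ * (M.hF F ^ n / M.hF F ^ 2) * f z ^ 2 :=
        mul_le_mul_of_nonneg_right (M.weight_le hn hM hp hF hz) (sq_nonneg _)
    _ = max 1 ρ * (M.hF F ^ n / M.hF F ^ 2 * f z ^ 2) := by ring
    _ ≤ max 1 ρ * (16 * (1 / M.hF F * M.faceSq F f)) :=
        mul_le_mul_of_nonneg_left (M.faceSq_ge hn hF hz hf) hm.le
    -- The 16 of `faceSq_ge`, doubled to absorb the factor `1 / 2` in `hX`.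
    _ = 32 * max 1 ρ / η₀ * (η₀ * (1 / 2 * (1 / M.hF F * M.faceSq F f))) := by
        field_simp; ring
    _ ≤ 32 * max 1 ρ / η₀ * X := mul_le_mul_of_nonneg_left hX (by positivity)

lemma faceSq_div_nonneg (F : Finset (E d)) (f : E d → ℝ) : 0 ≤ 1 / M.hF F * M.faceSq F f :=
  mul_nonneg (one_div_nonneg.2 (M.hF_nonneg F)) (M.faceSq_nonneg F f)

/-- One ordered pair is kept of the sum, so the factor `1 / 2` remains. The next two lemmas give it
away, so that all three kinds of faces enter `weight_mul_sq_le` alike. -/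
lemma le_intTerm {η₀ : ℝ} (hη₀ : 0 < η₀) (hηF : ∀ i F, η₀ ≤ ηF i F) {i : Fin N}
    {K L : Finset (E n)} {F : Finset (E d)} (hK : K ∈ M.elemsAt i F) (hL : L ∈ M.elemsAt i F)
    (hKL : K ≠ L) :
    η₀ * (1 / 2 * (1 / M.hF F * M.faceSq F fun x => M.val v i K x - M.val v i L x)) ≤
      M.intTerm ηF v i F := by
  have h1 : M.faceSq F (fun x => M.val v i K x - M.val v i L x) ≤
      ∑ q ∈ (M.elemsAt i F).offDiag, M.faceSq F fun x => M.val v i q.1 x - M.val v i q.2 x :=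
    Finset.single_le_sum
      (f := fun q : Finset (E n) × Finset (E n) =>
        M.faceSq F fun x => M.val v i q.1 x - M.val v i q.2 x)
      (fun q _ => M.faceSq_nonneg _ _) (a := (K, L)) (Finset.mem_offDiag.2 ⟨hK, hL, hKL⟩)
  have h2 := one_div_nonneg.2 (M.hF_nonneg F)
  rw [intTerm, div_eq_mul_one_div (ηF i F)]
  calc _ = η₀ * (1 / M.hF F) * (1 / 2 * M.faceSq F fun x => M.val v i K x - M.val v i L x) := by
        ring
    _ ≤ _ := by
        refine mul_le_mul (mul_le_mul_of_nonneg_right (hηF i F) h2)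
          (mul_le_mul_of_nonneg_left h1 (by norm_num)) ?_ ?_
        · exact mul_nonneg (by norm_num) (M.faceSq_nonneg _ _)
        · exact mul_nonneg (hη₀.le.trans (hηF i F)) h2

lemma le_bdTerm {η₀ : ℝ} (hη₀ : 0 < η₀) (hηF : ∀ i F, η₀ ≤ ηF i F) {i : Fin N}
    {K : Finset (E n)} {F : Finset (E d)} (hK : K ∈ M.elemsAt i F) :
    η₀ * (1 / 2 * (1 / M.hF F * M.faceSq F (M.val v i K))) ≤ M.bdTerm ηF v i F := by
  have h1 : M.faceSq F (M.val v i K) ≤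
      ∑ K ∈ M.elemsAt i F, M.faceSq F fun x => M.val v i K x :=
    Finset.single_le_sum (f := fun K => M.faceSq F fun x => M.val v i K x)
      (fun q _ => M.faceSq_nonneg _ _) hK
  have h2 := one_div_nonneg.2 (M.hF_nonneg F)
  have h3 := M.faceSq_nonneg F (M.val v i K)
  rw [bdTerm, div_eq_mul_one_div (ηF i F)]
  calc _ = η₀ * (1 / M.hF F) * (1 / 2 * M.faceSq F (M.val v i K)) := by ring
    _ ≤ η₀ * (1 / M.hF F) * M.faceSq F (M.val v i K) :=
        mul_le_mul_of_nonneg_left (by linarith) (mul_nonneg hη₀.le h2)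
    _ ≤ _ := mul_le_mul (mul_le_mul_of_nonneg_right (hηF i F) h2) h1 h3
        (mul_nonneg (hη₀.le.trans (hηF i F)) h2)

lemma le_bifTerm {η₀ : ℝ} (hη₀ : 0 < η₀) (hηΓ : ∀ γ, η₀ ≤ ηΓ γ) {i j : Fin N} (hij : i < j)
    {γ : Set (E d)} (hi : i ∈ G.I γ) (hj : j ∈ G.I γ) {K L : Finset (E n)} {F : Finset (E d)}
    (hK : K ∈ M.elemsAt i F) (hL : L ∈ M.elemsAt j F) :
    η₀ * (1 / 2 * (1 / M.hF F * M.faceSq F fun x => M.val v i K x - M.val v j L x)) ≤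
      M.bifTerm ηΓ v γ F := by
  have h0 : ∀ (p : Fin N × Fin N) K L,
      0 ≤ M.faceSq F fun x => M.val v p.1 K x - M.val v p.2 L x := fun p K L =>
    M.faceSq_nonneg _ _
  have h1 : M.faceSq F (fun x => M.val v i K x - M.val v j L x) ≤
      ∑ p ∈ G.D γ, ∑ K ∈ M.elemsAt p.1 F, ∑ L ∈ M.elemsAt p.2 F,
        M.faceSq F fun x => M.val v p.1 K x - M.val v p.2 L x := by
    have hD : (i, j) ∈ G.D γ := by
      rw [D, Finset.mem_filter]
      exact ⟨Finset.mem_univ _, hij, hi, hj⟩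
    refine le_trans ?_ (Finset.single_le_sum (f := fun p : Fin N × Fin N =>
      ∑ K ∈ M.elemsAt p.1 F, ∑ L ∈ M.elemsAt p.2 F,
        M.faceSq F fun x => M.val v p.1 K x - M.val v p.2 L x) (fun p _ =>
          Finset.sum_nonneg fun K _ => Finset.sum_nonneg fun L _ => h0 p K L) hD)
    refine le_trans ?_ (Finset.single_le_sum (f := fun K => ∑ L ∈ M.elemsAt j F,
        M.faceSq F fun x => M.val v i K x - M.val v j L x) (fun K _ =>
          Finset.sum_nonneg fun L _ => h0 (i, j) K L) hK)
    exact Finset.single_le_sum (f := fun L => M.faceSq F fun x => M.val v i K x - M.val v j L x)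
      (fun L _ => h0 (i, j) K L) hL
  have h2 := one_div_nonneg.2 (M.hF_nonneg F)
  have h3 := h0 (i, j) K L
  have h4 := M.faceSq_div_nonneg F fun x => M.val v i K x - M.val v j L x
  refine mul_le_mul (hηΓ γ) ?_ (mul_nonneg (by norm_num) h4) (hη₀.le.trans (hηΓ γ))
  calc _ ≤ 1 / M.hF F * M.faceSq F fun x => M.val v i K x - M.val v j L x := by linarith
    _ ≤ _ := mul_le_mul_of_nonneg_left h1 h2

/-- The jump at `z` between two elements with a common face at `z`. -/
lemma weight_mul_jump_sq_le (hn : n = 1 ∨ n = 2) {ρ : ℝ} (hM : M.ShapeRegular ρ) {η₀ : ℝ}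
    (hη₀ : 0 < η₀) (hηF : ∀ i F, η₀ ≤ ηF i F) (hηΓ : ∀ γ, η₀ ≤ ηΓ γ) {z : E d}
    {r p q : Σ _ : Fin N, Finset (E n)} (hr : r ∈ M.patch z) (h : M.Linked z p q) :
    size r.2 ^ n / size r.2 ^ 2 * (M.val v p.1 p.2 z - M.val v q.1 q.2 z) ^ 2 ≤
      32 * max 1 ρ / η₀ * M.localPenalty ηF ηΓ v z := by
  have hηF' : ∀ i F, 0 ≤ ηF i F := fun i F => hη₀.le.trans (hηF i F)
  have hηΓ' : ∀ γ, 0 ≤ ηΓ γ := fun γ => hη₀.le.trans (hηΓ γ)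
  have hc : ∀ F : Finset (E d), (0 : ℝ) ≤ if z ∈ F then 1 else 0 := fun F => by
    split_ifs <;> norm_num
  obtain ⟨hp, hq, F, hF, hzF, hFp, hFq, hcase⟩ := h
  have hpe := (M.mem_patch.1 hp).1
  have hqe := (M.mem_patch.1 hq).1
  have haff := (M.affineAlong_val v hFp).sub (M.affineAlong_val v hFq)
  refine M.weight_mul_sq_le hn hM hr hF hzF haff hη₀ ?_
  obtain ⟨i, K⟩ := p
  obtain ⟨j, L⟩ := q
  simp only at hcase ⊢
  have hKF : K ∈ M.elemsAt i F := M.mem_elemsAt.2 ⟨hpe, hFp⟩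
  have hLF : L ∈ M.elemsAt j F := M.mem_elemsAt.2 ⟨hqe, hFq⟩
  rcases eq_or_ne i j with rfl | hij
  · by_cases hKL : K = L
    · subst hKL
      have h0 : (M.faceSq F fun x => M.val v i K x - M.val v i K x) = 0 := by simp [faceSq]
      rw [h0]
      simpa using! M.penalty_nonneg v hηF' hηΓ' hc
    · have hint : F ∈ M.intFaces i := M.mem_intFaces.2
        ⟨hF, Finset.one_lt_card.2 ⟨K, hKF, L, hLF, hKL⟩⟩
      have h2 := M.intTerm_le_penalty v hηF' hηΓ' hc hint
      rw [if_pos hzF, one_mul] at h2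
      exact (M.le_intTerm v hη₀ hηF hKF hLF hKL).trans h2
  · obtain ⟨γ, hγ, hFγ, hiγ, hjγ⟩ := hcase.resolve_left hij
    have h2 := M.bifTerm_le_penalty v hηF' hηΓ' hc hγ (M.mem_bifFaces.2 ⟨hF, hFγ⟩)
    rw [if_pos hzF, one_mul] at h2
    refine le_trans ?_ h2
    -- Only pairs with increasing indices are in `D γ`; the square does not see the order.
    rcases lt_or_gt_of_ne hij with hlt | hlt
    · exact M.le_bifTerm v hη₀ hηΓ hlt hiγ hjγ hKF hLF
    · rw [faceSq_sub_comm]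
      exact M.le_bifTerm v hη₀ hηΓ hlt hjγ hiγ hLF hKF

/-- The difference between `E_h v` and `v` at a vertex of an element. -/
lemma weight_mul_nodeVal_sub_sq_le (hn : n = 1 ∨ n = 2) {ρ : ℝ} (hM : M.ShapeRegular ρ)
    {η₀ : ℝ} (hη₀ : 0 < η₀) (hηF : ∀ i F, η₀ ≤ ηF i F) (hηΓ : ∀ γ, η₀ ≤ ηΓ γ) {z : E d}
    {p : Σ _ : Fin N, Finset (E n)} (hp : p ∈ M.patch z) :
    size p.2 ^ n / size p.2 ^ 2 * (M.nodeVal v z - M.val v p.1 p.2 z) ^ 2 ≤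
      ((M.patch z).card + 1) ^ 2 * (32 * max 1 ρ / η₀ * M.localPenalty ηF ηΓ v z) := by
  have hηF' : ∀ i F, 0 ≤ ηF i F := fun i F => hη₀.le.trans (hηF i F)
  have hηΓ' : ∀ γ, 0 ≤ ηΓ γ := fun γ => hη₀.le.trans (hηΓ γ)
  have hc : ∀ F : Finset (E d), (0 : ℝ) ≤ if z ∈ F then 1 else 0 := fun F => by
    split_ifs <;> norm_num
  have hs := M.size_pos (by omega) (M.mem_patch.1 hp).1
  set w := size p.2 ^ n / size p.2 ^ 2 with hw
  have hw0 : 0 < w := by positivity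
  set X := 32 * max 1 ρ / η₀ * M.localPenalty ηF ηΓ v z with hX
  have hX0 : 0 ≤ X := mul_nonneg (div_nonneg (mul_nonneg (by norm_num)
    (zero_le_one.trans (le_max_left _ _))) hη₀.le) (M.penalty_nonneg v hηF' hηΓ' hc)
  -- The bound for a single jump: `w * x ^ 2 ≤ X` means `|x| ≤ B`.
  set B := Real.sqrt (X / w) with hB
  have hB0 : 0 ≤ B := Real.sqrt_nonneg _
  have hBsq : w * B ^ 2 = X := by
    rw [hB, Real.sq_sqrt (by positivity)]
    field_simp
  have hle : ∀ x : ℝ, w * x ^ 2 ≤ X → |x| ≤ B := fun x hx => by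
    refine abs_le_of_sq_le_sq (le_of_mul_le_mul_left ?_ hw0) hB0
    rw [hBsq]
    exact hx
  set f : (Σ _ : Fin N, Finset (E n)) → ℝ := fun q => M.val v q.1 q.2 z with hf
  have hchain : ∀ q ∈ M.patch z, |f q - f p| ≤ (M.patch z).card * B := fun q hq =>
    abs_sub_le_of_chain (M.patch z) (R := M.Linked z) (fun a b h => ⟨h.1, h.2.1⟩) hB0
      (fun a b h => hle _ (M.weight_mul_jump_sq_le v hn hM hη₀ hηF hηΓ hp h)) hq
      (M.linked_of_mem_patch hn hq hp)
  have key : |M.nodeVal v z - f p| ≤ ((M.patch z).card + 1) * B := by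
    by_cases hz : z ∈ M.nodes
    · rw [nodeVal, if_pos hz, nodalAvg]
      have hcard : (0 : ℝ) < (M.patch z).card := by exact_mod_cast Finset.card_pos.2 ⟨p, hp⟩
      have h1 : ((M.patch z).card : ℝ)⁻¹ * ∑ q ∈ M.patch z, f q - f p =
          ((M.patch z).card : ℝ)⁻¹ * ∑ q ∈ M.patch z, (f q - f p) := by
        rw [Finset.sum_sub_distrib, Finset.sum_const, nsmul_eq_mul, mul_sub, inv_mul_cancel_left₀
          hcard.ne']
      rw [h1, abs_mul, abs_of_pos (inv_pos.2 hcard), inv_mul_le_iff₀ hcard]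
      calc |∑ q ∈ M.patch z, (f q - f p)| ≤ ∑ q ∈ M.patch z, |f q - f p| :=
            Finset.abs_sum_le_sum_abs _ _
        _ ≤ ∑ _ ∈ M.patch z, ((M.patch z).card : ℝ) * B := Finset.sum_le_sum hchain
        _ = (M.patch z).card * ((M.patch z).card * B) := by rw [Finset.sum_const, nsmul_eq_mul]
        _ ≤ _ := by gcongr; linarith
    -- Here the nodal value is zero, and the value of `v` on an element `q` with a boundary face at
    -- `z` is itself penalised. Going from `q` to `p` costs a chain; the boundary face accounts for
    -- the `+ 1`.
    · have hb : z ∈ G.boundary := by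
        by_contra hb
        refine hz (Finset.mem_filter.2 ⟨Finset.mem_biUnion.2 ⟨p, M.mem_patch.1 hp⟩, hb⟩)
      obtain ⟨q, hq, F, hF, hzF, hFq⟩ := M.exists_bdFace hn hp hb
      have hqF : q.2 ∈ M.elemsAt q.1 F := M.mem_elemsAt.2 ⟨(M.mem_patch.1 hq).1, hFq⟩
      have h2 := M.bdTerm_le_penalty v hηF' hηΓ' hc hF
      rw [if_pos hzF, one_mul] at h2
      have h3 : |f q| ≤ B := hle _ (M.weight_mul_sq_le hn hM hp (M.mem_bdFaces.1 hF).1 hzF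
        (M.affineAlong_val v hFq) hη₀ ((M.le_bdTerm v hη₀ hηF hqF).trans h2))
      rw [nodeVal, if_neg hz, zero_sub, abs_neg]
      calc |f p| = |f q - (f q - f p)| := by rw [sub_sub_cancel]
        _ ≤ |f q| + |f q - f p| := abs_sub _ _
        _ ≤ B + (M.patch z).card * B := add_le_add h3 (hchain q hq)
        _ = _ := by ring
  calc w * (M.nodeVal v z - f p) ^ 2 ≤ w * (((M.patch z).card + 1) * B) ^ 2 := by
        refine mul_le_mul_of_nonneg_left ?_ hw0.le
        rw [← sq_abs]
        exact pow_le_pow_left₀ (abs_nonneg _) key 2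
    _ = ((M.patch z).card + 1) ^ 2 * (w * B ^ 2) := by ring
    _ = _ := by rw [hBsq]

end HyperDG.Network.Mesh

namespace HyperDG

/-! ### Norms of affine functions on elements -/

section Element

variable {n : ℕ} {K : Finset (E n)} {q : E n →ᵃ[ℝ] ℝ} {m : ℝ}

lemma abs_affine_le (hq : ∀ y ∈ K, |q y| ≤ m) {x : E n}
    (hx : x ∈ convexHull ℝ (K : Set (E n))) : |q x| ≤ m := by
  obtain ⟨w, h0, h1, rfl⟩ := Finset.mem_convexHull'.1 hx
  rw [affineMap_sum_smul _ _ _ _ h1]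
  calc |∑ a ∈ K, w a • q a| ≤ ∑ a ∈ K, |w a • q a| := Finset.abs_sum_le_sum_abs _ _
    _ ≤ ∑ a ∈ K, w a * m := Finset.sum_le_sum fun a ha => by
        rw [smul_eq_mul, abs_mul, abs_of_nonneg (h0 a ha)]
        exact mul_le_mul_of_nonneg_left (hq a ha) (h0 a ha)
    _ = m := by rw [← Finset.sum_mul, h1, one_mul]

lemma measurableSet_convexHull (K : Finset (E n)) :
    MeasurableSet (convexHull ℝ (K : Set (E n))) :=
  (K.finite_toSet.isCompact_convexHull (𝕜 := ℝ)).isClosed.measurableSet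

lemma volume_convexHull_ne_top (K : Finset (E n)) :
    volume (convexHull ℝ (K : Set (E n))) ≠ ⊤ :=
  (K.finite_toSet.isCompact_convexHull (𝕜 := ℝ)).measure_lt_top.ne

lemma volume_real_convexHull_le (hK : K.Nonempty) :
    volume.real (convexHull ℝ (K : Set (E n))) ≤
      size K ^ n * volume.real (Metric.ball (0 : E n) 1) := by
  obtain ⟨y, hy⟩ := hK
  have hsub : convexHull ℝ (K : Set (E n)) ⊆ Metric.closedBall y (size K) := fun x hx =>
    dist_le_size hx (subset_convexHull ℝ _ hy)
  refine (measureReal_mono hsub measure_closedBall_lt_top.ne).trans_eq ?_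
  rw [Measure.real, Measure.addHaar_closedBall volume y (size_nonneg K), ENNReal.toReal_mul,
    ENNReal.toReal_ofReal (pow_nonneg (size_nonneg K) _), finrank_euclideanSpace_fin]
  rfl

/-- From the centre of the ball to its boundary in the direction of the gradient, `q` grows by `r *
‖affineGrad q‖`, while both values are at most `m` in modulus. -/
lemma norm_affineGrad_le {c : E n} {r : ℝ} (hr : 0 ≤ r)
    (hc : Metric.closedBall c r ⊆ convexHull ℝ (K : Set (E n))) (hq : ∀ y ∈ K, |q y| ≤ m) :
    r * ‖affineGrad q‖ ≤ 2 * m := by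
  set u := affineGrad q with hu
  set e : E n := (r / ‖u‖) • u with he
  have hball : c + e ∈ Metric.closedBall c r := by
    rw [Metric.mem_closedBall, dist_eq_norm, add_sub_cancel_left, he, norm_smul, norm_div, norm_norm,
      Real.norm_of_nonneg hr]
    rcases eq_or_ne ‖u‖ 0 with h | h
    · rwa [h, mul_zero]
    · rw [div_mul_cancel₀ _ h]
  have h1 := abs_le.1 (abs_affine_le hq (hc hball))
  have h2 := abs_le.1 (abs_affine_le hq (hc (Metric.mem_closedBall_self hr)))
  have h3 : q (c + e) = r * ‖u‖ + q c := by
    have : q (c + e) = q.linear e + q c := by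
      rw [add_comm c e]
      exact q.map_vadd c e
    rw [this, ← inner_affineGrad, ← hu, he, inner_smul_right, real_inner_self_eq_norm_sq]
    by_cases h : ‖u‖ = 0
    · simp [h]
    · field_simp
  linarith [h1.2, h2.1]

lemma integrableOn_affine_sq (q : E n →ᵃ[ℝ] ℝ) (K : Finset (E n)) :
    IntegrableOn (fun x => q x ^ 2) (convexHull ℝ (K : Set (E n))) :=
  ((continuous_affine q).pow 2).continuousOn.integrableOn_compact
    (K.finite_toSet.isCompact_convexHull (𝕜 := ℝ))

lemma setIntegral_affine_sq_le (hK : K.Nonempty) (hq : ∀ y ∈ K, |q y| ≤ m) :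
    ∫ x in convexHull ℝ (K : Set (E n)), q x ^ 2 ≤
      volume.real (Metric.ball (0 : E n) 1) * size K ^ n * m ^ 2 := by
  calc ∫ x in convexHull ℝ (K : Set (E n)), q x ^ 2
      ≤ ∫ _ in convexHull ℝ (K : Set (E n)), m ^ 2 := by
        refine setIntegral_mono_on (integrableOn_affine_sq q K)
          (integrableOn_const (volume_convexHull_ne_top K)) (measurableSet_convexHull K)
          fun x hx => ?_
        rw [← sq_abs]
        exact pow_le_pow_left₀ (abs_nonneg _) (abs_affine_le hq hx) 2
    _ = volume.real (convexHull ℝ (K : Set (E n))) * m ^ 2 := by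
        rw [setIntegral_const, smul_eq_mul]
    _ ≤ _ := by
        refine mul_le_mul_of_nonneg_right ?_ (sq_nonneg m)
        rw [mul_comm]
        exact volume_real_convexHull_le hK

/-- The inverse estimate `‖affineGrad q‖ ≤ 2 * ρ * m / size K`, squared, times the volume bound for
`K`. -/
lemma setIntegral_affineGrad_sq_le (hK : K.Nonempty) {ρ : ℝ} (hρ : 0 < ρ) (hs : 0 < size K)
    {c : E n} (hc : Metric.closedBall c (size K / ρ) ⊆ convexHull ℝ (K : Set (E n)))
    (hq : ∀ y ∈ K, |q y| ≤ m) :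
    ∫ _ in convexHull ℝ (K : Set (E n)), ‖affineGrad q‖ ^ 2 ≤
      4 * ρ ^ 2 * volume.real (Metric.ball (0 : E n) 1) * (size K ^ n / size K ^ 2 * m ^ 2) := by
  have h1 := norm_affineGrad_le (by positivity) hc hq
  have h2 : ‖affineGrad q‖ ≤ 2 * ρ * m / size K := by
    rw [le_div_iff₀ hs]
    calc ‖affineGrad q‖ * size K = ρ * (size K / ρ * ‖affineGrad q‖) := by field_simp
      _ ≤ ρ * (2 * m) := mul_le_mul_of_nonneg_left h1 hρ.le
      _ = 2 * ρ * m := by ring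
  rw [setIntegral_const, smul_eq_mul]
  calc volume.real (convexHull ℝ (K : Set (E n))) * ‖affineGrad q‖ ^ 2
      ≤ (size K ^ n * volume.real (Metric.ball (0 : E n) 1)) * (2 * ρ * m / size K) ^ 2 :=
        mul_le_mul (volume_real_convexHull_le hK) (pow_le_pow_left₀ (norm_nonneg _) h2 2)
          (sq_nonneg _) (by positivity)
    _ = _ := by field_simp; ring

end Element

/-- Since `f` is nonnegative, overlaps of the elements only help: an inequality of measures is
enough. -/
lemma setIntegral_le_sum {n : ℕ} {Ω : Set (E n)} {T : Finset (Finset (E n))} {f : E n → ℝ}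
    (hΩ : Ω ⊆ ⋃ K ∈ T, convexHull ℝ (K : Set (E n))) (hf : ∀ x, 0 ≤ f x)
    (hi : ∀ K ∈ T, IntegrableOn f (convexHull ℝ (K : Set (E n)))) :
    ∫ x in Ω, f x ≤ ∑ K ∈ T, ∫ x in convexHull ℝ (K : Set (E n)), f x := by
  have hle : volume.restrict Ω ≤ ∑ K ∈ T, volume.restrict (convexHull ℝ (K : Set (E n))) := by
    have h := Measure.restrict_biUnion_le (μ := (volume : Measure (E n)))
      (s := fun K : Finset (E n) => convexHull ℝ (K : Set (E n))) (T := (T : Set (Finset (E n))))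
      T.countable_toSet
    refine (Measure.restrict_mono_set _ hΩ).trans (h.trans_eq ?_)
    rw [Measure.sum_fintype]
    exact Finset.sum_coe_sort T fun K => volume.restrict (convexHull ℝ (K : Set (E n)))
  have hint : Integrable f (∑ K ∈ T, volume.restrict (convexHull ℝ (K : Set (E n)))) :=
    integrable_finsetSum_measure.2 hi
  rw [← integral_finsetSum_measure hi]
  exact integral_mono_measure hle (ae_of_all _ hf) hint

/-! ### Summation of the defects and the two error integrals. -/

namespace Network.Mesh

variable {n d N : ℕ} {G : Network n d N} (M : G.Mesh)
  {ηF : Fin N → Finset (E d) → ℝ} {ηΓ : Set (E d) → ℝ} (v : Fin N → E n → ℝ)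

/-- The difference between `E_h v` and `v` on an element. -/
def diffPoly (i : Fin N) (K : Finset (E n)) : E n →ᵃ[ℝ] ℝ :=
  M.enrichPoly v i K - elemPoly (v i) K

lemma diffPoly_vertex {i : Fin N} {K : Finset (E n)} (hK : K ∈ M.T i) {y : E n} (hy : y ∈ K) :
    M.diffPoly v i K y = M.nodeVal v (G.Φ i y) - M.val v i K (G.Φ i y) := by
  rw [val_apply, ← M.enrichPoly_vertex v hK hy]
  rfl

lemma affineGrad_enrichPoly (i : Fin N) (K : Finset (E n)) :
    affineGrad (M.enrichPoly v i K) =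
      affineGrad (elemPoly (v i) K) + affineGrad (M.diffPoly v i K) := by
  rw [affineGrad, affineGrad, affineGrad, ← map_add, ← map_add, diffPoly, AffineMap.sub_linear,
    add_sub_cancel]

/-- The weighted sum of the squared differences at the vertices of an element. -/
def vertexDefect (p : Σ _ : Fin N, Finset (E n)) : ℝ :=
  size p.2 ^ n / size p.2 ^ 2 * ∑ y ∈ p.2, M.diffPoly v p.1 p.2 y ^ 2

lemma vertexDefect_nonneg (p : Σ _ : Fin N, Finset (E n)) : 0 ≤ M.vertexDefect v p :=
  mul_nonneg (div_nonneg (pow_nonneg (size_nonneg _) _) (sq_nonneg _))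
    (Finset.sum_nonneg fun _ _ => sq_nonneg _)

/-- Two powers of `N * ρ ^ n + 1` come from the squared chain length, the third from exchanging the
sums over elements and vertices, where each vertex counts once per element of its patch. The factor
`n` is the number of vertices of a face. -/
lemma sum_vertexDefect_le (hn : n = 1 ∨ n = 2) {ρ : ℝ} (hρ : 0 < ρ) (hM : M.ShapeRegular ρ)
    {η₀ : ℝ} (hη₀ : 0 < η₀) (hηF : ∀ i F, η₀ ≤ ηF i F) (hηΓ : ∀ γ, η₀ ≤ ηΓ γ) :
    ∑ p ∈ M.elems, M.vertexDefect v p ≤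
      (N * ρ ^ n + 1) ^ 3 * (32 * max 1 ρ / η₀) * n * M.dgNorm ηF ηΓ v ^ 2 := by
  have hηF' : ∀ i F, 0 ≤ ηF i F := fun i F => hη₀.le.trans (hηF i F)
  have hηΓ' : ∀ γ, 0 ≤ ηΓ γ := fun γ => hη₀.le.trans (hηΓ γ)
  have hn0 : 0 < n := by omega
  set P : ℝ := N * ρ ^ n + 1 with hP
  have hP0 : 0 < P := by positivity
  set A := 32 * max 1 ρ / η₀ with hA
  have hA0 : 0 < A := by positivity
  set L := M.localPenalty ηF ηΓ v with hL
  have hL0 : ∀ z, 0 ≤ L z := fun z => M.penalty_nonneg v hηF' hηΓ' fun F => by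
    split_ifs <;> norm_num
  have hcard : ∀ z, ((M.patch z).card : ℝ) + 1 ≤ P := fun z => by
    have := M.card_patch_le hn0 hρ hM z
    linarith
  have h1 : ∀ p ∈ M.elems, M.vertexDefect v p ≤ ∑ z ∈ M.emb p, P ^ 2 * (A * L z) := by
    intro p hp
    have hpT := M.mem_elems.1 hp
    rw [vertexDefect, Finset.mul_sum, emb, Finset.sum_image (G.Φ p.1).injective.injOn]
    refine Finset.sum_le_sum fun y hy => ?_
    have hpz : p ∈ M.patch (G.Φ p.1 y) := M.mem_patch.2 ⟨hp, M.mem_emb.2 ⟨y, hy, rfl⟩⟩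
    rw [M.diffPoly_vertex v hpT hy]
    refine (M.weight_mul_nodeVal_sub_sq_le v hn hM hη₀ hηF hηΓ hpz).trans ?_
    exact mul_le_mul_of_nonneg_right (pow_le_pow_left₀ (by positivity) (hcard _) 2)
      (mul_nonneg hA0.le (hL0 _))
  set V := M.elems.biUnion M.emb with hV
  have hswap : ∑ p ∈ M.elems, ∑ z ∈ M.emb p, P ^ 2 * (A * L z) =
      ∑ z ∈ V, ∑ p ∈ M.patch z, P ^ 2 * (A * L z) := by
    refine Finset.sum_comm' fun p z => ?_
    rw [mem_patch, hV, Finset.mem_biUnion]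
    exact ⟨fun h => ⟨h, p, h⟩, fun h => h.1⟩
  have hdg : M.penalty ηF ηΓ v (fun _ => 1) ≤ M.dgNorm ηF ηΓ v ^ 2 := by
    rw [M.dgNorm_sq v hηF' hηΓ']
    exact le_add_of_nonneg_left (Finset.sum_nonneg fun i _ => Finset.sum_nonneg fun K _ =>
      integral_nonneg fun _ => sq_nonneg _)
  calc ∑ p ∈ M.elems, M.vertexDefect v p
      ≤ ∑ p ∈ M.elems, ∑ z ∈ M.emb p, P ^ 2 * (A * L z) := Finset.sum_le_sum h1
    _ = ∑ z ∈ V, (M.patch z).card * (P ^ 2 * (A * L z)) := by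
        rw [hswap]
        simp only [Finset.sum_const, nsmul_eq_mul]
    _ ≤ ∑ z ∈ V, P * (P ^ 2 * (A * L z)) := Finset.sum_le_sum fun z _ =>
        mul_le_mul_of_nonneg_right (by linarith [hcard z])
          (mul_nonneg (sq_nonneg _) (mul_nonneg hA0.le (hL0 z)))
    _ = P ^ 3 * A * ∑ z ∈ V, L z := by
        rw [Finset.mul_sum]
        exact Finset.sum_congr rfl fun z _ => by ring
    _ ≤ P ^ 3 * A * (n * M.penalty ηF ηΓ v fun _ => 1) :=
        mul_le_mul_of_nonneg_left (M.sum_localPenalty_le v hηF' hηΓ' V) (by positivity)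
    _ ≤ P ^ 3 * A * (n * M.dgNorm ηF ηΓ v ^ 2) := by gcongr
    _ = _ := by ring

lemma sum_elems (f : (Σ _ : Fin N, Finset (E n)) → ℝ) :
    ∑ p ∈ M.elems, f p = ∑ i, ∑ K ∈ M.T i, f ⟨i, K⟩ := by
  rw [elems, Finset.sum_sigma]

lemma abs_diffPoly_le {i : Fin N} {K : Finset (E n)} {y : E n} (hy : y ∈ K) :
    |M.diffPoly v i K y| ≤ Real.sqrt (∑ y ∈ K, M.diffPoly v i K y ^ 2) := by
  rw [← Real.sqrt_sq_eq_abs]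
  exact Real.sqrt_le_sqrt (Finset.single_le_sum (f := fun y => M.diffPoly v i K y ^ 2)
    (fun _ _ => sq_nonneg _) hy)

lemma sq_sqrt_diffPoly (i : Fin N) (K : Finset (E n)) :
    Real.sqrt (∑ y ∈ K, M.diffPoly v i K y ^ 2) ^ 2 = ∑ y ∈ K, M.diffPoly v i K y ^ 2 :=
  Real.sq_sqrt (Finset.sum_nonneg fun _ _ => sq_nonneg _)

lemma nonempty_of_mem {i : Fin N} {K : Finset (E n)} (hK : K ∈ M.T i) : K.Nonempty :=
  Finset.card_pos.1 (by rw [M.card_eq i K hK]; omega)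

/-- The defect carries `size K ^ n / size K ^ 2`, whereas the integral scales like `size K ^ n`; the
spare `size K ^ 2` is at most `M.h ^ 2`. -/
lemma integral_enrich_sub_sq_le (hn : 0 < n) {v : Fin N → E n → ℝ} (hv : M.MemV v) (i : Fin N) :
    ∫ x in G.Ω i, (M.enrich v i x - v i x) ^ 2 ≤
      ∑ K ∈ M.T i, volume.real (Metric.ball (0 : E n) 1) * M.h ^ 2 * M.vertexDefect v ⟨i, K⟩ := by
  have hae : ∀ K ∈ M.T i, (fun x => (M.enrich v i x - v i x) ^ 2)
      =ᵐ[volume.restrict (convexHull ℝ (K : Set (E n)))] fun x => M.diffPoly v i K x ^ 2 := by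
    intro K hK
    filter_upwards [M.agreesOn_enrich v hK, agreesOn_elemPoly ((hv i).2 K hK)] with x h1 h2
    rw [h1, h2]
    rfl
  refine (setIntegral_le_sum (subset_closure.trans (M.cover i).ge) (fun x => sq_nonneg _)
    fun K hK => (integrableOn_affine_sq _ K).congr (hae K hK).symm).trans ?_
  refine Finset.sum_le_sum fun K hK => ?_
  have hs : 0 < size K := M.size_pos (p := ⟨i, K⟩) hn (M.mk_mem_elems.2 hK)
  have hh : size K ≤ M.h := M.size_le_h (p := ⟨i, K⟩) (M.mk_mem_elems.2 hK)
  rw [integral_congr_ae (hae K hK)]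
  refine (setIntegral_affine_sq_le (M.nonempty_of_mem hK)
    fun y hy => M.abs_diffPoly_le v hy).trans ?_
  rw [sq_sqrt_diffPoly]
  have h0 := M.vertexDefect_nonneg v ⟨i, K⟩
  calc _ = volume.real (Metric.ball (0 : E n) 1) * size K ^ 2 * M.vertexDefect v ⟨i, K⟩ := by
        rw [vertexDefect]
        field_simp
    _ ≤ _ := by gcongr

/-- The gradient is that of `v` plus that of `diffPoly`; squaring the sum costs a factor 2, which
turns the 4 of `setIntegral_affineGrad_sq_le` into 8. -/
lemma integral_weakGrad_enrich_sq_le (hn : 0 < n) {ρ : ℝ} (hρ : 0 < ρ) (hM : M.ShapeRegular ρ)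
    (i : Fin N) :
    ∫ x in G.Ω i, ‖weakGrad (G.Ω i) (M.enrich v i) x‖ ^ 2 ≤
      ∑ K ∈ M.T i, (2 * (∫ _ in convexHull ℝ (K : Set (E n)),
        ‖affineGrad (elemPoly (v i) K)‖ ^ 2) +
        8 * ρ ^ 2 * volume.real (Metric.ball (0 : E n) 1) * M.vertexDefect v ⟨i, K⟩) := by
  have hΩ := (G.polytopal i).isOpen
  have h1 : ∫ x in G.Ω i, ‖weakGrad (G.Ω i) (M.enrich v i) x‖ ^ 2 =
      ∫ x in G.Ω i, ‖∇ (M.enrich v i) x‖ ^ 2 := by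
    refine integral_congr_ae ?_
    filter_upwards [(M.hasWeakGradient_enrich v i).weakGrad_ae_eq hΩ] with x hx
    rw [hx]
  have hae : ∀ K ∈ M.T i, (fun x => ‖∇ (M.enrich v i) x‖ ^ 2)
      =ᵐ[volume.restrict (convexHull ℝ (K : Set (E n)))]
        fun _ => ‖affineGrad (M.enrichPoly v i K)‖ ^ 2 := by
    intro K hK
    rw [EventuallyEq, ae_restrict_iff' (measurableSet_convexHull K)]
    filter_upwards [measure_eq_zero_iff_ae_notMem.1
      ((convex_convexHull ℝ (K : Set (E n))).addHaar_frontier volume)] with x hx hxK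
    have hxi : x ∈ interior (convexHull ℝ (K : Set (E n))) := by
      by_contra hni
      exact hx ⟨subset_closure hxK, hni⟩
    rw [(hasGradientAt_piecewise (fun _ hK _ hx => M.enrich_apply v hK hx) hK hxi).gradient]
  rw [h1]
  refine (setIntegral_le_sum (subset_closure.trans (M.cover i).ge) (fun x => sq_nonneg _)
    fun K hK => (integrableOn_const (volume_convexHull_ne_top K)).congr (hae K hK).symm).trans ?_
  refine Finset.sum_le_sum fun K hK => ?_
  have hs : 0 < size K := M.size_pos (p := ⟨i, K⟩) hn (M.mk_mem_elems.2 hK)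
  obtain ⟨c, hc⟩ := hM.1 ⟨i, K⟩ (M.mk_mem_elems.2 hK)
  have h2 := setIntegral_affineGrad_sq_le (q := M.diffPoly v i K) (M.nonempty_of_mem hK) hρ hs hc
    fun y hy => M.abs_diffPoly_le v hy
  rw [sq_sqrt_diffPoly] at h2
  rw [integral_congr_ae (hae K hK)]
  calc ∫ _ in convexHull ℝ (K : Set (E n)), ‖affineGrad (M.enrichPoly v i K)‖ ^ 2
      ≤ 2 * (∫ _ in convexHull ℝ (K : Set (E n)), ‖affineGrad (elemPoly (v i) K)‖ ^ 2) +
        2 * ∫ _ in convexHull ℝ (K : Set (E n)), ‖affineGrad (M.diffPoly v i K)‖ ^ 2 := by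
        simp only [setIntegral_const, smul_eq_mul]
        have h3 : ‖affineGrad (M.enrichPoly v i K)‖ ^ 2 ≤
            2 * ‖affineGrad (elemPoly (v i) K)‖ ^ 2 + 2 * ‖affineGrad (M.diffPoly v i K)‖ ^ 2 := by
          rw [affineGrad_enrichPoly]
          have h4 := pow_le_pow_left₀ (norm_nonneg _) (norm_add_le
            (affineGrad (elemPoly (v i) K)) (affineGrad (M.diffPoly v i K))) 2
          nlinarith [sq_nonneg (‖affineGrad (elemPoly (v i) K)‖ - ‖affineGrad (M.diffPoly v i K)‖)]
        have h5 := mul_le_mul_of_nonneg_left h3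
          (measureReal_nonneg (μ := volume) (s := convexHull ℝ (K : Set (E n))))
        linarith
    _ ≤ _ := by
        have : M.vertexDefect v ⟨i, K⟩ =
          size K ^ n / size K ^ 2 * ∑ y ∈ K, M.diffPoly v i K y ^ 2 := rfl
        rw [this]
        linarith

end Network.Mesh
end HyperDG

end

/-! ### The theorem. -/

theorem mainTheorem4 (n d N : ℕ) (hn : n = 1 ∨ n = 2) (G : HyperDG.Network n d N)
    (ρ η₀ : ℝ) (hρ : 0 < ρ) (hη₀ : 0 < η₀) :
    ∃ C : ℝ, 0 < C ∧ ∀ M : G.Mesh, M.ShapeRegular ρ →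
      ∀ (ηF : Fin N → Finset (HyperDG.E d) → ℝ) (ηΓ : Set (HyperDG.E d) → ℝ),
      (∀ i F, η₀ ≤ ηF i F) → (∀ γ, η₀ ≤ ηΓ γ) →
      ∀ v : Fin N → HyperDG.E n → ℝ, M.MemV v →
        (M.MemV (M.enrich v) ∧ G.MemH10 (M.enrich v)) ∧
        (∀ z ∈ M.nodes, ∀ p ∈ M.patch z,
          M.val (M.enrich v) p.1 p.2 z =
            (∑ q ∈ M.patch z, M.val v q.1 q.2 z) / ((M.patch z).card : ℝ)) ∧
        Real.sqrt (∑ i, ∫ x in G.Ω i, (M.enrich v i x - v i x) ^ 2) ≤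
          C * M.h * M.dgNorm ηF ηΓ v ∧
        Real.sqrt (∑ i, ∫ x in G.Ω i,
            ‖HyperDG.weakGrad (G.Ω i) (M.enrich v i) x‖ ^ 2) ≤
          C * M.dgNorm ηF ηΓ v := by
  have hn0 : 0 < n := by omega
  set V := volume.real (Metric.ball (0 : HyperDG.E n) 1) with hV
  have hV0 : 0 ≤ V := measureReal_nonneg
  set S : ℝ := (N * ρ ^ n + 1) ^ 3 * (32 * max 1 ρ / η₀) * n with hS
  have hS0 : 0 ≤ S := by positivity
  -- `C ^ 2` has to dominate `V * S` and `2 + 8 * ρ ^ 2 * V * S`. Both are at most `C`, and `C ≤ C ^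
  -- 2` because of the summand 2.
  set C : ℝ := 2 + V * S + 8 * ρ ^ 2 * V * S with hC
  have hCVS : V * S ≤ C ^ 2 ∧ 2 + 8 * ρ ^ 2 * V * S ≤ C ^ 2 := by
    have h1 : 0 ≤ V * S := mul_nonneg hV0 hS0
    have h2 : 0 ≤ 8 * ρ ^ 2 * V * S := by positivity
    have h3 : C ≤ C ^ 2 := by nlinarith
    constructor <;> linarith
  refine ⟨C, by positivity, fun M hM ηF ηΓ hηF hηΓ v hv => ?_⟩
  have hdg := M.sum_vertexDefect_le v hn hρ hM hη₀ hηF hηΓ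
  have hdg0 : 0 ≤ M.dgNorm ηF ηΓ v := Real.sqrt_nonneg _
  have hh0 : 0 ≤ M.h := Real.iSup_nonneg fun _ => HyperDG.size_nonneg _
  rw [← hS, M.sum_elems] at hdg
  refine ⟨⟨M.memV_enrich v, M.memH10_enrich v hn⟩, fun z hz p hp => ?_, ?_, ?_⟩
  · rw [M.val_enrich v hp, HyperDG.Network.Mesh.nodeVal, if_pos hz,
      HyperDG.Network.Mesh.nodalAvg, inv_mul_eq_div]
  · refine Real.sqrt_le_iff.2 ⟨by positivity, ?_⟩
    calc ∑ i, ∫ x in G.Ω i, (M.enrich v i x - v i x) ^ 2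
        ≤ ∑ i, ∑ K ∈ M.T i, V * M.h ^ 2 * M.vertexDefect v ⟨i, K⟩ :=
          Finset.sum_le_sum fun i _ => M.integral_enrich_sub_sq_le hn0 hv i
      _ = V * M.h ^ 2 * ∑ i, ∑ K ∈ M.T i, M.vertexDefect v ⟨i, K⟩ := by
          simp only [Finset.mul_sum]
      _ ≤ V * M.h ^ 2 * (S * M.dgNorm ηF ηΓ v ^ 2) :=
          mul_le_mul_of_nonneg_left hdg (by positivity)
      _ = V * S * (M.h ^ 2 * M.dgNorm ηF ηΓ v ^ 2) := by ring
      _ ≤ C ^ 2 * (M.h ^ 2 * M.dgNorm ηF ηΓ v ^ 2) :=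
          mul_le_mul_of_nonneg_right hCVS.1 (by positivity)
      _ = (C * M.h * M.dgNorm ηF ηΓ v) ^ 2 := by ring
  · refine Real.sqrt_le_iff.2 ⟨by positivity, ?_⟩
    have hsq := M.dgNorm_sq v (fun i F => hη₀.le.trans (hηF i F)) fun γ => hη₀.le.trans (hηΓ γ)
    have hpen := M.penalty_nonneg v (fun i F => hη₀.le.trans (hηF i F))
      (fun γ => hη₀.le.trans (hηΓ γ)) (c := fun _ => 1) fun _ => zero_le_one
    calc ∑ i, ∫ x in G.Ω i, ‖HyperDG.weakGrad (G.Ω i) (M.enrich v i) x‖ ^ 2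
        ≤ ∑ i, ∑ K ∈ M.T i, (2 * (∫ _ in convexHull ℝ (K : Set (HyperDG.E n)),
            ‖HyperDG.affineGrad (HyperDG.elemPoly (v i) K)‖ ^ 2) +
            8 * ρ ^ 2 * V * M.vertexDefect v ⟨i, K⟩) :=
          Finset.sum_le_sum fun i _ => M.integral_weakGrad_enrich_sq_le v hn0 hρ hM i
      _ = 2 * (∑ i, ∑ K ∈ M.T i, ∫ _ in convexHull ℝ (K : Set (HyperDG.E n)),
            ‖HyperDG.affineGrad (HyperDG.elemPoly (v i) K)‖ ^ 2) +
          8 * ρ ^ 2 * V * ∑ i, ∑ K ∈ M.T i, M.vertexDefect v ⟨i, K⟩ := by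
          simp only [Finset.mul_sum, Finset.sum_add_distrib]
      _ ≤ 2 * M.dgNorm ηF ηΓ v ^ 2 + 8 * ρ ^ 2 * V * (S * M.dgNorm ηF ηΓ v ^ 2) :=
          add_le_add (by linarith) (mul_le_mul_of_nonneg_left hdg (by positivity))
      _ = (2 + 8 * ρ ^ 2 * V * S) * M.dgNorm ηF ηΓ v ^ 2 := by ring
      _ ≤ C ^ 2 * M.dgNorm ηF ηΓ v ^ 2 :=
          mul_le_mul_of_nonneg_right hCVS.2 (sq_nonneg _)
      _ = (C * M.dgNorm ηF ηΓ v) ^ 2 := by ring
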